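/- Let $k=\mathbb F_q$ be a finite field, $\bar k$ an algebraic closure, $\hat G=\mathrm{Gal}(\bar k/k)$, and $G\subseteq\hat G$ the subgroup generated by the Frobenius $\varphi:x\mapsto x^q$. Let $X$ be a scheme of finite type over $k$ and $\bar X=X\times_k\bar k$, on which $\hat G$ acts. For $U\to\bar X$ étale and $g\in\hat G$ let $gU$ be $U$ with its structure map composed with the action of $g$ on $\bar X$. Let $\mathcal T_G$ be the category of étale sheaves of abelian groups $\mathcal F$ on $\bar X$ with an action of $G$, i.e. with isomorphisms $\sigma(g):\mathcal F(U)\to\mathcal F(gU)$, natural in $U$, such that $\sigma(gh)=\sigma(g)\sigma(h)$; we write $gf=\sigma(g)f$. A quasi-compact étale $U$ over $\bar X$ can be written as $U=V\times_L\bar k$ with $L\subseteq\bar k$ finite over $k$ and $V$ quasi-compact étale over $X\times_kL$; then $H_U=\mathrm{Gal}(\bar k/L)$ stabilizes $U$ (that is, $gU=U$ for $g\in H_U$, via the action on the factor $\bar k$) and so acts on sections over $U$. Let $\mathcal T_{\hat G}$ be the category of étale sheaves of abelian groups on $\bar X$ with an action of $\hat G$ which is continuous: for all such $U$, every section over $U$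 is fixed by an open subgroup of $H_U$. Let $\gamma^*:\mathcal T_{\hat G}\to\mathcal T_G$ be the restriction of the action to $G$. **Theorem.** The functor $\gamma^*$ has a right adjoint $\gamma_*$, complexes in $\mathcal T_{\hat G}$ have cohomology objects in $\mathcal T_{\hat G}$, and every object of $\mathcal T_G$ has an injective resolution. Let $\mathcal F\in\mathcal T_G$, let $\mathcal F\to I^\bullet$ be any injective resolution, and put $R\gamma_*\mathcal F=\gamma_*I^\bullet$, $R^i\gamma_*\mathcal F=H^i(\gamma_*I^\bullet)$. Then the following hold. (a) There are an object $\mathcal A$ of $\mathcal T_{\hat G}$ and an endomorphism $t$ of $\mathcal A$ such that $R\gamma_*\mathcal F$ is quasi-isomorphic, as a complex in $\mathcal T_{\hat G}$, to $\mathcal A\xrightarrow{t-1}\mathcal A$ (in degrees $0,1$), and such that for $U$ quasi-compact étale over $\bar X$ $$\mathcal A(U)\cong\operatorname{colim}_m\bigoplus_{i=0}^{m-1}\mathcal F(\varphi^iU),$$ compatibly with restriction. Here $m$ runs through the positive integers with $mG:=\langle\varphi^m\rangle\subseteq H_U$, ordered by divisibility; $f^{(i)}$ denotes $f\in\mathcal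 F(\varphi^iU)$ placed in the summand of index $i \bmod m$; the transition maps are $$\delta_m^n:\bigoplus_{i=0}^{m-1}\mathcal F(\varphi^iU)\to\bigoplus_{i=0}^{nm-1}\mathcal F(\varphi^iU),\qquad f^{(i)}\mapsto\sum_{j=0}^{n-1}f^{(i+mj)};$$ the element $g=\varphi^a$ of $G$ acts by $\mathcal A(U)\to\mathcal A(gU)$, $f^{(i)}\mapsto f^{(i-a)}$ (this determines the continuous action of $\hat G$); and $t(f^{(i)})=(\varphi f)^{(i+1)}$. (b) For $U$ quasi-compact étale over $\bar X$, the counit $\gamma^*\gamma_*\mathcal F\to\mathcal F$ identifies $\gamma_*\mathcal F(U)$ with $\operatorname{colim}_m\mathcal F(U)^{m\mathbb Z}=\bigcup_m\mathcal F(U)^{m\mathbb Z}\subseteq\mathcal F(U)$, where $m\mathbb Z$ acts through $\varphi^m$. (c) $R^1\gamma_*\mathcal F$ is, compatibly with the action of $G$, the sheaf associated with $$U\mapsto\operatorname{colim}_{m,N_m^n}\mathcal F(U)_{m\mathbb Z}$$ on quasi-compact étale $U$, with transition maps $N_m^n:\mathcal F(U)_{m\mathbb Z}\to\mathcal F(U)_{mn\mathbb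 Z}$, $f\mapsto\sum_{j=0}^{n-1}\varphi^{-jm}f$. (d) $R^i\gamma_*\mathcal F=0$ for $i>1$. -/

import Mathlib

/-!
# Weil-étale sheaves and their derived direct image on the étale site

`k` is a finite field, `kbar` an algebraic closure, `Ĝ = Gal(kbar/k)`, `G ≤ Ĝ` the subgroup
generated by the Frobenius, `X` a scheme of finite type over `k` and `X̄ = X ×ₖ kbar`.
Étale sheaves are sheaves of abelian groups on the small étale site of Mathlib.
-/

open CategoryTheory Limits AlgebraicGeometry Opposite

universe u v

noncomputable section

namespace WeilEtale

/-! ### Sheaves with an action of a group acting on the base scheme -/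

section Equivariant

variable {S : Scheme.{u}} {Γ : Type v} [Group Γ] (ρ : Γ →* Aut S)

/-- The automorphism of `S` by which `g` acts. -/
def act (g : Γ) : S ⟶ S := (ρ g).hom

instance (g : Γ) : IsIso (act ρ g) := Iso.isIso_hom (ρ g)

lemma act_comp (g h : Γ) : act ρ h ≫ act ρ g = act ρ (g * h) := by
  unfold act; rw [map_mul]; rfl

lemma act_one : act ρ 1 = 𝟙 S := by
  unfold act; rw [map_one]; rfl

/-- The structure morphism of an étale `S`-scheme. -/
def str (U : S.Etale) : U.left ⟶ S := U.hom

instance (U : S.Etale) : Etale (str U) := U.prop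

lemma str_w {U V : S.Etale} (f : U ⟶ V) : f.left ≫ str V = str U := MorphismProperty.Over.w f

/-- The étale `S`-scheme given by an étale morphism. -/
def etaleMk {U : Scheme.{u}} (f : U ⟶ S) [Etale f] : S.Etale :=
  MorphismProperty.Over.mk ⊤ f (P := @Etale) ‹Etale f›

/-- A morphism of étale `S`-schemes. -/
def etaleHom {U V : S.Etale} (f : U.left ⟶ V.left) (w : f ≫ str V = str U) : U ⟶ V :=
  MorphismProperty.Over.homMk f w

/-- The étale `S`-scheme `gU`: the scheme `U`, with structure morphism `U ⟶ S` followed by the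
automorphism by which `g` acts on `S`. -/
def twist (g : Γ) (U : S.Etale) : S.Etale := etaleMk (str U ≫ act ρ g)

/-- A morphism of schemes `f : U ⟶ V` lying over the automorphism `g` of `S` is the same thing as a
morphism `gU ⟶ V` of étale `S`-schemes. -/
def ofSemilinear (g : Γ) {U V : S.Etale} (f : U.left ⟶ V.left)
    (w : f ≫ str V = str U ≫ act ρ g) : twist ρ g U ⟶ V :=
  etaleHom (U := twist ρ g U) f w

/-- More generally, a morphism of schemes `f : U ⟶ V` over the automorphism `h⁻¹ g` of `S`
is the same thing as a morphism `gU ⟶ hV` of étale `S`-schemes. -/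
def twistHom (g h : Γ) {U V : S.Etale} (f : U.left ⟶ V.left)
    (w : f ≫ str V ≫ act ρ h = str U ≫ act ρ g) : twist ρ g U ⟶ twist ρ h V :=
  etaleHom (U := twist ρ g U) (V := twist ρ h V) f w

/-- The morphism `gU ⟶ gV` induced by a morphism `U ⟶ V`. -/
def twistMap (g : Γ) {U V : S.Etale} (f : U ⟶ V) : twist ρ g U ⟶ twist ρ g V :=
  twistHom ρ g g f.left (by rw [← Category.assoc, str_w])

/-- The canonical morphism `1U ⟶ U` (the identity of the scheme `U`). -/
def twistOne (U : S.Etale) : twist ρ 1 U ⟶ U :=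
  ofSemilinear ρ 1 (𝟙 U.left) (by rw [act_one, Category.comp_id, Category.id_comp])

/-- The canonical morphism `(gh)U ⟶ g(hU)` (the identity of the scheme `U`). -/
def twistMul (g h : Γ) (U : S.Etale) : twist ρ (g * h) U ⟶ twist ρ g (twist ρ h U) :=
  ofSemilinear ρ (g * h) (V := twist ρ g (twist ρ h U)) (𝟙 U.left)
    (by
      change 𝟙 U.left ≫ (str U ≫ act ρ h) ≫ act ρ g = _
      rw [Category.id_comp, Category.assoc, act_comp])

/-- A sheaf of abelian groups `F` on the small étale site of `S` with an action of `Γ`: a morphism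
`σ(g) : F ⟶ g^*F`, i.e. maps `σ(g) : F(U) ⟶ F(gU)` natural in `U`, for each `g`, such that
`σ(1) = 1` and `σ(gh) = σ(g)σ(h)`. (These conditions force `σ(g)` to be an isomorphism.) -/
structure EquivariantSheaf where
  sheaf : Sheaf S.smallEtaleTopology AddCommGrpCat.{u}
  σ : ∀ (g : Γ) (U : S.Etale), sheaf.obj.obj (op U) ⟶ sheaf.obj.obj (op (twist ρ g U))
  naturality : ∀ (g : Γ) {U V : S.Etale} (f : U ⟶ V),
    sheaf.obj.map f.op ≫ σ g U = σ g V ≫ sheaf.obj.map (twistMap ρ g f).op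
  σ_one : ∀ U : S.Etale, σ 1 U = sheaf.obj.map (twistOne ρ U).op
  σ_mul : ∀ (g h : Γ) (U : S.Etale),
    σ (g * h) U = σ h U ≫ σ g (twist ρ h U) ≫ sheaf.obj.map (twistMul ρ g h U).op

namespace EquivariantSheaf

variable {ρ}

/-- Morphisms of equivariant sheaves: morphisms of sheaves that commute with the action. -/
@[ext]
structure Hom (F F' : EquivariantSheaf ρ) where
  hom : F.sheaf ⟶ F'.sheaf
  comm : ∀ (g : Γ) (U : S.Etale),
    F.σ g U ≫ hom.hom.app (op (twist ρ g U)) = hom.hom.app (op U) ≫ F'.σ g U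

attribute [simp] Hom.comm

instance : Category (EquivariantSheaf ρ) where
  Hom := Hom
  id F := ⟨𝟙 _, fun g U => by simp⟩
  comp a b := ⟨a.hom ≫ b.hom, fun g U => by
    have h1 := a.comm g U
    have h2 := b.comm g U
    simp only [ObjectProperty.FullSubcategory.comp_hom, NatTrans.comp_app, Category.assoc]
    rw [← h2, ← Category.assoc, h1, Category.assoc]⟩

@[ext]
lemma hom_ext {F F' : EquivariantSheaf ρ} {a b : F ⟶ F'} (h : a.hom = b.hom) : a = b :=
  Hom.ext h

@[simp] lemma id_hom (F : EquivariantSheaf ρ) : Hom.hom (𝟙 F) = 𝟙 F.sheaf := rfl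

@[simp] lemma comp_hom {F F' F'' : EquivariantSheaf ρ} (a : F ⟶ F') (b : F' ⟶ F'') :
    Hom.hom (a ≫ b) = a.hom ≫ b.hom := rfl

section Preadditive

variable {F F' : EquivariantSheaf ρ}

instance : Zero (F ⟶ F') := ⟨⟨0, fun g U => by
  change _ ≫ 0 = 0 ≫ _
  simp⟩⟩

instance : Add (F ⟶ F') := ⟨fun a b => ⟨a.hom + b.hom, fun g U => by
  change _ ≫ (a.hom.hom.app _ + b.hom.hom.app _) = (a.hom.hom.app _ + b.hom.hom.app _) ≫ _
  rw [Preadditive.comp_add, Preadditive.add_comp, a.comm, b.comm]⟩⟩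

instance : Neg (F ⟶ F') := ⟨fun a => ⟨-a.hom, fun g U => by
  change _ ≫ (-a.hom.hom.app _) = (-a.hom.hom.app _) ≫ _
  rw [Preadditive.comp_neg, Preadditive.neg_comp, a.comm]⟩⟩

lemma add_hom (a b : F ⟶ F') : (a + b).hom = a.hom + b.hom := rfl
lemma neg_hom (a : F ⟶ F') : (-a).hom = -a.hom := rfl
lemma zero_hom : (0 : F ⟶ F').hom = 0 := rfl

instance : AddCommGroup (F ⟶ F') where
  add_assoc a b c := by ext1; simp only [add_hom, add_assoc]
  zero_add a := by ext1; simp only [add_hom, zero_hom, zero_add]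
  add_zero a := by ext1; simp only [add_hom, zero_hom, add_zero]
  add_comm a b := by ext1; simp only [add_hom, add_comm]
  neg_add_cancel a := by ext1; simp only [add_hom, neg_hom, zero_hom, neg_add_cancel]
  nsmul := nsmulRec
  zsmul := zsmulRec

instance : Preadditive (EquivariantSheaf ρ) where
  add_comp _ _ _ _ _ _ := by ext1; simp only [add_hom, comp_hom, Preadditive.add_comp]
  comp_add _ _ _ _ _ _ := by ext1; simp only [add_hom, comp_hom, Preadditive.comp_add]

end Preadditive

/-- The zero sheaf, with its unique action. -/
def zero : EquivariantSheaf ρ where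
  sheaf := ⟨(Functor.const _).obj (AddCommGrpCat.of PUnit),
    Presheaf.isSheaf_of_isTerminal _
      (AddCommGrpCat.isZero_of_subsingleton (AddCommGrpCat.of PUnit)).isTerminal⟩
  σ _ _ := 𝟙 _
  naturality _ _ _ _ := rfl
  σ_one _ := rfl
  σ_mul _ _ _ := rfl

lemma isZero_zero : IsZero (zero : EquivariantSheaf ρ) := by
  rw [IsZero.iff_id_eq_zero]
  ext1
  apply Sheaf.hom_ext
  ext U x
  exact Subsingleton.elim (α := PUnit) _ _

instance : HasZeroObject (EquivariantSheaf ρ) := ⟨_, isZero_zero⟩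

lemma σ_eq_of_eq_one (F : EquivariantSheaf ρ) {g : Γ} (hg : g = 1) (U : S.Etale)
    (w : 𝟙 U.left ≫ str U = str U ≫ act ρ g) :
    F.σ g U = F.sheaf.obj.map (ofSemilinear ρ g (𝟙 U.left) w).op := by
  subst hg; exact F.σ_one U

lemma σ_eq_of_eq_mul (F : EquivariantSheaf ρ) {c g h : Γ} (hc : c = g * h) (U : S.Etale)
    (w : 𝟙 U.left ≫ str (twist ρ g (twist ρ h U)) = str U ≫ act ρ c) :
    F.σ c U = F.σ h U ≫ F.σ g (twist ρ h U) ≫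
      F.sheaf.obj.map (ofSemilinear ρ c (V := twist ρ g (twist ρ h U)) (𝟙 U.left) w).op := by
  subst hc; exact F.σ_mul g h U

/-- Restriction of the action along a group homomorphism `i : Γ' →* Γ`. -/
def restrict {Γ' : Type v} [Group Γ'] (i : Γ' →* Γ) :
    EquivariantSheaf ρ ⥤ EquivariantSheaf (ρ.comp i) where
  obj F :=
    { sheaf := F.sheaf
      σ g U := F.σ (i g) U
      naturality g _ _ f := F.naturality (i g) f
      σ_one U := F.σ_eq_of_eq_one (map_one i) U _
      σ_mul g h U := F.σ_eq_of_eq_mul (map_mul i g h) U _ }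
  map a := ⟨a.hom, fun g U => a.comm (i g) U⟩

/-- The group of sections `F(U)`. -/
abbrev sec (F : EquivariantSheaf ρ) (U : S.Etale) : Type u := F.sheaf.obj.obj (op U)

/-- The restriction `F(V) ⟶ F(U)` along a morphism `U ⟶ V`. -/
def res (F : EquivariantSheaf ρ) {U V : S.Etale} (f : U ⟶ V) : F.sec V →+ F.sec U :=
  (F.sheaf.obj.map f.op).hom

/-- The action `σ(g) : F(U) ⟶ F(gU)`. -/
def smul (F : EquivariantSheaf ρ) (g : Γ) (U : S.Etale) : F.sec U →+ F.sec (twist ρ g U) :=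
  (F.σ g U).hom

/-- The action of an element `g` of the stabilizer of `U` on `F(U)`: given an identification
`a : U ⟶ gU`, it is the composition of `σ(g) : F(U) ⟶ F(gU)` with `F(gU) ⟶ F(U)`. -/
def stabSmul (F : EquivariantSheaf ρ) (g : Γ) (U : S.Etale) (a : U.left ⟶ U.left)
    (w : a ≫ str U ≫ act ρ g = str U) : F.sec U →+ F.sec U :=
  (F.res (etaleHom (V := twist ρ g U) a w)).comp (F.smul g U)

lemma res_res (F : EquivariantSheaf ρ) {U V W : S.Etale} (f : U ⟶ V) (g : V ⟶ W) (x : F.sec W) :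
    F.res f (F.res g x) = F.res (f ≫ g) x := by
  simp [res]

lemma smul_res (F : EquivariantSheaf ρ) (g : Γ) {U V : S.Etale} (f : U ⟶ V) (x : F.sec V) :
    F.smul g U (F.res f x) = F.res (twistMap ρ g f) (F.smul g V x) :=
  ConcreteCategory.congr_hom (F.naturality g f) x

lemma smul_mul (F : EquivariantSheaf ρ) (g h : Γ) (U : S.Etale) (x : F.sec U) :
    F.smul (g * h) U x = F.res (twistMul ρ g h U) (F.smul g _ (F.smul h U x)) :=
  ConcreteCategory.congr_hom (F.σ_mul g h U) x

lemma stabSmul_mul (F : EquivariantSheaf ρ) {g h c : Γ} (U : S.Etale) {a b d : U.left ⟶ U.left}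
    (ha : a ≫ str U ≫ act ρ g = str U) (hb : b ≫ str U ≫ act ρ h = str U)
    (hd : d ≫ str U ≫ act ρ c = str U) (hc : c = g * h) (e : d = a ≫ b) (x : F.sec U) :
    F.stabSmul c U d hd x = F.stabSmul g U a ha (F.stabSmul h U b hb x) := by
  subst hc e
  simp only [stabSmul, AddMonoidHom.comp_apply, smul_mul, smul_res, res_res]
  rfl

end EquivariantSheaf
end Equivariant

/-! ### The geometric situation -/

section Geometry

variable {k : Type u} [Field k] (kbar : Type u) [Field kbar] [Algebra k kbar]
variable {X : Scheme.{u}} (p : X ⟶ Spec (CommRingCat.of k))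

/-- `Spec A ⟶ Spec k` for a `k`-algebra `A`. -/
abbrev specMap (A : Type u) [CommRing A] [Algebra k A] :
    Spec (CommRingCat.of A) ⟶ Spec (CommRingCat.of k) :=
  Spec.map (CommRingCat.ofHom (algebraMap k A))

/-- The base change `X ×ₖ A`. -/
abbrev baseChange (A : Type u) [CommRing A] [Algebra k A] : Scheme.{u} := pullback p (specMap A)

/-- The morphism `X ×ₖ B ⟶ X ×ₖ A` induced by a homomorphism of `k`-algebras `A ⟶ B`. -/
def baseChangeMap {A B : Type u} [CommRing A] [Algebra k A] [CommRing B] [Algebra k B]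
    (f : A →ₐ[k] B) : baseChange p B ⟶ baseChange p A :=
  pullback.lift (pullback.fst _ _)
    (pullback.snd _ _ ≫ Spec.map (CommRingCat.ofHom f.toRingHom))
    (by rw [Category.assoc, ← Spec.map_comp, ← CommRingCat.ofHom_comp, pullback.condition]
        exact congrArg (fun x => pullback.snd p (specMap B) ≫ Spec.map (CommRingCat.ofHom x))
          f.comp_algebraMap.symm)

lemma baseChangeMap_fst {A B : Type u} [CommRing A] [Algebra k A] [CommRing B] [Algebra k B]
    (f : A →ₐ[k] B) : baseChangeMap p f ≫ pullback.fst _ _ = pullback.fst _ _ :=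
  pullback.lift_fst _ _ _

lemma baseChangeMap_snd {A B : Type u} [CommRing A] [Algebra k A] [CommRing B] [Algebra k B]
    (f : A →ₐ[k] B) : baseChangeMap p f ≫ pullback.snd _ _ =
      pullback.snd _ _ ≫ Spec.map (CommRingCat.ofHom f.toRingHom) :=
  pullback.lift_snd _ _ _

lemma baseChangeMap_comp {A B C : Type u} [CommRing A] [Algebra k A] [CommRing B] [Algebra k B]
    [CommRing C] [Algebra k C] (f : A →ₐ[k] B) (g : B →ₐ[k] C) :
    baseChangeMap p g ≫ baseChangeMap p f = baseChangeMap p (g.comp f) := by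
  apply pullback.hom_ext
  · rw [Category.assoc, baseChangeMap_fst, baseChangeMap_fst, baseChangeMap_fst]
  · rw [Category.assoc, baseChangeMap_snd, baseChangeMap_snd, ← Category.assoc, baseChangeMap_snd,
      Category.assoc, ← Spec.map_comp, ← CommRingCat.ofHom_comp]
    rfl

lemma baseChangeMap_id {A : Type u} [CommRing A] [Algebra k A] :
    baseChangeMap p (AlgHom.id k A) = 𝟙 _ := by
  apply pullback.hom_ext
  · rw [baseChangeMap_fst, Category.id_comp]
  · rw [baseChangeMap_snd, Category.id_comp]
    exact (congrArg _ (Spec.map_id _)).trans (Category.comp_id _)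

lemma baseChangeMap_inv {A : Type u} [CommRing A] [Algebra k A] {f g : A →ₐ[k] A}
    (h : g.comp f = AlgHom.id k A) : baseChangeMap p g ≫ baseChangeMap p f = 𝟙 _ := by
  rw [baseChangeMap_comp, h, baseChangeMap_id]

/-- `X̄ = X ×ₖ kbar`. -/
abbrev Xbar : Scheme.{u} := baseChange p kbar

/-- The (left) action of `Ĝ` on `X̄`: `g` acts by `1 × Spec(g⁻¹)`. -/
def galAction : Gal(kbar/k) →* Aut (Xbar kbar p) where
  toFun g :=
    { hom := baseChangeMap p (g⁻¹ : Gal(kbar/k)).toAlgHom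
      inv := baseChangeMap p g.toAlgHom
      hom_inv_id := baseChangeMap_inv p (AlgHom.ext fun x => g.symm_apply_apply x)
      inv_hom_id := baseChangeMap_inv p (AlgHom.ext fun x => g.apply_symm_apply x) }
  map_one' := Iso.ext (baseChangeMap_id p)
  map_mul' g h := Iso.ext (by
    refine Eq.trans ?_ (baseChangeMap_comp p (g⁻¹ : Gal(kbar/k)).toAlgHom
      (h⁻¹ : Gal(kbar/k)).toAlgHom).symm
    congr 1)

/-- The projection `X̄ ⟶ X ×ₖ L` for an intermediate field `L`. -/
def toLevel (L : IntermediateField k kbar) : Xbar kbar p ⟶ baseChange p L :=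
  baseChangeMap p L.val

lemma act_toLevel (L : IntermediateField k kbar) {g : Gal(kbar/k)} (hg : g ∈ L.fixingSubgroup) :
    act (galAction kbar p) g ≫ toLevel kbar p L = toLevel kbar p L := by
  change baseChangeMap p _ ≫ baseChangeMap p _ = baseChangeMap p _
  rw [baseChangeMap_comp]
  congr 1
  ext x
  exact (L.mem_fixingSubgroup_iff (g⁻¹)).1 (inv_mem hg) x x.2

/-- A quasi-compact étale `X̄`-scheme together with a model `π : V ⟶ X ×ₖ L`, over a finite
subextension `L` of `kbar/k`. Every quasi-compact étale `X̄`-scheme has such a model. -/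
structure Model where
  L : IntermediateField k kbar
  finite : FiniteDimensional k L
  V : Scheme.{u}
  π : V ⟶ baseChange p L
  etale : Etale π
  compact : CompactSpace V

namespace Model

variable {kbar p}
variable (P : Model kbar p)

instance : Etale P.π := P.etale

/-- The scheme `V ×_L kbar`. -/
def total : Scheme.{u} := pullback P.π (toLevel kbar p P.L)

/-- The projection `V ×_L kbar ⟶ V`. -/
def fst : P.total ⟶ P.V := pullback.fst P.π (toLevel kbar p P.L)

/-- The projection `V ×_L kbar ⟶ X ×ₖ kbar`. -/
def snd : P.total ⟶ Xbar kbar p := pullback.snd P.π (toLevel kbar p P.L)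

instance : Etale P.snd := inferInstanceAs (Etale (pullback.snd P.π (toLevel kbar p P.L)))

/-- The étale `X̄`-scheme `U = V ×_L kbar`. -/
def U : (Xbar kbar p).Etale := etaleMk P.snd

/-- The stabilizer `H_U = Gal(kbar/L)` of `U`. -/
abbrev stab : Subgroup Gal(kbar/k) := P.L.fixingSubgroup

/-- The automorphism of `U = V ×_L kbar` given by the action of `g ∈ Gal(kbar/L)` on the
second factor. -/
def alphaTotal (g : P.stab) : P.total ⟶ P.total :=
  pullback.lift P.fst (P.snd ≫ act (galAction kbar p) g)
    (by rw [Category.assoc, act_toLevel kbar p P.L g.2]; exact pullback.condition)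

lemma alphaTotal_fst (g : P.stab) : P.alphaTotal g ≫ P.fst = P.fst :=
  pullback.lift_fst _ _ _

lemma alphaTotal_snd (g : P.stab) : P.alphaTotal g ≫ P.snd = P.snd ≫ act (galAction kbar p) g :=
  pullback.lift_snd _ _ _

lemma alphaTotal_mul (g h : P.stab) : P.alphaTotal (g * h) = P.alphaTotal h ≫ P.alphaTotal g := by
  apply pullback.hom_ext (f := P.π) (g := toLevel kbar p P.L)
  · change _ ≫ P.fst = _ ≫ P.fst
    rw [Category.assoc, alphaTotal_fst, alphaTotal_fst, alphaTotal_fst]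
  · change _ ≫ P.snd = _ ≫ P.snd
    rw [Category.assoc, alphaTotal_snd, alphaTotal_snd, ← Category.assoc, alphaTotal_snd,
      Category.assoc, act_comp]
    rfl

/-- The identification of `gU` with `U` for `g` in the stabilizer. -/
def alpha (g : P.stab) : P.U.left ⟶ P.U.left := P.alphaTotal g

lemma alpha_w (g : P.stab) : P.alpha g ≫ str P.U = str P.U ≫ act (galAction kbar p) g :=
  P.alphaTotal_snd g

lemma alpha_mul (g h : P.stab) : P.alpha (g * h) = P.alpha h ≫ P.alpha g := P.alphaTotal_mul g h

lemma alpha_inv_w (g : Gal(kbar/k)) (hg : g ∈ P.stab) :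
    P.alpha ⟨g⁻¹, inv_mem hg⟩ ≫ str P.U ≫ act (galAction kbar p) g = str P.U := by
  rw [← Category.assoc, alpha_w, Category.assoc, act_comp, mul_inv_cancel, act_one,
    Category.comp_id]

end Model

variable (k) [Finite k] [IsAlgClosure k kbar]

/-- The Frobenius `φ : x ↦ x ^ q` in `Ĝ = Gal(kbar/k)`, where `q` is the cardinality of `k`. -/
def frob : Gal(kbar/k) :=
  letI := Fintype.ofFinite k
  haveI : Algebra.IsAlgebraic k kbar := IsAlgClosure.isAlgebraic
  FiniteField.frobeniusAlgEquivOfAlgebraic k kbar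

/-- The group `G`: the subgroup of `Ĝ` generated by the Frobenius. -/
abbrev weilGroup : Subgroup Gal(kbar/k) := Subgroup.zpowers (frob k kbar)

/-- The Frobenius as an element of `G`. -/
def frobG : weilGroup k kbar := ⟨frob k kbar, Subgroup.mem_zpowers _⟩

lemma frobG_zpow (m : ℤ) : ((frobG k kbar ^ m : weilGroup k kbar) : Gal(kbar/k)) = frob k kbar ^ m :=
  rfl

variable {k}

/-! ### The categories of Weil-étale and of étale sheaves -/

/-- The action of `G` on `X̄`. -/
abbrev weilAction : weilGroup k kbar →* Aut (Xbar kbar p) :=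
  (galAction kbar p).comp (weilGroup k kbar).subtype

/-- The category `𝒯_G` of étale sheaves on `X̄` with an action of `G`. -/
abbrev TG := EquivariantSheaf (weilAction kbar p)

variable {kbar p} in
/-- The action of `Ĝ` on `F` is continuous: for every quasi-compact étale `U` over `X̄`, the
stabilizer `H_U` acts continuously on the discrete group `F(U)`, i.e. every section is fixed
by an open subgroup. -/
def IsContinuous : ObjectProperty (EquivariantSheaf (galAction kbar p)) := fun F =>
  ∀ (P : Model kbar p) (s : F.sec P.U), ∃ N : Subgroup Gal(kbar/k), IsOpen (N : Set Gal(kbar/k)) ∧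
    ∀ g ∈ N, ∀ hg : g ∈ P.stab,
      F.stabSmul g P.U (P.alpha ⟨g⁻¹, inv_mem hg⟩) (P.alpha_inv_w g hg) s = s

/-- The category `𝒯_Ĝ` of étale sheaves on `X̄` with a continuous action of `Ĝ`. -/
abbrev TGhat := (IsContinuous (kbar := kbar) (p := p)).FullSubcategory

instance : HasZeroObject (TGhat kbar p) :=
  ⟨⟨EquivariantSheaf.zero, fun _ _ => ⟨⊤, isOpen_univ, fun _ _ _ =>
    Subsingleton.elim (α := PUnit) _ _⟩⟩, by
    rw [IsZero.iff_id_eq_zero]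
    apply ObjectProperty.hom_ext
    exact EquivariantSheaf.isZero_zero.eq_of_src _ _⟩

/-- The functor `γ^* : 𝒯_Ĝ ⥤ 𝒯_G` restricting the action from `Ĝ` to `G`. -/
def gammaUpper : TGhat kbar p ⥤ TG kbar p :=
  ObjectProperty.ι _ ⋙ EquivariantSheaf.restrict (weilGroup k kbar).subtype

/-- The functor `γ_* : 𝒯_G ⥤ 𝒯_Ĝ`, the right adjoint of `γ^*`. -/
abbrev gammaLower [(gammaUpper kbar p).IsLeftAdjoint] : TG kbar p ⥤ TGhat kbar p :=
  (gammaUpper kbar p).rightAdjoint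

/-- The complex `Rγ_* F`, computed by an injective resolution `I` of `F`. -/
abbrev RGamma [(gammaUpper kbar p).IsLeftAdjoint] {F : TG kbar p} (I : InjectiveResolution F) :
    CochainComplex (TGhat kbar p) ℕ :=
  ((gammaLower kbar p).mapHomologicalComplex _).obj I.cocomplex

/-- Two complexes are quasi-isomorphic if they are isomorphic in the derived category, i.e. if they
are connected by a roof of quasi-isomorphisms. -/
def QuasiIsomorphic {C : Type*} [Category C] [Preadditive C] [CategoryWithHomology C]
    (K L : CochainComplex C ℕ) : Prop :=
  ∃ (M : CochainComplex C ℕ) (α : K ⟶ M) (β : L ⟶ M), QuasiIso α ∧ QuasiIso β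

/-- The complex `A ⟶ B` in degrees `0` and `1`. -/
abbrev twoTerm {C : Type*} [Category C] [Preadditive C] [HasZeroObject C] {A B : C} (f : A ⟶ B) :
    CochainComplex C ℕ :=
  HomologicalComplex.double f (c := ComplexShape.up ℕ) (i₀ := 0) (i₁ := 1) (by simp)

namespace Model

variable {kbar p}
variable (P Q : Model kbar p) (F : TG kbar p)

/-- The object `φ^i U`. -/
abbrev phiU (i : ℤ) : (Xbar kbar p).Etale := twist (weilAction kbar p) (frobG k kbar ^ i) P.U

/-- For `φ^(j-i)` in the stabilizer of `U`: the isomorphism `F(φ^i U) ⟶ F(φ^j U)` given by the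
identification `φ^j U = φ^i (φ^(j-i) U) = φ^i U`. -/
def transport {i j : ℤ} (h : frob k kbar ^ (j - i) ∈ P.stab) :
    F.sec (P.phiU i) →+ F.sec (P.phiU j) :=
  F.res (twistHom (weilAction kbar p) (frobG k kbar ^ j) (frobG k kbar ^ i) (P.alpha ⟨_, h⟩)
    (by
      change _ ≫ _ ≫ act (galAction kbar p) (frob k kbar ^ i) =
        _ ≫ act (galAction kbar p) (frob k kbar ^ j)
      rw [← Category.assoc, alpha_w, Category.assoc, act_comp, ← zpow_add]
      congr 3
      omega))

/-- The map `φ : F(φ^i U) ⟶ F(φ^(i+1) U)`. -/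
def phi (i : ℤ) : F.sec (P.phiU i) →+ F.sec (P.phiU (i + 1)) :=
  (F.res (ofSemilinear (weilAction kbar p) (frobG k kbar ^ (i + 1))
    (V := twist (weilAction kbar p) (frobG k kbar) (P.phiU i)) (𝟙 P.U.left)
    (by
      change 𝟙 _ ≫ (str P.U ≫ act (weilAction kbar p) _) ≫ act (weilAction kbar p) _ = _
      rw [Category.id_comp, Category.assoc, act_comp, ← zpow_one_add, add_comm]))).comp
    (F.smul (frobG k kbar) (P.phiU i))

/-- The action of an element `φ^m` of the stabilizer of `U` on `F(U)`. -/
def frobAct (m : ℤ) (h : frob k kbar ^ m ∈ P.stab) : F.sec P.U →+ F.sec P.U :=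
  F.stabSmul (frobG k kbar ^ m) P.U (P.alpha ⟨_, inv_mem h⟩) (P.alpha_inv_w _ h)

lemma frobAct_frobAct {m n l : ℤ} (hm : frob k kbar ^ m ∈ P.stab) (hn : frob k kbar ^ n ∈ P.stab)
    (hl : frob k kbar ^ l ∈ P.stab) (e : l = m + n) (x : F.sec P.U) :
    P.frobAct F m hm (P.frobAct F n hn x) = P.frobAct F l hl x := by
  subst e
  refine (F.stabSmul_mul P.U _ _ _ (zpow_add _ _ _) ?_ x).symm
  rw [← alpha_mul]
  congr 1
  apply Subtype.ext
  change (frob k kbar ^ (m + n))⁻¹ = (frob k kbar ^ n)⁻¹ * (frob k kbar ^ m)⁻¹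
  rw [zpow_add, mul_inv_rev]

lemma frobAct_congr {m n : ℤ} (hm : frob k kbar ^ m ∈ P.stab) (hn : frob k kbar ^ n ∈ P.stab)
    (e : m = n) (x : F.sec P.U) : P.frobAct F m hm x = P.frobAct F n hn x := by
  subst e; rfl

/-- The positive integers `n` such that `nG` is contained in the stabilizer of `U`, ordered by
divisibility. -/
structure Level where
  val : ℕ
  pos : 0 < val
  mem : frob k kbar ^ val ∈ P.stab

instance : Preorder P.Level where
  le n m := n.val ∣ m.val
  le_refl n := dvd_refl _
  le_trans _ _ _ := dvd_trans

instance : DecidableEq P.Level := Classical.decEq _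

variable {P} in
lemma Level.zpow_mem (n : P.Level) {i : ℤ} (h : (n.val : ℤ) ∣ i) : frob k kbar ^ i ∈ P.stab := by
  obtain ⟨c, rfl⟩ := h
  rw [zpow_mul, zpow_natCast]
  exact Subgroup.zpow_mem _ n.mem c

/-! ### The system `⊕_{i<n} F(φ^i U)` -/

/-- The group `⊕_{i=0}^{n-1} F(φ^i U)`. -/
abbrev Sum (n : P.Level) : Type u := ∀ i : Fin n.val, F.sec (P.phiU ((i : ℕ) : ℤ))

/-- For `i ∈ ℤ` and `f ∈ F(φ^i U)`, the element `f^{(i)}` of `⊕_{i=0}^{n-1} F(φ^i U)`: the element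
`f` in the summand of index `i mod n`. -/
def entry (n : P.Level) (i : ℤ) : F.sec (P.phiU i) →+ P.Sum F n :=
  (AddMonoidHom.single (fun i : Fin n.val => F.sec (P.phiU ((i : ℕ) : ℤ)))
    ⟨(i % n.val).toNat, by
      have := n.pos
      have h1 := Int.emod_nonneg i (b := n.val) (by omega)
      have h2 := Int.emod_lt_of_pos i (b := n.val) (by omega)
      omega⟩).comp
    (P.transport F (n.zpow_mem (by
      have := n.pos
      have h1 := Int.emod_nonneg i (b := n.val) (by omega)
      have h2 := Int.emod_add_mul_ediv i n.val
      refine ⟨-(i / n.val), ?_⟩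
      rw [Int.toNat_of_nonneg h1]
      linarith)))

/-- The transition map `δ : ⊕_{i<n} F(φ^i U) ⟶ ⊕_{i<n'} F(φ^i U)` for `n ∣ n'`,
`f^{(i)} ↦ ∑_{j < n'/n} f^{(i + n j)}`. -/
def delta (n n' : P.Level) (_ : n ≤ n') : P.Sum F n →+ P.Sum F n' :=
  ∑ i : Fin n.val, ∑ j ∈ Finset.range (n'.val / n.val),
    (P.entry F n' (((i : ℕ) : ℤ) + n.val * j)).comp
      ((P.transport F (n.zpow_mem ⟨j, by ring⟩)).comp
        (Pi.evalAddMonoidHom (fun i : Fin n.val => F.sec (P.phiU ((i : ℕ) : ℤ))) i))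

/-- The group `colim_n ⊕_{i<n} F(φ^i U)`. -/
abbrev colimSum : Type u := AddCommGroup.DirectLimit (P.Sum F) (P.delta F)

/-- The element of `colim_n ⊕_{i<n} F(φ^i U)` defined by `f^{(i)}` at the level `n`. -/
def entryColim (n : P.Level) (i : ℤ) : F.sec (P.phiU i) →+ P.colimSum F :=
  (AddCommGroup.DirectLimit.of (P.Sum F) (P.delta F) n).comp (P.entry F n i)

/-! ### The system of coinvariants -/

/-- The norm map `N : F(U) ⟶ F(U)`, `f ↦ ∑_{j < n'/n} φ^{-jn} f`, for `n ∣ n'`. -/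
def norm (n n' : P.Level) : F.sec P.U →+ F.sec P.U :=
  ∑ j ∈ Finset.range (n'.val / n.val), P.frobAct F (-(n.val * j : ℤ))
    (n.zpow_mem (Dvd.dvd.neg_right ⟨j, rfl⟩))

/-- The action of `φ^n` on `F(U)`. -/
def levelAct (n : P.Level) : F.sec P.U →+ F.sec P.U := P.frobAct F n.val (n.zpow_mem dvd_rfl)

/-- The map `φ^n - 1` on `F(U)`. -/
def levelActSubOne (n : P.Level) : F.sec P.U →+ F.sec P.U :=
  P.levelAct F n - AddMonoidHom.id (F.sec P.U)

/-- The coinvariants `F(U)_{nℤ}`. -/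
abbrev Coinv (n : P.Level) : Type u := F.sec P.U ⧸ (P.levelActSubOne F n).range

lemma norm_mem (n n' : P.Level) (h : n ≤ n') (x : F.sec P.U) :
    P.norm F n n' (P.levelActSubOne F n x) ∈ (P.levelActSubOne F n').range := by
  have h' : n.val ∣ n'.val := h
  let c : ℕ → F.sec P.U := fun j => P.frobAct F (n.val - n.val * j : ℤ)
    (n.zpow_mem (dvd_sub dvd_rfl (Dvd.intro _ rfl))) x
  have e1 : P.norm F n n' (P.levelActSubOne F n x) =
      ∑ j ∈ Finset.range (n'.val / n.val), (c j - c (j + 1)) := by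
    unfold norm levelActSubOne levelAct
    rw [AddMonoidHom.finsetSum_apply]
    refine Finset.sum_congr rfl fun j _ => ?_
    rw [AddMonoidHom.sub_apply, map_sub]
    congr 1
    · exact P.frobAct_frobAct F _ _ _ (by ring) x
    · exact P.frobAct_congr F _ _ (by push_cast; ring) x
  have hd : (n.val : ℤ) ∣ (n.val - n'.val : ℤ) :=
    dvd_sub dvd_rfl (Int.natCast_dvd_natCast.2 h')
  refine ⟨P.frobAct F (n.val - n'.val : ℤ) (n.zpow_mem hd) x, ?_⟩
  rw [e1, Finset.sum_range_sub']
  unfold levelActSubOne levelAct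
  rw [AddMonoidHom.sub_apply]
  congr 1
  · exact P.frobAct_frobAct F _ _ _ (by push_cast; ring) x
  · refine P.frobAct_congr F (n.zpow_mem hd) _ ?_ x
    rw [← Nat.cast_mul, Nat.mul_div_cancel' h']

/-- The map `F(U)_{nℤ} ⟶ F(U)_{n'ℤ}` induced by the norm map, for `n ∣ n'`. -/
def coinvMap (n n' : P.Level) (h : n ≤ n') : P.Coinv F n →+ P.Coinv F n' :=
  QuotientAddGroup.map _ _ (P.norm F n n') (by
    rintro _ ⟨x, rfl⟩
    exact P.norm_mem F n n' h x)

/-- The group `colim_{n, N} F(U)_{nℤ}`. -/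
abbrev colimCoinv : Type u := AddCommGroup.DirectLimit (P.Coinv F) (P.coinvMap F)

/-- The element of `colim_{n, N} F(U)_{nℤ}` defined by `x ∈ F(U)` at the level `n`. -/
def coinvMk (n : P.Level) : F.sec P.U →+ P.colimCoinv F :=
  (AddCommGroup.DirectLimit.of (P.Coinv F) (P.coinvMap F) n).comp (QuotientAddGroup.mk' _)

/-! ### Functoriality in `U` -/

variable {P Q}

/-- A morphism `φ^a U_P ⟶ U_Q` over `X̄`, i.e. a morphism of schemes `U_P ⟶ U_Q` over the
automorphism `φ^a` of `X̄`. -/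
def IsSemilinear (a : ℤ) (f : P.U.left ⟶ Q.U.left) : Prop :=
  f ≫ str Q.U = str P.U ≫ act (weilAction kbar p) (frobG k kbar ^ a)

/-- The morphism `f` is compatible with the identifications `φ^n U_P = U_P` and `φ^n U_Q = U_Q`.
Every `f` has this property for some level `n`. -/
def CompatibleAt (f : P.U.left ⟶ Q.U.left) (n : P.Level) (m : Q.Level) : Prop :=
  n.val = m.val ∧ f ≫ Q.alpha ⟨_, m.mem⟩ = P.alpha ⟨_, n.mem⟩ ≫ f

/-- The restriction `F(U_Q) ⟶ F(φ^a U_P)` along a morphism `φ^a U_P ⟶ U_Q`. -/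
def resSemilinear {a : ℤ} {f : P.U.left ⟶ Q.U.left} (hf : IsSemilinear a f) :
    F.sec Q.U →+ F.sec (P.phiU a) :=
  F.res (ofSemilinear (weilAction kbar p) (frobG k kbar ^ a) f hf)

/-- The restriction `F(φ^i U_Q) ⟶ F(φ^(i+a) U_P)` along a morphism `φ^a U_P ⟶ U_Q`. -/
def resPhi {a : ℤ} {f : P.U.left ⟶ Q.U.left} (hf : IsSemilinear a f) (i : ℤ) :
    F.sec (Q.phiU i) →+ F.sec (P.phiU (i + a)) :=
  F.res (twistHom (weilAction kbar p) (frobG k kbar ^ (i + a)) (frobG k kbar ^ i) f (by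
    rw [← Category.assoc, show f ≫ str Q.U = _ from hf, Category.assoc, act_comp, ← zpow_add]))

/-- The map `φ^a : F(U) ⟶ F(φ^a U)`. -/
def phiPow (P : Model kbar p) (a : ℤ) : F.sec P.U →+ F.sec (P.phiU a) :=
  F.smul (frobG k kbar ^ a) P.U

/-- `z' ∈ colim_{n, N} F(U_P)_{nℤ}` is the image of `z ∈ colim_{n, N} F(U_Q)_{nℤ}` under
`(φ^a)⁻¹ f^*`, for a morphism `f : φ^a U_P ⟶ U_Q`. -/
def CoinvRestr {a : ℤ} {f : P.U.left ⟶ Q.U.left} (hf : IsSemilinear a f)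
    (z : Q.colimCoinv F) (z' : P.colimCoinv F) : Prop :=
  ∃ (n : P.Level) (m : Q.Level) (x : F.sec Q.U) (x' : F.sec P.U), CompatibleAt f n m ∧
    phiPow F P a x' = resSemilinear F hf x ∧ z = Q.coinvMk F m x ∧ z' = P.coinvMk F n x'

lemma isSemilinear_zero (f : P.U ⟶ Q.U) : IsSemilinear 0 f.left := by
  unfold IsSemilinear
  rw [zpow_zero, act_one, Category.comp_id, str_w]

end Model

variable {kbar p}

/-- The object `A` of `𝒯_Ĝ` with its endomorphism `t` is `U ↦ colim_n ⊕_{i<n} F(φ^i U)`: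
the isomorphisms `e` are compatible with restriction and with the action of `G` (which
is dense in `Ĝ` and hence determines the continuous action of `Ĝ`) by rotation,
`g f^{(i)} = f^{(i-a)} ∈ colim_n ⊕_{i<n} F(φ^i gU)` for `g = φ^a`, and `t f^{(i)} = (φ f)^{(i+1)}`. -/
structure IsColimSumSheaf (F : TG kbar p) {A : TGhat kbar p} (t : A ⟶ A)
    (e : ∀ P : Model kbar p, P.colimSum F ≃+ ((gammaUpper kbar p).obj A).sec P.U) : Prop where
  /-- For `f : gU_P ⟶ U_Q` with `g = φ^a` and `x ∈ F(φ^i U_Q)`, one has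
  `f^*(x^{(i)}) = g ((f^* x)^{(i+a)})` in `A(gU_P)`. -/
  natural : ∀ (P Q : Model kbar p) (a : ℤ) (f : P.U.left ⟶ Q.U.left)
    (hf : Model.IsSemilinear a f) (n : P.Level) (m : Q.Level), Model.CompatibleAt f n m →
    ∀ (i : ℤ) (x : F.sec (Q.phiU i)),
      Model.resSemilinear ((gammaUpper kbar p).obj A) hf (e Q (Q.entryColim F m i x)) =
        Model.phiPow ((gammaUpper kbar p).obj A) P a
          (e P (P.entryColim F n (i + a) (Model.resPhi F hf i x)))
  t_entry : ∀ (P : Model kbar p) (n : P.Level) (i : ℤ) (x : F.sec (P.phiU i)),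
    t.hom.hom.hom.app (op P.U) (e P (P.entryColim F n i x)) =
      e P (P.entryColim F n (i + 1) (P.phi F i x))

/-- The object `B` of `𝒯_Ĝ` is the sheaf associated with `U ↦ colim_{n, N} F(U)_{nℤ}`: there is a
homomorphism `S` from this presheaf to `B`, compatible with the action of `G`, which is locally
injective and locally surjective. -/
structure IsColimCoinvSheaf (F : TG kbar p) (B : TGhat kbar p)
    (S : ∀ P : Model kbar p, P.colimCoinv F →+ ((gammaUpper kbar p).obj B).sec P.U) : Prop where
  natural : ∀ (P Q : Model kbar p) (a : ℤ) (f : P.U.left ⟶ Q.U.left)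
    (hf : Model.IsSemilinear a f) (z : Q.colimCoinv F) (z' : P.colimCoinv F),
    Model.CoinvRestr F hf z z' →
      Model.resSemilinear ((gammaUpper kbar p).obj B) hf (S Q z) =
        Model.phiPow ((gammaUpper kbar p).obj B) P a (S P z')
  locally_injective : ∀ (Q : Model kbar p) (z : Q.colimCoinv F), S Q z = 0 →
    ∃ (ι : Type u) (P : ι → Model kbar p) (f : ∀ j, (P j).U ⟶ Q.U),
      Sieve.ofArrows _ f ∈ (Xbar kbar p).smallEtaleTopology Q.U ∧
      ∀ j, Model.CoinvRestr F (Model.isSemilinear_zero (f j)) z 0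
  locally_surjective : ∀ (Q : Model kbar p) (s : ((gammaUpper kbar p).obj B).sec Q.U),
    ∃ (ι : Type u) (P : ι → Model kbar p) (f : ∀ j, (P j).U ⟶ Q.U),
      Sieve.ofArrows _ f ∈ (Xbar kbar p).smallEtaleTopology Q.U ∧
      ∀ j, ∃ z : (P j).colimCoinv F, S (P j) z = ((gammaUpper kbar p).obj B).res (f j) s

/-- The counit `γ^* γ_* F ⟶ F` identifies `γ_* F(U)` with `colim_n F(U)^{nℤ}`, i.e. with
the union of the subgroups `F(U)^{nℤ}` of `F(U)`. -/
def IsColimInv [(gammaUpper kbar p).IsLeftAdjoint] (F : TG kbar p) : Prop :=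
  ∀ P : Model kbar p,
    let ε : ((gammaUpper kbar p).obj ((gammaLower kbar p).obj F)).sec P.U → F.sec P.U :=
      ((Adjunction.ofIsLeftAdjoint (gammaUpper kbar p)).counit.app F).hom.hom.app (op P.U)
    Function.Injective ε ∧ Set.range ε = {s | ∃ n : P.Level, P.levelAct F n s = s}

end Geometry

end WeilEtale
end

/-! The argument rests on a coinduction functor. The forgetful functor from `𝒯_Ĝ` to étale sheaves
on `X̄` has a right adjoint `coind`: the sections of `coind F` over a quasi-compact étale `U` are
the families `(s_h)` with `s_h ∈ F(hU)`, `h ∈ Ĝ`, that are fixed by an open subgroup. The groups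
`Gal(kbar/F_{q^n})` are cofinal among the open subgroups, and `1, φ, …, φ^(n-1)` represent the
cosets. So a family fixed at level `n` amounts to its components in `F(φ^i U)` for `i < n`, and the
sections form `colim_n ⊕_{i<n} F(φ^i U)`; splitting a coset into smaller ones gives the transition
maps `δ`. Hence `A = coind F`.

If `F` carries an action of `G`, then `(ts)_h = φ s_{φ⁻¹h}` defines an endomorphism of `coind F`. A
morphism of sheaves `b : M ⟶ F` corresponds to `x ↦ (b(hx))_h`, and `t` fixes this morphism exactly
when `b` commutes with `φ` (`toCoind_shift_iff`). So `Hom(γ^*M, F) = Hom(M, ker(t - 1))`, which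
gives the adjoint `γ_*` and identifies `γ_* F` with `ker(t - 1)`.

Two facts give the derived functor. First, `coind` is exact: it is a right adjoint, and it preserves
epimorphisms because a section over a quasi-compact `U` has finitely many components, each of which
lifts on a finite covering (`hs_spread_eq_zero`). Second, `t - 1` is an epimorphism on `coind J` for
injective `J` (`epi_shift_sub_one`): `J` is a retract of `U ↦ ∏_{g ∈ G} J(gU)`, where `φ^n - 1` is
surjective on sections since `G` is infinite cyclic, and a telescoping sum turns a preimage under
`φ^n - 1` into one under `t - 1`. For an injective resolution `I` of `F` this yields a short exact
sequence `0 → γ_* I → coind I → coind I → 0` of complexes in which `coind I` resolves `A`. Both `γ_*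
I` and `t - 1 : A ⟶ A` then map quasi-isomorphically to the total complex of `t - 1` on `coind I`,
which gives (a) and (d).

For (b), a section killed by `t - 1` has components `φ^i x` for a single `x` with `φ^n x = x`. For
(c), `R¹γ_* F` is the cokernel of `t - 1`: there the index of a component is irrelevant, `x` and
`φ^n x` become equal at level `n`, and splitting cosets becomes the norm map. Since cokernels are
computed locally, a sheafification appears.

The geometric input is finite presentation: étale schemes over `X̄` are locally defined over finite
subextensions, and morphisms between models commute with an open subgroup of `Ĝ`
(`exists_model_hom`, `exists_alphaTotal_comm`). Together with quasi-compactness this makes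
smoothness of sections a local condition, so that `𝒯_Ĝ` is an abelian subcategory closed under
kernels and cokernels. -/

noncomputable section

namespace WeilEtale

/-! ### The absolute Galois group of a finite field: open subgroups and cosets of Frobenius powers.
-/

section Galois

variable (k : Type u) [Field k] (kbar : Type u) [Field kbar] [Algebra k kbar]
  [Finite k] [IsAlgClosure k kbar]

lemma frob_apply (x : kbar) : frob k kbar x = x ^ Nat.card k := by
  let := Fintype.ofFinite k
  rw [Nat.card_eq_fintype_card]
  rfl

lemma frob_pow_apply (n : ℕ) (x : kbar) : (frob k kbar ^ n) x = x ^ (Nat.card k ^ n) := by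
  induction n generalizing x with
  | zero => simp
  | succ n ih => rw [pow_succ, AlgEquiv.mul_apply, frob_apply, ih, ← pow_mul, pow_succ']

/-- The subfield of `kbar` of elements fixed by the `n`-th power of the Frobenius. -/
def levelField (n : ℕ) : IntermediateField k kbar :=
  IntermediateField.fixedField (Subgroup.zpowers (frob k kbar ^ n))

variable {k kbar}

lemma mem_levelField_iff {n : ℕ} {x : kbar} :
    x ∈ levelField k kbar n ↔ (frob k kbar ^ n) x = x := by
  constructor
  · intro h
    exact h ⟨_, Subgroup.mem_zpowers _⟩
  · rintro h ⟨_, ⟨m, rfl⟩⟩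
    have : frob k kbar ^ n ∈ MulAction.stabilizer Gal(kbar/k) x := h
    exact Subgroup.zpow_mem _ this m

lemma mem_levelField_iff_pow {n : ℕ} {x : kbar} :
    x ∈ levelField k kbar n ↔ x ^ (Nat.card k ^ n) = x := by
  rw [mem_levelField_iff, frob_pow_apply]

lemma one_lt_card_pow {n : ℕ} (hn : 0 < n) : 1 < Nat.card k ^ n :=
  Nat.one_lt_pow hn.ne' Finite.one_lt_card

lemma finite_levelField {n : ℕ} (hn : 0 < n) : Finite (levelField k kbar n) := by
  have hc := one_lt_card_pow (k := k) hn
  have hf : (Polynomial.X ^ (Nat.card k ^ n) - Polynomial.X : Polynomial kbar) ≠ 0 :=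
    FiniteField.X_pow_card_sub_X_ne_zero kbar hc
  refine Set.Finite.subset (Polynomial.rootSet_finite
    (Polynomial.X ^ (Nat.card k ^ n) - Polynomial.X : Polynomial kbar) kbar) ?_
  intro x hx
  rw [Polynomial.mem_rootSet]
  refine ⟨hf, ?_⟩
  have := mem_levelField_iff_pow.1 hx
  simp [this]

open Polynomial in
-- The field consists of the roots of `X^(q^n) - X`. The characteristic divides `q^n`, so this
-- polynomial is separable and has `q^n` distinct roots in the algebraically closed field `kbar`.
lemma levelField_card {n : ℕ} (hn : 0 < n) :
    Nat.card (levelField k kbar n) = Nat.card k ^ n := by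
  have hc := one_lt_card_pow (k := k) hn
  have := IsAlgClosure.isAlgClosed k (K := kbar)
  obtain ⟨p, hp⟩ := CharP.exists k
  have : Fact p.Prime := ⟨CharP.char_is_prime k p⟩
  have : CharP kbar p := charP_of_injective_algebraMap (algebraMap k kbar).injective p
  have hdvd : p ∣ Nat.card k ^ n := by
    let := Fintype.ofFinite k
    obtain ⟨m, _, hm⟩ := FiniteField.card k p
    rw [Nat.card_eq_fintype_card, hm, ← pow_mul]
    exact dvd_pow_self _ (Nat.mul_ne_zero m.pos.ne' hn.ne')
  have hsep : (X ^ (Nat.card k ^ n) - X : kbar[X]).Separable := galois_poly_separable p _ hdvd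
  have hf : (X ^ (Nat.card k ^ n) - X : kbar[X]) ≠ 0 := FiniteField.X_pow_card_sub_X_ne_zero kbar hc
  have h1 : Fintype.card ((X ^ (Nat.card k ^ n) - X : kbar[X]).rootSet kbar) = Nat.card k ^ n := by
    rw [card_rootSet_eq_natDegree hsep (IsAlgClosed.splits _),
      FiniteField.X_pow_card_sub_X_natDegree_eq kbar hc]
  rw [← h1, ← Nat.card_eq_fintype_card]
  refine Nat.card_congr (Equiv.setCongr ?_)
  ext x
  rw [mem_rootSet, SetLike.mem_coe, mem_levelField_iff_pow]
  simp [hf, sub_eq_zero]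

variable (k kbar) in
lemma levelField_finite {n : ℕ} (hn : 0 < n) : FiniteDimensional k (levelField k kbar n) := by
  have := finite_levelField (k := k) (kbar := kbar) hn
  exact inferInstance

variable (k kbar) in
/-- The Galois group of `kbar` over the subfield of elements fixed by `φ ^ n`. -/
def levelGroup (n : ℕ) : Subgroup Gal(kbar/k) := (levelField k kbar n).fixingSubgroup

lemma mem_levelGroup_iff {n : ℕ} {g : Gal(kbar/k)} :
    g ∈ levelGroup k kbar n ↔ ∀ x : kbar, (frob k kbar ^ n) x = x → g x = x := by
  rw [levelGroup, IntermediateField.mem_fixingSubgroup_iff]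
  simp only [mem_levelField_iff]

lemma isOpen_levelGroup {n : ℕ} (hn : 0 < n) :
    IsOpen (levelGroup k kbar n : Set Gal(kbar/k)) := by
  have := levelField_finite k kbar hn
  exact IntermediateField.fixingSubgroup_isOpen _

lemma levelGroup_anti {m n : ℕ} (h : m ∣ n) : levelGroup k kbar n ≤ levelGroup k kbar m := by
  intro g hg
  rw [mem_levelGroup_iff] at hg ⊢
  obtain ⟨c, rfl⟩ := h
  intro x hx
  apply hg
  have : frob k kbar ^ m ∈ MulAction.stabilizer Gal(kbar/k) x := hx
  rw [pow_mul]
  exact Subgroup.pow_mem _ this c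

lemma levelGroup_le_fixingSubgroup {n : ℕ} {L : IntermediateField k kbar}
    (h : frob k kbar ^ n ∈ L.fixingSubgroup) : levelGroup k kbar n ≤ L.fixingSubgroup := by
  intro g hg
  rw [mem_levelGroup_iff] at hg
  rw [IntermediateField.mem_fixingSubgroup_iff] at h ⊢
  exact fun x hx => hg x (h x hx)

lemma frob_pow_mem_levelGroup (n : ℕ) : frob k kbar ^ n ∈ levelGroup k kbar n :=
  mem_levelGroup_iff.2 fun _ h => h

/-- A nonzero remainder `r` of `i` modulo `n` would put `φ^r` in the group, so the field with `q^n`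
elements would lie in the one with `q^r` elements although `r < n`. -/
lemma frob_zpow_mem_levelGroup_iff {n : ℕ} (hn : 0 < n) {i : ℤ} :
    frob k kbar ^ i ∈ levelGroup k kbar n ↔ (n : ℤ) ∣ i := by
  constructor
  · intro h
    have hmod : frob k kbar ^ (i % n) ∈ levelGroup k kbar n := by
      have e : i % n = i + n * (-(i / n)) := by
        have := Int.emod_add_mul_ediv i n
        linarith
      rw [e, zpow_add, zpow_mul, zpow_natCast]
      exact mul_mem h (Subgroup.zpow_mem _ (frob_pow_mem_levelGroup n) _)
    have h0 := Int.emod_nonneg i (b := n) (by omega)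
    have h1 := Int.emod_lt_of_pos i (b := n) (by omega)
    obtain ⟨r, hr⟩ := Int.eq_ofNat_of_zero_le h0
    by_contra hd
    have hr0 : 0 < r := by
      rcases Nat.eq_zero_or_pos r with rfl | h'
      · exact absurd (Int.dvd_of_emod_eq_zero hr) hd
      · exact h'
    rw [hr, zpow_natCast, mem_levelGroup_iff] at hmod
    have hle : levelField k kbar n ≤ levelField k kbar r := fun x hx =>
      mem_levelField_iff.2 (hmod x (mem_levelField_iff.1 hx))
    have := finite_levelField (k := k) (kbar := kbar) hr0
    have := Nat.card_le_card_of_injective _ (IntermediateField.inclusion hle).injective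
    rw [levelField_card hn, levelField_card hr0] at this
    have := (Nat.pow_le_pow_iff_right (Finite.one_lt_card (α := k))).1 this
    omega
  · rintro ⟨c, rfl⟩
    rw [zpow_mul, zpow_natCast]
    exact Subgroup.zpow_mem _ (frob_pow_mem_levelGroup n) _

/-- The automorphisms of the finite field fixed by `φ^n` are the powers of its Frobenius. Apply this
to the restriction of `h`, and reduce the exponent modulo `n`, which is harmless since `φ^n` lies in
the level group. -/
lemma exists_frob_pow_inv_mul_mem {n : ℕ} (hn : 0 < n) (h : Gal(kbar/k)) :
    ∃ i < n, (frob k kbar ^ i)⁻¹ * h ∈ levelGroup k kbar n := by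
  have := finite_levelField (k := k) (kbar := kbar) hn
  have := IsAlgClosure.isAlgebraic (R := k) (K := kbar)
  let := Fintype.ofFinite k
  obtain ⟨i, hi⟩ := (FiniteField.bijective_frobeniusAlgEquivOfAlgebraic_pow k
    (levelField k kbar n)).2 (AlgEquiv.restrictNormalHom (levelField k kbar n) h)
  have key : (frob k kbar ^ i.1)⁻¹ * h ∈ levelGroup k kbar n := by
    rw [mem_levelGroup_iff]
    intro x hx
    let y : levelField k kbar n := ⟨x, mem_levelField_iff.2 hx⟩
    have e1 : ((AlgEquiv.restrictNormalHom (levelField k kbar n) h) y : kbar) = h x :=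
      AlgEquiv.restrictNormal_commutes h _ y
    rw [← hi] at e1
    have e2 : (((FiniteField.frobeniusAlgEquivOfAlgebraic k (levelField k kbar n)) ^ i.1) y :
        kbar) = x ^ (Fintype.card k ^ i.1) := by
      rw [AlgEquiv.coe_pow, FiniteField.coe_frobeniusAlgEquivOfAlgebraic_iterate]
      rfl
    rw [AlgEquiv.mul_apply, ← e1, e2, ← Nat.card_eq_fintype_card, ← frob_pow_apply,
      ← AlgEquiv.mul_apply, inv_mul_cancel, AlgEquiv.one_apply]
  refine ⟨i.1 % n, Nat.mod_lt _ hn, ?_⟩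
  have e : (frob k kbar ^ (i.1 % n))⁻¹ * h =
      (frob k kbar ^ n) ^ (i.1 / n) * ((frob k kbar ^ i.1)⁻¹ * h) := by
    have e' : frob k kbar ^ i.1 =
        frob k kbar ^ (i.1 % n) * (frob k kbar ^ n) ^ (i.1 / n) := by
      rw [← pow_mul, ← pow_add, Nat.mod_add_div]
    rw [e']
    group
  rw [e]
  exact mul_mem (pow_mem (frob_pow_mem_levelGroup n) _) key

/-- The exponent is `[L : k]`: the elements of `L` satisfy `x^|L| = x`, and `|L| = q^[L : k]`. -/
lemma exists_frob_pow_mem {L : IntermediateField k kbar} (hL : FiniteDimensional k L) :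
    ∃ n : ℕ, 0 < n ∧ frob k kbar ^ n ∈ L.fixingSubgroup := by
  refine ⟨Module.finrank k L, Module.finrank_pos, ?_⟩
  have : Finite L := Module.finite_of_finite k
  let := Fintype.ofFinite L
  rw [IntermediateField.mem_fixingSubgroup_iff]
  intro x hx
  rw [frob_pow_apply, ← Module.natCard_eq_pow_finrank, Nat.card_eq_fintype_card]
  exact congrArg Subtype.val (FiniteField.pow_card (⟨x, hx⟩ : L))

/-- Cofinality of the level groups: every continuity statement may be tested on one of them. -/
lemma exists_levelGroup_le {N : Subgroup Gal(kbar/k)} (hN : IsOpen (N : Set Gal(kbar/k))) :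
    ∃ n : ℕ, 0 < n ∧ levelGroup k kbar n ≤ N := by
  obtain ⟨L, hL, h⟩ := (krullTopology_mem_nhds_one_iff k kbar N).1 (hN.mem_nhds N.one_mem)
  obtain ⟨n, hn, hm⟩ := exists_frob_pow_mem hL
  exact ⟨n, hn, (levelGroup_le_fixingSubgroup hm).trans h⟩

/-- On a given element every automorphism acts as some power map `y ↦ y^(q^i)`, and power maps
commute with automorphisms. The exponent chosen for `g` at `x` also serves at `h x`, because both
lie in the field fixed by `φ^n`. -/
lemma gal_mul_comm (g h : Gal(kbar/k)) : g * h = h * g := by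
  have := IsAlgClosure.isAlgebraic (R := k) (K := kbar)
  ext x
  have hx : IsIntegral k x := Algebra.IsIntegral.isIntegral x
  obtain ⟨n, hn, hm⟩ := exists_frob_pow_mem (IntermediateField.adjoin.finiteDimensional hx)
  have hfix := (IntermediateField.mem_fixingSubgroup_iff _ _).1 hm x
    (IntermediateField.mem_adjoin_simple_self k x)
  have hfix' (g : Gal(kbar/k)) : (frob k kbar ^ n) (g x) = g x := by
    rw [frob_pow_apply, ← map_pow, ← frob_pow_apply, hfix]
  have key (g : Gal(kbar/k)) : ∃ i : ℕ, ∀ y : kbar, (frob k kbar ^ n) y = y →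
      g y = y ^ (Nat.card k ^ i) := by
    obtain ⟨i, _, hi⟩ := exists_frob_pow_inv_mul_mem hn g
    refine ⟨i, fun y hy => ?_⟩
    rw [← frob_pow_apply]
    nth_rw 2 [← mem_levelGroup_iff.1 hi y hy]
    rw [← AlgEquiv.mul_apply, mul_inv_cancel_left]
  obtain ⟨i, hi⟩ := key g
  rw [AlgEquiv.mul_apply, AlgEquiv.mul_apply, hi x hfix, hi (h x) (hfix' h), map_pow]

end Galois

/-! ### `V ×_L kbar` as a limit over finite subextensions. -/

section LevelLimit

variable {k : Type u} [Field k] {kbar : Type u} [Field kbar] [Algebra k kbar]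

/-- The finite subextensions of `kbar` containing `L`. -/
abbrev FiniteOver (L : IntermediateField k kbar) : Type u :=
  {E : IntermediateField k kbar // FiniteDimensional k E ∧ L ≤ E}

instance (L : IntermediateField k kbar) : IsDirectedOrder (FiniteOver L) where
  directed E E' := by
    have := E.2.1
    have := E'.2.1
    exact ⟨⟨E.1 ⊔ E'.1, inferInstance, E.2.2.trans le_sup_left⟩, le_sup_left (a := E.1),
      le_sup_right (a := E.1)⟩

/-- The diagram of the finite subextensions containing `L`. -/
def fieldDiagram (L : IntermediateField k kbar) : FiniteOver L ⥤ CommRingCat.{u} where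
  obj E := CommRingCat.of E.1
  map f := CommRingCat.ofHom (IntermediateField.inclusion (leOfHom f)).toRingHom

/-- The cocone with vertex `kbar` over the diagram of finite subextensions. -/
def fieldCocone (L : IntermediateField k kbar) : Cocone (fieldDiagram L) where
  pt := CommRingCat.of kbar
  ι := { app E := CommRingCat.ofHom E.1.val.toRingHom }

/-- `kbar` is the colimit of its finite subextensions. -/
def isColimitFieldCocone [Algebra.IsAlgebraic k kbar] (L : IntermediateField k kbar)
    [FiniteDimensional k L] : IsColimit (fieldCocone L) := by
  have : Nonempty (FiniteOver L) := ⟨⟨L, ‹_›, le_rfl⟩⟩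
  refine @isColimitOfReflects _ _ _ _ _ _ (fieldDiagram L) (forget CommRingCat) _ ?_ (reflectsColimitsOfShape_of_reflectsIsomorphisms.reflectsColimit)
  apply Types.FilteredColimit.isColimitOf
  · intro (x : kbar)
    have hx : _root_.IsIntegral k x := Algebra.IsIntegral.isIntegral x
    have := IntermediateField.adjoin.finiteDimensional hx
    exact ⟨⟨L ⊔ IntermediateField.adjoin k {x}, inferInstance, le_sup_left⟩,
      ⟨x, le_sup_right (a := L) (IntermediateField.mem_adjoin_simple_self k x)⟩, rfl⟩
  · intro E E' x y h
    obtain ⟨M, h1, h2⟩ := exists_ge_ge E E'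
    exact ⟨M, homOfLE h1, homOfLE h2, Subtype.ext h⟩

/-- `kbar` is the filtered union of its finite subextensions, and `Spec` turns this colimit of rings
into a limit of schemes. -/
lemma exists_unique_to_spec [Algebra.IsAlgebraic k kbar] (L : IntermediateField k kbar)
    [FiniteDimensional k L] {T : Scheme.{u}}
    (f : ∀ E : FiniteOver L, T ⟶ Spec (CommRingCat.of E.1))
    (hf : ∀ (E E' : FiniteOver L) (h : E ≤ E'), f E = f E' ≫ Spec.map (CommRingCat.ofHom
      (IntermediateField.inclusion h).toRingHom)) :
    ∃ g : T ⟶ Spec (CommRingCat.of kbar),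
      (∀ E, g ≫ Spec.map (CommRingCat.ofHom E.1.val.toRingHom) = f E) ∧
      ∀ g' : T ⟶ Spec (CommRingCat.of kbar),
        (∀ E, g' ≫ Spec.map (CommRingCat.ofHom E.1.val.toRingHom) = f E) → g' = g := by
  let hl : IsLimit (Scheme.Spec.mapCone (fieldCocone L).op) :=
    isLimitOfPreserves Scheme.Spec (isColimitFieldCocone L).op
  let c : Cone ((fieldDiagram L).op ⋙ Scheme.Spec) :=
    { pt := T
      π :=
        { app E := f E.unop
          naturality E E' h := (Category.id_comp _).trans (hf _ _ (leOfHom h.unop)) } }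
  exact ⟨hl.lift c, fun E => hl.fac c (op E), fun g' h => hl.uniq c g' fun E => h E.unop⟩

variable {X : Scheme.{u}} {p : X ⟶ Spec (CommRingCat.of k)}

instance {A : Type u} [CommRing A] [Algebra k A] : IsAffineHom (pullback.fst p (specMap A)) :=
  MorphismProperty.IsStableUnderBaseChange.of_isPullback (P := @IsAffineHom)
    (IsPullback.of_hasPullback p (specMap A)).flip inferInstance

instance baseChangeMap_isAffineHom {A B : Type u} [CommRing A] [Algebra k A] [CommRing B]
    [Algebra k B] (f : A →ₐ[k] B) : IsAffineHom (baseChangeMap p f) := by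
  have : IsAffineHom (baseChangeMap p f ≫ pullback.fst _ _) := by
    rw [baseChangeMap_fst]; infer_instance
  exact MorphismProperty.of_postcomp (W := @IsAffineHom) (W' := @IsSeparated) _
    (pullback.fst p (specMap A)) inferInstance this

namespace Model

variable (P : Model kbar p)

/-- The scheme `V ×_L E` for a finite subextension `E` containing `L`. -/
def atLevel (E : FiniteOver P.L) : Scheme.{u} :=
  pullback P.π (baseChangeMap p (IntermediateField.inclusion E.2.2))

/-- The projection `V ×_L E ⟶ V`. -/
def atLevelFst (E : FiniteOver P.L) : P.atLevel E ⟶ P.V := pullback.fst _ _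

/-- The projection `V ×_L E ⟶ X ×ₖ E`. -/
def atLevelSnd (E : FiniteOver P.L) : P.atLevel E ⟶ baseChange p E.1 := pullback.snd _ _

variable {P} in
lemma atLevel_condition (E : FiniteOver P.L) : P.atLevelFst E ≫ P.π =
    P.atLevelSnd E ≫ baseChangeMap p (IntermediateField.inclusion E.2.2) :=
  pullback.condition

variable {P} in
lemma atLevel_hom_ext {T : Scheme.{u}} {E : FiniteOver P.L} {f g : T ⟶ P.atLevel E}
    (h1 : f ≫ P.atLevelFst E = g ≫ P.atLevelFst E)
    (h2 : f ≫ P.atLevelSnd E = g ≫ P.atLevelSnd E) : f = g :=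
  pullback.hom_ext h1 h2

/-- The universal property of `V ×_L E`. -/
def atLevelLift {T : Scheme.{u}} {E : FiniteOver P.L} (f : T ⟶ P.V) (g : T ⟶ baseChange p E.1)
    (h : f ≫ P.π = g ≫ baseChangeMap p (IntermediateField.inclusion E.2.2)) : T ⟶ P.atLevel E :=
  pullback.lift f g h

section
variable {T : Scheme.{u}} {E : FiniteOver P.L} (f : T ⟶ P.V) (g : T ⟶ baseChange p E.1)
    (h : f ≫ P.π = g ≫ baseChangeMap p (IntermediateField.inclusion E.2.2))

lemma atLevelLift_fst : P.atLevelLift f g h ≫ P.atLevelFst E = f := pullback.lift_fst _ _ _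

lemma atLevelLift_snd : P.atLevelLift f g h ≫ P.atLevelSnd E = g := pullback.lift_snd _ _ _

lemma atLevelLift_snd_assoc {Z : Scheme.{u}} (b : baseChange p E.1 ⟶ Z) :
    P.atLevelLift f g h ≫ P.atLevelSnd E ≫ b = g ≫ b := by
  rw [← Category.assoc, atLevelLift_snd]
end

/-- The transition morphisms between the schemes `V ×_L E`. -/
def atLevelMap {E E' : FiniteOver P.L} (h : E ≤ E') : P.atLevel E' ⟶ P.atLevel E :=
  P.atLevelLift (P.atLevelFst E')
    (P.atLevelSnd E' ≫ baseChangeMap p (IntermediateField.inclusion h))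
    (by rw [Category.assoc, baseChangeMap_comp]; exact atLevel_condition E')

/-- The diagram of the schemes `V ×_L E`, for the finite subextensions `E` containing `L`. -/
def levelDiagram : (FiniteOver P.L)ᵒᵖ ⥤ Scheme.{u} where
  obj E := P.atLevel E.unop
  map f := P.atLevelMap (leOfHom f.unop)
  map_id E := by
    apply atLevel_hom_ext
    · rw [atLevelMap, atLevelLift_fst, Category.id_comp]
    · rw [atLevelMap, atLevelLift_snd, Category.id_comp]
      exact (congrArg _ (baseChangeMap_id p)).trans (Category.comp_id _)
  map_comp f g := by
    apply atLevel_hom_ext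
    · simp only [atLevelMap, Category.assoc, atLevelLift_fst]
    · simp only [atLevelMap, Category.assoc, atLevelLift_snd, atLevelLift_snd_assoc,
        baseChangeMap_comp]
      rfl

lemma fst_π : P.fst ≫ P.π = P.snd ≫ toLevel kbar p P.L := pullback.condition

/-- The projection `V ×_L kbar ⟶ V ×_L E`. -/
def toAtLevel (E : FiniteOver P.L) : P.total ⟶ P.atLevel E :=
  P.atLevelLift P.fst (P.snd ≫ toLevel kbar p E.1)
    (by rw [Category.assoc, toLevel, baseChangeMap_comp]; exact P.fst_π)

lemma toAtLevel_fst (E : FiniteOver P.L) : P.toAtLevel E ≫ P.atLevelFst E = P.fst :=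
  P.atLevelLift_fst _ _ _

lemma toAtLevel_snd (E : FiniteOver P.L) :
    P.toAtLevel E ≫ P.atLevelSnd E = P.snd ≫ toLevel kbar p E.1 :=
  P.atLevelLift_snd _ _ _

lemma toAtLevel_snd_assoc (E : FiniteOver P.L) {Z : Scheme.{u}} (b : baseChange p E.1 ⟶ Z) :
    P.toAtLevel E ≫ P.atLevelSnd E ≫ b = P.snd ≫ toLevel kbar p E.1 ≫ b := by
  rw [← Category.assoc, toAtLevel_snd, Category.assoc]

lemma toAtLevel_map {E E' : FiniteOver P.L} (h : E ≤ E') :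
    P.toAtLevel E' ≫ P.atLevelMap h = P.toAtLevel E := by
  apply atLevel_hom_ext
  · rw [atLevelMap, Category.assoc, atLevelLift_fst, toAtLevel_fst, toAtLevel_fst]
  · rw [atLevelMap, Category.assoc, atLevelLift_snd, toAtLevel_snd, toAtLevel_snd_assoc, toLevel,
      baseChangeMap_comp]
    rfl

/-- This converts a factorization through a finite level into invariance under an open subgroup. -/
lemma alphaTotal_toAtLevel (E : FiniteOver P.L) (g : P.stab) (hg : g.1 ∈ E.1.fixingSubgroup) :
    P.alphaTotal g ≫ P.toAtLevel E = P.toAtLevel E := by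
  apply atLevel_hom_ext
  · rw [Category.assoc, toAtLevel_fst, alphaTotal_fst]
  · rw [Category.assoc, toAtLevel_snd, ← Category.assoc, alphaTotal_snd, Category.assoc,
      act_toLevel kbar p _ hg]

/-- The cone with vertex `V ×_L kbar` over the diagram of the schemes `V ×_L E`. -/
def levelCone : Cone P.levelDiagram where
  pt := P.total
  π := { app E := P.toAtLevel E.unop
         naturality _ _ f := (Category.id_comp _).trans (P.toAtLevel_map (leOfHom f.unop)).symm }

lemma total_hom_ext {T : Scheme.{u}} {f g : T ⟶ P.total} (h1 : f ≫ P.fst = g ≫ P.fst)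
    (h2 : f ≫ P.snd = g ≫ P.snd) : f = g :=
  pullback.hom_ext h1 h2

/-- In a compatible family the components in `V` and in `X` do not depend on `E`. Only the
components in `Spec E` vary, and these assemble to a morphism to `Spec kbar`. -/
lemma existsUnique_toAtLevel [Algebra.IsAlgebraic k kbar] {T : Scheme.{u}}
    (f : ∀ E : FiniteOver P.L, T ⟶ P.atLevel E)
    (hf : ∀ (E E' : FiniteOver P.L) (h : E ≤ E'), f E' ≫ P.atLevelMap h = f E) :
    ∃ g : T ⟶ P.total, (∀ E, g ≫ P.toAtLevel E = f E) ∧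
      ∀ g' : T ⟶ P.total, (∀ E, g' ≫ P.toAtLevel E = f E) → g' = g := by
  have := P.finite
  -- `L` is the least index, so the constant components can be read off there.
  let base : FiniteOver P.L := ⟨P.L, P.finite, le_rfl⟩
  have h1 (E : FiniteOver P.L) : f E ≫ P.atLevelFst E = f base ≫ P.atLevelFst base := by
    rw [← hf base E E.2.2, Category.assoc, atLevelMap, atLevelLift_fst]
  have h2 {E E' : FiniteOver P.L} (h : E ≤ E') : f E ≫ P.atLevelSnd E =
      f E' ≫ P.atLevelSnd E' ≫ baseChangeMap p (IntermediateField.inclusion h) := by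
    rw [← hf E E' h, Category.assoc, atLevelMap, atLevelLift_snd]
  obtain ⟨e, he, hu⟩ := exists_unique_to_spec P.L
    (fun E => f E ≫ P.atLevelSnd E ≫ pullback.snd p (specMap E.1)) (by
      intro E E' h
      rw [← Category.assoc (f E), h2 h]
      simp only [Category.assoc, baseChangeMap_snd])
  have hX (E : FiniteOver P.L) : f E ≫ P.atLevelSnd E ≫ pullback.fst p (specMap E.1) =
      f base ≫ P.atLevelSnd base ≫ pullback.fst p (specMap base.1) := by
    rw [← Category.assoc (f base), h2 (E' := E) E.2.2]
    simp only [Category.assoc, baseChangeMap_fst]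
  have hcond : (f base ≫ P.atLevelSnd base ≫ pullback.fst p (specMap base.1)) ≫ p =
      e ≫ specMap kbar := by
    have e' : specMap (k := k) kbar =
        Spec.map (CommRingCat.ofHom base.1.val.toRingHom) ≫ specMap (k := k) base.1 := by
      rw [← Spec.map_comp, ← CommRingCat.ofHom_comp]
      exact congrArg (fun f => Spec.map (CommRingCat.ofHom f)) base.1.val.comp_algebraMap.symm
    rw [e']
    refine Eq.trans ?_ ((congrArg (· ≫ specMap (k := k) base.1) (he base)).symm.trans
      (Category.assoc _ _ _))
    simp only [Category.assoc, pullback.condition]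
  let d : T ⟶ Xbar kbar p := pullback.lift _ e hcond
  have hd (E : FiniteOver P.L) : d ≫ toLevel kbar p E.1 = f E ≫ P.atLevelSnd E := by
    apply pullback.hom_ext
    · rw [Category.assoc, Category.assoc, toLevel, baseChangeMap_fst, hX E]
      exact pullback.lift_fst _ _ _
    · rw [Category.assoc, Category.assoc, toLevel, baseChangeMap_snd, ← he E]
      exact pullback.lift_snd_assoc _ _ _ _
  have hb : (f base ≫ P.atLevelFst base) ≫ P.π = d ≫ toLevel kbar p P.L := by
    have e : baseChangeMap p (IntermediateField.inclusion base.2.2) = 𝟙 _ := baseChangeMap_id p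
    rw [Category.assoc, atLevel_condition, ← Category.assoc, e, ← hd base]
    exact Category.comp_id _
  let l : T ⟶ P.total := pullback.lift (f base ≫ P.atLevelFst base) d hb
  refine ⟨l, fun E => ?_, fun g hg => ?_⟩
  · apply atLevel_hom_ext
    · rw [Category.assoc, toAtLevel_fst, h1 E]
      exact pullback.lift_fst _ _ _
    · rw [Category.assoc, toAtLevel_snd, ← hd E]
      exact pullback.lift_snd_assoc _ _ _ _
  · apply total_hom_ext
    · refine Eq.trans ?_ (pullback.lift_fst _ _ _).symm
      rw [← hg base, Category.assoc, toAtLevel_fst]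
    · refine Eq.trans ?_ (pullback.lift_snd _ _ _).symm
      apply pullback.hom_ext
      · rw [show d ≫ pullback.fst _ _ = _ from pullback.lift_fst _ _ _, ← hg base]
        simp only [Category.assoc, toAtLevel_snd_assoc, toLevel, baseChangeMap_fst]
      · rw [show d ≫ pullback.snd _ _ = _ from pullback.lift_snd _ _ _]
        refine hu _ fun E => ?_
        rw [← hg E]
        simp only [Category.assoc, toAtLevel_snd_assoc, toLevel, baseChangeMap_snd]

/-- `V ×_L kbar` is the limit of the schemes `V ×_L E`. -/
lemma nonempty_isLimit_levelCone [Algebra.IsAlgebraic k kbar] : Nonempty (IsLimit P.levelCone) := by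
  have h (s : Cone P.levelDiagram) := P.existsUnique_toAtLevel (fun E => s.π.app (op E))
    (fun E E' h => s.w (homOfLE h).op)
  choose g hg hu using h
  exact ⟨⟨g, fun s E => hg s E.unop, fun s m hm => hu s m fun E => hm (op E)⟩⟩

/-- The schemes `V ×_L E` are quasi-compact and quasi-separated with affine transition morphisms. A
morphism over `X` from their limit to a scheme locally of finite presentation over `X` therefore
factors through some `V ×_L E`, on which `Gal(kbar/E)` has no effect. -/
lemma exists_alpha_comp_eq [LocallyOfFiniteType p] [Algebra.IsAlgebraic k kbar] {Y : Scheme.{u}}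
    (q : Y ⟶ X) [LocallyOfFinitePresentation q] (a : P.total ⟶ Y)
    (ha : a ≫ q = P.snd ≫ pullback.fst _ _) :
    ∃ N : Subgroup Gal(kbar/k), IsOpen (N : Set Gal(kbar/k)) ∧
      ∀ g (hg : g ∈ P.stab), g ∈ N → P.alphaTotal ⟨g, hg⟩ ≫ a = a := by
  have := P.finite
  obtain ⟨hc⟩ := P.nonempty_isLimit_levelCone
  have base : FiniteOver P.L := ⟨P.L, P.finite, le_rfl⟩
  have : Nonempty (FiniteOver P.L) := ⟨base⟩
  have hfst (E : FiniteOver P.L) : IsAffineHom (P.atLevelFst E) :=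
    MorphismProperty.IsStableUnderBaseChange.of_isPullback (P := @IsAffineHom)
      (IsPullback.of_hasPullback P.π _).flip inferInstance
  have hfst' (E : FiniteOver P.L) : IsSeparated (P.atLevelFst E) :=
    have := hfst E
    inferInstance
  have h1 {E E' : FiniteOver P.L} (h : E ≤ E') : IsAffineHom (P.atLevelMap h) := by
    have : IsAffineHom (P.atLevelMap h ≫ P.atLevelFst E) := by
      rw [atLevelMap, atLevelLift_fst]
      exact hfst E'
    exact MorphismProperty.of_postcomp (W := @IsAffineHom) (W' := @IsSeparated) _
      (P.atLevelFst E) (hfst' E) this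
  have h1' {E E' : (FiniteOver P.L)ᵒᵖ} (f : E ⟶ E') : IsAffineHom (P.levelDiagram.map f) :=
    h1 (leOfHom f.unop)
  have h2 (E : FiniteOver P.L) : CompactSpace (P.atLevel E) := by
    have := P.compact
    have := hfst E
    exact QuasiCompact.compactSpace_of_compactSpace (P.atLevelFst E)
  have h2' (E : (FiniteOver P.L)ᵒᵖ) : CompactSpace (P.levelDiagram.obj E) := h2 E.unop
  -- `V` is locally of finite type over a field, hence locally noetherian, hence quasi-separated.
  have hV : QuasiSeparatedSpace P.V := by
    have : LocallyOfFiniteType (specMap (k := k) P.L) :=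
      HasRingHomProperty.Spec_iff.2 (RingHom.finiteType_algebraMap.2 inferInstance)
    have : LocallyOfFiniteType (pullback.fst p (specMap (k := k) P.L) ≫ p) := inferInstance
    have : LocallyOfFiniteType (P.π ≫ pullback.fst p (specMap (k := k) P.L) ≫ p) := inferInstance
    have : IsLocallyNoetherian P.V :=
      LocallyOfFiniteType.isLocallyNoetherian (P.π ≫ pullback.fst _ _ ≫ p)
    infer_instance
  have h3 (E : FiniteOver P.L) : QuasiSeparatedSpace (P.atLevel E) :=
    have := hfst E
    quasiSeparatedSpace_of_quasiSeparated (P.atLevelFst E)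
  have h3' (E : (FiniteOver P.L)ᵒᵖ) : QuasiSeparatedSpace (P.levelDiagram.obj E) := h3 E.unop
  have hX {E E' : FiniteOver P.L} (h : E ≤ E') :
      P.atLevelMap h ≫ P.atLevelSnd E ≫ pullback.fst p (specMap E.1) =
        P.atLevelSnd E' ≫ pullback.fst p (specMap E'.1) := by
    rw [atLevelMap, atLevelLift_snd_assoc, Category.assoc, baseChangeMap_fst]
  obtain ⟨E, b, hb, -⟩ := Scheme.exists_π_app_comp_eq_of_locallyOfFinitePresentation
    P.levelDiagram
    { app E := P.atLevelSnd E.unop ≫ pullback.fst p (specMap E.unop.1)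
      naturality _ _ f := (hX (leOfHom f.unop)).trans (Category.comp_id _).symm } q P.levelCone hc a
    (by
      ext E : 2
      refine (P.toAtLevel_snd_assoc E.unop _).trans (Eq.trans ?_ ha.symm)
      rw [toLevel, baseChangeMap_fst])
  have := E.unop.2.1
  refine ⟨E.unop.1.fixingSubgroup, IntermediateField.fixingSubgroup_isOpen _, fun g hg hg' => ?_⟩
  have e := P.alphaTotal_toAtLevel E.unop ⟨g, hg⟩ hg'
  have hb' : P.toAtLevel E.unop ≫ b = a := hb
  rw [← hb']
  exact (Category.assoc _ _ _).symm.trans (congrArg (· ≫ b) e)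

end Model
end LevelLimit

/-! ### Coverings of the small étale site, pointwise. -/

section EtaleTopology

variable {S : Scheme.{u}}

lemma mem_smallEtaleTopology_iff {U : S.Etale} {R : Sieve U} :
    R ∈ S.smallEtaleTopology U ↔
      ∀ x : U.left, ∃ (Y : S.Etale) (f : Y ⟶ U) (y : Y.left), R f ∧ f.left y = x := by
  let ι := Σ Y : S.Etale, {f : Y ⟶ U // R f}
  have e : R = Sieve.ofArrows (fun i : ι => i.1) (fun i => i.2.1) := by
    ext Y f
    constructor
    · intro h
      exact Sieve.ofArrows_mk (fun i : ι => i.1) (fun i => i.2.1) ⟨Y, f, h⟩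
    · rintro ⟨_, g, _, ⟨i⟩, rfl⟩
      exact R.downward_closed i.2.2 g
  rw [e, Scheme.ofArrows_mem_smallEtaleTopology_iff, ← e, Set.eq_univ_iff_forall]
  refine forall_congr' fun x => ?_
  rw [Set.mem_iUnion]
  constructor
  · rintro ⟨i, y, hy⟩
    exact ⟨i.1, i.2.1, y, i.2.2, hy⟩
  · rintro ⟨Y, f, y, hf, hy⟩
    exact ⟨⟨Y, f, hf⟩, y, hy⟩

/-- A morphism between étale `S`-schemes is itself étale, hence open. This allows the extraction of
finite subcoverings. -/
lemma isOpen_range_left {U V : S.Etale} (f : U ⟶ V) : IsOpen (Set.range f.left) := by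
  have : Etale (f.left ≫ str V) := by
    rw [str_w]
    infer_instance
  have : Etale f.left := MorphismProperty.of_postcomp (W := @Etale) (W' := @Etale) f.left (str V)
    inferInstance this
  exact f.left.isOpenMap.isOpen_range

end EtaleTopology

/-! ### Étale schemes over `X̄` and their morphisms descend to finite subextensions. -/

section Descent

open TensorProduct

lemma exists_point_of_isPullback {P X Y Z : Scheme.{u}} {fst : P ⟶ X} {snd : P ⟶ Y}
    {f : X ⟶ Z} {g : Y ⟶ Z} (h : IsPullback fst snd f g) (x : X) (y : Y) (e : f x = g y) :
    ∃ z : P, fst z = x ∧ snd z = y := by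
  obtain ⟨z, hx, hy⟩ := Scheme.Pullback.exists_preimage_pullback x y e
  refine ⟨h.isoPullback.inv z, ?_, ?_⟩
  · rw [← Scheme.Hom.comp_apply, h.isoPullback_inv_fst, hx]
  · rw [← Scheme.Hom.comp_apply, h.isoPullback_inv_snd, hy]

variable {k : Type u} [Field k] {kbar : Type u} [Field kbar] [Algebra k kbar]

section Ring
variable (R : Type u) [CommRing R] [Algebra k R]

/-- The inclusion `R ⊗ₖ L ⟶ R ⊗ₖ kbar`. -/
abbrev tensorVal (L : IntermediateField k kbar) : R ⊗[k] L →ₐ[R] R ⊗[k] kbar :=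
  Algebra.TensorProduct.map (AlgHom.id R R) L.val

lemma tensorVal_range_mono {L L' : IntermediateField k kbar} (h : L ≤ L') :
    (tensorVal R L).range ≤ (tensorVal R L').range := by
  rintro _ ⟨x, rfl⟩
  have e : (tensorVal R L').comp
      (Algebra.TensorProduct.map (AlgHom.id R R) (IntermediateField.inclusion h)) =
        tensorVal R L := by
    ext x
    simp
  exact ⟨_, DFunLike.congr_fun e x⟩

lemma tensorVal_injective (L : IntermediateField k kbar) :
    Function.Injective (tensorVal R L) :=
  Module.Flat.lTensor_preserves_injective_linearMap (M := R) L.val.toLinearMap L.val.injective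

lemma exists_mem_range_tensorVal [Algebra.IsAlgebraic k kbar] (x : R ⊗[k] kbar) :
    ∃ L : IntermediateField k kbar, FiniteDimensional k L ∧ x ∈ (tensorVal R L).range := by
  induction x using TensorProduct.induction_on with
  | zero => exact ⟨⊥, inferInstance, zero_mem _⟩
  | tmul r y =>
    have hy : _root_.IsIntegral k y := Algebra.IsIntegral.isIntegral y
    exact ⟨IntermediateField.adjoin k {y}, IntermediateField.adjoin.finiteDimensional hy,
      ⟨r ⊗ₜ ⟨y, IntermediateField.mem_adjoin_simple_self k y⟩, by simp⟩⟩
  | add x y hx hy =>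
    obtain ⟨L, h1, h2⟩ := hx
    obtain ⟨L', h1', h2'⟩ := hy
    exact ⟨L ⊔ L', inferInstance, add_mem (tensorVal_range_mono R le_sup_left h2)
      (tensorVal_range_mono R le_sup_right h2')⟩

lemma exists_le_range_tensorVal [Algebra.IsAlgebraic k kbar] {A : Subalgebra R (R ⊗[k] kbar)}
    (hA : A.FG) :
    ∃ L : IntermediateField k kbar, FiniteDimensional k L ∧ A ≤ (tensorVal R L).range := by
  classical
  obtain ⟨s, rfl⟩ := hA
  induction s using Finset.induction_on with
  | empty => exact ⟨⊥, inferInstance, by simp⟩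
  | insert x s _ ih =>
    obtain ⟨L, h1, h2⟩ := exists_mem_range_tensorVal R x
    obtain ⟨L', h1', h2'⟩ := ih
    refine ⟨L ⊔ L', inferInstance, Algebra.adjoin_le ?_⟩
    intro y hy
    rw [Finset.coe_insert, Set.mem_insert_iff] at hy
    rcases hy with rfl | hy
    · exact tensorVal_range_mono R le_sup_left h2
    · exact tensorVal_range_mono R le_sup_right (h2' (Algebra.subset_adjoin hy))

/-- An étale morphism to `Spec (R ⊗ₖ kbar)` from an affine scheme is defined over a finite
subextension. -/
lemma exists_etale_model [Algebra.IsAlgebraic k kbar] {B : CommRingCat.{u}}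
    (b : Spec B ⟶ Spec (CommRingCat.of (R ⊗[k] kbar))) [Etale b] :
    ∃ (L : IntermediateField k kbar) (_ : FiniteDimensional k L) (V : Scheme.{u})
      (π : V ⟶ Spec (CommRingCat.of (R ⊗[k] L))) (c : Spec B ⟶ V), Etale π ∧ CompactSpace V ∧
      IsPullback c b π (Spec.map (CommRingCat.ofHom (tensorVal R L).toRingHom)) := by
  obtain ⟨φ, rfl⟩ := Spec.map_surjective b
  have hφ : φ.hom.Etale := HasRingHomProperty.Spec_iff (P := @Etale).1 ‹_›
  let := φ.hom.toAlgebra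
  have : Algebra.Etale (R ⊗[k] kbar) B := hφ
  -- An étale algebra is the base change of an étale algebra over a finitely generated subalgebra
  -- `A₀`, and the generators of `A₀` involve only finitely many elements of `kbar`.
  obtain ⟨A₀, B₀, _, _, hfg, het, ⟨e⟩⟩ :=
    Algebra.Etale.exists_subalgebra_fg R (R ⊗[k] kbar) B
  obtain ⟨L, hL, hle⟩ := exists_le_range_tensorVal R hfg
  let i : A₀ →+* R ⊗[k] L := ((AlgEquiv.ofInjective _ (tensorVal_injective R L)).symm.toAlgHom.comp
    (Subalgebra.inclusion hle)).toRingHom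
  have hi : (tensorVal R L).toRingHom.comp i = A₀.val.toRingHom := by
    ext x
    exact congrArg Subtype.val ((AlgEquiv.ofInjective _ (tensorVal_injective R L)).apply_symm_apply
      (Subalgebra.inclusion hle x))
  let β : Spec (CommRingCat.of B₀) ⟶ Spec (CommRingCat.of A₀) :=
    Spec.map (CommRingCat.ofHom (algebraMap A₀ B₀))
  have hβ : Etale β := HasRingHomProperty.Spec_iff.2 ((RingHom.etale_algebraMap).2 het)
  let ι : Spec (CommRingCat.of (R ⊗[k] L)) ⟶ Spec (CommRingCat.of A₀) :=
    Spec.map (CommRingCat.ofHom i)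
  have hpo : IsPushout (CommRingCat.ofHom (algebraMap A₀ (R ⊗[k] kbar)))
      (CommRingCat.ofHom (algebraMap A₀ B₀)) φ
      (CommRingCat.ofHom (e.symm.toRingHom.comp Algebra.TensorProduct.includeRight.toRingHom)) :=
    (CommRingCat.isPushout_tensorProduct A₀ (R ⊗[k] kbar) B₀).of_iso (Iso.refl _) (Iso.refl _)
      (Iso.refl _) e.symm.toRingEquiv.toCommRingCatIso (by simp) (by simp)
      (CommRingCat.hom_ext (RingHom.ext fun x => e.symm.commutes x)) rfl
  have hpb := isPullback_SpecMap_of_isPushout _ _ _ _ hpo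
  have hfac : Spec.map (CommRingCat.ofHom (tensorVal R L).toRingHom) ≫ ι =
      Spec.map (CommRingCat.ofHom (algebraMap A₀ (R ⊗[k] kbar))) := by
    rw [← Spec.map_comp, ← CommRingCat.ofHom_comp, hi]
    rfl
  have ht : IsPullback (pullback.fst β ι) (pullback.snd β ι) β ι := IsPullback.of_hasPullback β ι
  have hs : IsPullback (Spec.map (CommRingCat.ofHom (e.symm.toRingHom.comp
      Algebra.TensorProduct.includeRight.toRingHom))) (Spec.map φ) β
      (Spec.map (CommRingCat.ofHom (tensorVal R L).toRingHom) ≫ ι) := by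
    rw [hfac]; exact hpb.flip
  refine ⟨L, hL, pullback β ι, pullback.snd β ι, _, inferInstance, inferInstance,
    IsPullback.of_right' hs ht⟩
end Ring

variable {X : Scheme.{u}} {p : X ⟶ Spec (CommRingCat.of k)}

section Chart
variable (R : Type u) [CommRing R] [Algebra k R] (j : Spec (CommRingCat.of R) ⟶ X)
  (hj : j ≫ p = specMap R)

/-- For an affine chart `Spec R` of `X`, the chart `Spec (R ⊗ₖ A)` of `X ×ₖ A`. -/
def chart (A : Type u) [CommRing A] [Algebra k A] :
    Spec (CommRingCat.of (R ⊗[k] A)) ⟶ baseChange p A :=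
  pullback.lift (Spec.map (CommRingCat.ofHom Algebra.TensorProduct.includeLeftRingHom) ≫ j)
    (Spec.map (CommRingCat.ofHom Algebra.TensorProduct.includeRight.toRingHom))
    (by
      rw [Category.assoc, hj]
      exact (isPullback_SpecMap_of_isPushout _ _ _ _ (CommRingCat.isPushout_tensorProduct k R A)).w)

lemma isPullback_chart (A : Type u) [CommRing A] [Algebra k A] :
    IsPullback (chart R j hj A)
      (Spec.map (CommRingCat.ofHom Algebra.TensorProduct.includeLeftRingHom))
      (pullback.fst p (specMap A)) j := by
  have ht : IsPullback (pullback.snd p (specMap A)) (pullback.fst p (specMap A))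
    (specMap A) p := (IsPullback.of_hasPullback p (specMap A)).flip
  refine IsPullback.of_right ?_ (pullback.lift_fst _ _ _) ht
  rw [hj, show chart R j hj A ≫ pullback.snd _ _ = _ from pullback.lift_snd _ _ _]
  exact (isPullback_SpecMap_of_isPushout _ _ _ _
    (CommRingCat.isPushout_tensorProduct k R A)).flip

/-- Both charts are pulled back from `Spec R ⟶ X`, so the pasting law applies. -/
lemma isPullback_chart_toLevel (L : IntermediateField k kbar) :
    IsPullback (Spec.map (CommRingCat.ofHom (tensorVal R L).toRingHom)) (chart R j hj kbar)
      (chart R j hj L) (toLevel kbar p L) := by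
  have h1 := isPullback_chart R j hj L
  have h2 := isPullback_chart R j hj kbar
  have e1 : Spec.map (CommRingCat.ofHom (tensorVal R L).toRingHom) ≫
      Spec.map (CommRingCat.ofHom (Algebra.TensorProduct.includeLeftRingHom (A := R) (B := L)
        (R := k))) = Spec.map (CommRingCat.ofHom (Algebra.TensorProduct.includeLeftRingHom (A := R)
        (B := kbar) (R := k))) := by
    rw [← Spec.map_comp, ← CommRingCat.ofHom_comp]
    congr 2
  have e2 : toLevel kbar p L ≫ pullback.fst _ _ = pullback.fst p (specMap kbar) :=
    baseChangeMap_fst p _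
  refine IsPullback.of_right (h₁₂ := Spec.map (CommRingCat.ofHom
    (Algebra.TensorProduct.includeLeftRingHom (A := R) (B := L) (R := k)))) ?_ ?_ h1.flip
  · rw [e1, e2]
    exact h2.flip
  · apply pullback.hom_ext
    · rw [Category.assoc, Category.assoc, e2, h1.w, ← Category.assoc, e1, h2.w]
    · rw [Category.assoc, Category.assoc, toLevel, baseChangeMap_snd]
      rw [show chart R j hj L ≫ pullback.snd _ _ = _ from pullback.lift_snd _ _ _,
        ← Category.assoc,
        show chart R j hj kbar ≫ pullback.snd _ _ = _ from pullback.lift_snd _ _ _,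
        ← Spec.map_comp, ← Spec.map_comp, ← CommRingCat.ofHom_comp, ← CommRingCat.ofHom_comp]
      congr 2

end Chart

/-- The étale site of `X̄` is covered by the schemes with a model over a finite subextension. -/
lemma exists_model_hom [Algebra.IsAlgebraic k kbar] (U : (Xbar kbar p).Etale) (x : U.left) :
    ∃ (P : Model kbar p) (f : P.U ⟶ U) (y : P.U.left), f.left y = x := by
  obtain ⟨R, j, hj, hxj, -⟩ := Scheme.exists_affine_mem_range_and_range_subset
    (X := X) (x := pullback.fst p (specMap kbar) (str U x)) (U := ⊤) trivial
  obtain ⟨r, hr⟩ := hxj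
  let := (Spec.preimage (j ≫ p)).hom.toAlgebra
  have hjp : j ≫ p = specMap (k := k) R := (Spec.map_preimage (j ≫ p)).symm
  have h2 := isPullback_chart R j hjp kbar
  have hopen : IsOpenImmersion (chart R j hjp kbar) :=
    MorphismProperty.IsStableUnderBaseChange.of_isPullback (P := @IsOpenImmersion) h2.flip hj
  obtain ⟨a, ha, -⟩ := exists_point_of_isPullback h2 (str U x) r hr.symm
  -- Restrict `U` to the chart at `x`, and pass to an affine neighbourhood `Spec B` of the resulting
  -- point, so that the ring-theoretic descent applies.
  obtain ⟨w, hw1, hw2⟩ := Scheme.Pullback.exists_preimage_pullback (f := str U)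
    (g := chart R j hjp kbar) x a ha.symm
  obtain ⟨B, i, hi, ⟨z, hz⟩, -⟩ := Scheme.exists_affine_mem_range_and_range_subset
    (X := pullback (str U) (chart R j hjp kbar)) (x := w) (U := ⊤) trivial
  obtain ⟨L, hL, V, π, c, hπ, hV, hpb⟩ := exists_etale_model (kbar := kbar) R
    (i ≫ pullback.snd (str U) (chart R j hjp kbar))
  have hopenL : IsOpenImmersion (chart R j hjp L) :=
    MorphismProperty.IsStableUnderBaseChange.of_isPullback (P := @IsOpenImmersion)
      (isPullback_chart R j hjp L).flip hj
  -- The chart of `X ×ₖ L` is an open immersion, so `V` remains étale over `X ×ₖ L`.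
  let P : Model kbar p := ⟨L, hL, V, π ≫ chart R j hjp L, inferInstance, hV⟩
  have hP := hpb.paste_vert (isPullback_chart_toLevel R j hjp L)
  have e : hP.isoPullback.inv ≫ (i ≫ pullback.snd (str U) (chart R j hjp kbar)) ≫
      chart R j hjp kbar = P.snd := hP.isoPullback_inv_snd
  have w : (hP.isoPullback.inv ≫ i ≫ pullback.fst (str U) (chart R j hjp kbar)) ≫ str U =
      str P.U := by
    refine Eq.trans ?_ e
    simp only [Category.assoc, pullback.condition]
  refine ⟨P, etaleHom (V := U) _ w, hP.isoPullback.hom z, ?_⟩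
  change (hP.isoPullback.inv ≫ i ≫ pullback.fst (str U) (chart R j hjp kbar))
    (hP.isoPullback.hom z) = x
  rw [← Scheme.Hom.comp_apply, Iso.hom_inv_id_assoc, Scheme.Hom.comp_apply, hz, hw1]

/-- Every covering sieve contains a covering by schemes with a model. -/
lemma exists_model_cover [Algebra.IsAlgebraic k kbar] (U : (Xbar kbar p).Etale) {R : Sieve U}
    (hR : R ∈ (Xbar kbar p).smallEtaleTopology U) (x : U.left) :
    ∃ (Q : Model kbar p) (f : Q.U ⟶ U) (y : Q.U.left), R f ∧ f.left y = x := by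
  obtain ⟨Y, f, y, hf, hy⟩ := mem_smallEtaleTopology_iff.1 hR x
  obtain ⟨Q, g, z, hz⟩ := exists_model_hom Y y
  refine ⟨Q, g ≫ f, z, R.downward_closed hf g, ?_⟩
  change (g.left ≫ f.left) z = x
  rw [Scheme.Hom.comp_apply, hz, hy]

instance (P : Model kbar p) : CompactSpace P.U.left := by
  have : CompactSpace P.total := by
    have := P.compact
    have : IsAffineHom (toLevel kbar p P.L) := baseChangeMap_isAffineHom _
    have : IsAffineHom P.fst :=
      MorphismProperty.IsStableUnderBaseChange.of_isPullback (P := @IsAffineHom)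
        (IsPullback.of_hasPullback P.π _).flip this
    exact QuasiCompact.compactSpace_of_compactSpace P.fst
  exact this

/-- Every covering sieve of a quasi-compact étale scheme over `X̄` contains a finite covering by
schemes with a model. -/
lemma exists_finite_model_cover [Algebra.IsAlgebraic k kbar] (P : Model kbar p) {R : Sieve P.U}
    (hR : R ∈ (Xbar kbar p).smallEtaleTopology P.U) :
    ∃ (ι : Type u) (_ : Finite ι) (Q : ι → Model kbar p) (f : ∀ i, (Q i).U ⟶ P.U),
      (∀ i, R (f i)) ∧ Sieve.ofArrows _ f ∈ (Xbar kbar p).smallEtaleTopology P.U := by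
  choose Q f y hf hy using exists_model_cover P.U hR
  have ho (x) : IsOpen (Set.range (f x).left) := isOpen_range_left (f x)
  obtain ⟨t, ht⟩ := isCompact_univ.elim_finite_subcover (fun x => Set.range (f x).left) ho
    (fun x _ => Set.mem_iUnion.2 ⟨x, y x, hy x⟩)
  refine ⟨t, inferInstance, fun i => Q i, fun i => f i, fun i => hf i,
    (Scheme.ofArrows_mem_smallEtaleTopology_iff _).2 (Set.eq_univ_of_forall fun x => ?_)⟩
  obtain ⟨i, hi, hx⟩ := Set.mem_iUnion₂.1 (ht (Set.mem_univ x))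
  exact Set.mem_iUnion.2 ⟨⟨i, hi⟩, hx⟩

variable [Finite k] [IsAlgClosure k kbar] [LocallyOfFiniteType p]

/-- A morphism over the automorphism of `X̄` given by `g` is compatible with the action of an open
subgroup. -/
lemma exists_alphaTotal_comm {P Q : Model kbar p} {g : Gal(kbar/k)} (f : P.total ⟶ Q.total)
    (hf : f ≫ Q.snd = P.snd ≫ act (galAction kbar p) g) :
    ∃ N : Subgroup Gal(kbar/k), IsOpen (N : Set Gal(kbar/k)) ∧
      ∀ n ∈ N, ∃ (hP : n ∈ P.stab) (hQ : n ∈ Q.stab),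
        P.alphaTotal ⟨n, hP⟩ ≫ f = f ≫ Q.alphaTotal ⟨n, hQ⟩ := by
  have := IsAlgClosure.isAlgebraic (R := k) (K := kbar)
  have := P.finite
  have := Q.finite
  have hfin : Algebra.FinitePresentation k Q.L := Algebra.FinitePresentation.of_finiteType.1 inferInstance
  have hfp : LocallyOfFinitePresentation (specMap (k := k) Q.L) :=
    (LocallyOfFinitePresentation.SpecMap_iff _).2 (RingHom.finitePresentation_algebraMap.2 hfin)
  -- Commutation is tested on the two projections of `V_Q ×_L kbar`. On the first it is invariance
  -- of `f ≫ Q.fst`, whose target is locally of finite presentation over `X`; on the second it is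
  -- commutativity of `Ĝ`.
  obtain ⟨N, hN, h⟩ := P.exists_alpha_comp_eq (Q.π ≫ pullback.fst p (specMap Q.L)) (f ≫ Q.fst) (by
    have e1 : Q.fst ≫ Q.π ≫ pullback.fst p (specMap Q.L) =
        Q.snd ≫ pullback.fst p (specMap kbar) := by
      rw [← Category.assoc, Q.fst_π, Category.assoc, toLevel, baseChangeMap_fst]
    have e2 : act (galAction kbar p) g ≫ pullback.fst p (specMap kbar) = pullback.fst _ _ :=
      baseChangeMap_fst p _
    rw [Category.assoc, e1, ← Category.assoc, hf, Category.assoc, e2])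
  refine ⟨N ⊓ P.stab ⊓ Q.stab, (hN.inter (IntermediateField.fixingSubgroup_isOpen _)).inter
    (IntermediateField.fixingSubgroup_isOpen _), ?_⟩
  rintro n ⟨⟨hn, hnP⟩, hnQ⟩
  refine ⟨hnP, hnQ, Q.total_hom_ext ?_ ?_⟩
  · rw [Category.assoc, Category.assoc, Model.alphaTotal_fst, h n hnP hn]
  · rw [Category.assoc, Category.assoc, Model.alphaTotal_snd, hf, ← Category.assoc,
      Model.alphaTotal_snd, ← Category.assoc, hf, Category.assoc, Category.assoc, act_comp,
      act_comp, gal_mul_comm]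

lemma exists_alpha_comm {P Q : Model kbar p} {g : Gal(kbar/k)} (f : P.U.left ⟶ Q.U.left)
    (hf : f ≫ str Q.U = str P.U ≫ act (galAction kbar p) g) :
    ∃ N : Subgroup Gal(kbar/k), IsOpen (N : Set Gal(kbar/k)) ∧
      ∀ n ∈ N, ∃ (hP : n ∈ P.stab) (hQ : n ∈ Q.stab),
        P.alpha ⟨n, hP⟩ ≫ f = f ≫ Q.alpha ⟨n, hQ⟩ :=
  exists_alphaTotal_comm (P := P) (Q := Q) f hf

end Descent

/-! ### Sheaves of abelian groups in terms of sections. -/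

section Sheaves

variable {S : Scheme.{u}}

/-- Elementwise form of the sheaf condition on the small étale site. -/
lemma isSheaf_of_existsUnique (P : (S.Etale)ᵒᵖ ⥤ AddCommGrpCat.{u})
    (h : ∀ (U : S.Etale) (R : Sieve U), R ∈ S.smallEtaleTopology U →
      ∀ x : (∀ (Y : S.Etale) (f : Y ⟶ U), R f → P.obj (op Y)),
        (∀ (Y Z : S.Etale) (f : Y ⟶ U) (hf : R f) (g : Z ⟶ Y),
          P.map g.op (x Y f hf) = x Z (g ≫ f) (R.downward_closed hf g)) →
        ∃! s : P.obj (op U), ∀ (Y : S.Etale) (f : Y ⟶ U) (hf : R f), P.map f.op s = x Y f hf) :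
    Presheaf.IsSheaf S.smallEtaleTopology P := by
  intro E U R hR x hx
  let ξ (Y : S.Etale) (f : Y ⟶ U) (hf : R f) : E ⟶ P.obj (op Y) := x f hf
  have hx' : ∀ (Y Z : S.Etale) (f : Y ⟶ U) (hf : R f) (g : Z ⟶ Y),
      ξ Y f hf ≫ P.map g.op = ξ Z (g ≫ f) (R.downward_closed hf g) := by
    intro Y Z f hf g
    have := hx (Y₁ := Y) (Y₂ := Z) g (𝟙 Z) hf (R.downward_closed hf g) (Category.id_comp _).symm
    refine Eq.trans this ?_
    change ξ Z (g ≫ f) _ ≫ P.map (𝟙 _) = _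
    rw [P.map_id, Category.comp_id]
  have hex (e : E) := h U R hR (fun Y f hf => (ξ Y f hf).hom e) (fun Y Z f hf g =>
    ConcreteCategory.congr_hom (hx' Y Z f hf g) e)
  choose s hs hu using hex
  have hu' (e : E) (y y' : P.obj (op U)) (hy : ∀ (Y : S.Etale) (f : Y ⟶ U) (hf : R f),
      P.map f.op y = (ξ Y f hf).hom e) (hy' : ∀ (Y : S.Etale) (f : Y ⟶ U) (hf : R f),
      P.map f.op y' = (ξ Y f hf).hom e) : y = y' := (hu e y hy).trans (hu e y' hy').symm
  -- Uniqueness of the glued sections makes gluing additive.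
  let σ : E ⟶ P.obj (op U) := AddCommGrpCat.ofHom ⟨⟨s, by
    refine hu' 0 _ _ (hs 0) fun Y f hf => ?_
    rw [map_zero, map_zero]⟩, by
    intro a b
    refine hu' (a + b) _ _ (hs _) fun Y f hf => ?_
    rw [map_add, map_add]
    exact congrArg₂ (· + ·) (hs a Y f hf) (hs b Y f hf)⟩
  refine ⟨σ, fun Y f hf => ?_, fun (y : E ⟶ P.obj (op U)) hy => ?_⟩
  · exact AddCommGrpCat.hom_ext (AddMonoidHom.ext fun e => hs e Y f hf)
  · exact AddCommGrpCat.hom_ext (AddMonoidHom.ext fun e => hu e _ fun Y f hf =>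
      ConcreteCategory.congr_hom (hy f hf : y ≫ P.map f.op = ξ Y f hf) e)

/-- The group of sections of a sheaf. -/
abbrev Sec (F : Sheaf S.smallEtaleTopology AddCommGrpCat.{u}) (U : S.Etale) : Type u :=
  F.obj.obj (op U)

/-- Restriction of sections of a sheaf. -/
def rs (F : Sheaf S.smallEtaleTopology AddCommGrpCat.{u}) {U V : S.Etale} (f : U ⟶ V) :
    Sec F V →+ Sec F U := (F.obj.map f.op).hom

/-- The map on sections given by a morphism of sheaves. -/
def hs {F F' : Sheaf S.smallEtaleTopology AddCommGrpCat.{u}} (a : F ⟶ F') (U : S.Etale) :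
    Sec F U →+ Sec F' U := (a.hom.app (op U)).hom

section
variable {F F' F'' : Sheaf S.smallEtaleTopology AddCommGrpCat.{u}}

lemma rs_id {U : S.Etale} (x : Sec F U) : rs F (𝟙 U) x = x := by simp [rs]

lemma rs_rs {U V W : S.Etale} (f : U ⟶ V) (g : V ⟶ W) (x : Sec F W) :
    rs F f (rs F g x) = rs F (f ≫ g) x := by
  simp [rs]

lemma hs_rs (a : F ⟶ F') {U V : S.Etale} (f : U ⟶ V) (x : Sec F V) :
    hs a U (rs F f x) = rs F' f (hs a V x) :=
  ConcreteCategory.congr_hom (a.hom.naturality f.op) x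

lemma hs_comp (a : F ⟶ F') (b : F' ⟶ F'') (U : S.Etale) (x : Sec F U) :
    hs (a ≫ b) U x = hs b U (hs a U x) := rfl

lemma sheaf_hom_ext {a b : F ⟶ F'} (h : ∀ U x, hs a U x = hs b U x) : a = b := by
  apply Sheaf.hom_ext
  ext U x
  exact h U.unop x

/-- Constructor for morphisms of sheaves from maps on sections. -/
def mkHom (a : ∀ U, Sec F U →+ Sec F' U)
    (h : ∀ (U V : S.Etale) (f : U ⟶ V) (x : Sec F V), a U (rs F f x) = rs F' f (a V x)) :
    F ⟶ F' :=
  ⟨{ app U := AddCommGrpCat.ofHom (a U.unop)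
     naturality V U f := by
      ext x
      exact h U.unop V.unop f.unop x }⟩

/-- A section is a homomorphism from `ℤ`, so elements are glued by the sheaf condition for the test
object `ULift ℤ`. -/
lemma existsUnique_glue {U : S.Etale} {R : Sieve U} (hR : R ∈ S.smallEtaleTopology U)
    (x : ∀ (Y : S.Etale) (f : Y ⟶ U), R f → Sec F Y)
    (hx : ∀ (Y Z : S.Etale) (f : Y ⟶ U) (hf : R f) (g : Z ⟶ Y),
      rs F g (x Y f hf) = x Z (g ≫ f) (R.downward_closed hf g)) :
    ∃! s : Sec F U, ∀ (Y : S.Etale) (f : Y ⟶ U) (hf : R f), rs F f s = x Y f hf := by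
  let E : AddCommGrpCat.{u} := AddCommGrpCat.of (ULift ℤ)
  let c (Y : S.Etale) (y : Sec F Y) : E ⟶ F.obj.obj (op Y) :=
    AddCommGrpCat.ofHom ((zmultiplesHom _ y).comp AddEquiv.ulift.toAddMonoidHom)
  have hc (Y : S.Etale) (y : Sec F Y) : (c Y y).hom ⟨1⟩ = y := one_zsmul y
  have hext (Y : S.Etale) (a b : E ⟶ F.obj.obj (op Y)) (h : a.hom ⟨1⟩ = b.hom ⟨1⟩) : a = b := by
    ext ⟨z⟩
    have e : (ULift.up z : ULift ℤ) = z • ⟨1⟩ := ULift.ext _ _ (by simp)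
    rw [e]
    exact (map_zsmul a.hom z _).trans ((congrArg _ h).trans (map_zsmul b.hom z _).symm)
  obtain ⟨t, ht, hu⟩ := F.property E R hR (fun Y f hf => c Y (x Y f hf)) (by
    intro Y₁ Y₂ Z g₁ g₂ f₁ f₂ h₁ h₂ e
    refine hext Z _ _ ?_
    have e1 := hx _ _ f₁ h₁ g₁
    have e2 := hx _ _ f₂ h₂ g₂
    change rs F g₁ ((c _ _).hom ⟨1⟩) = rs F g₂ ((c _ _).hom ⟨1⟩)
    rw [hc, hc, e1, e2]
    congr 1)
  refine ⟨t.hom ⟨1⟩, fun Y f hf => ?_, fun s h => ?_⟩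
  · exact (ConcreteCategory.congr_hom (ht f hf) _).trans (hc _ _)
  · have := hu (c U s) (fun Y f hf => hext Y _ _ (by
      change rs F f ((c _ _).hom ⟨1⟩) = (c _ _).hom ⟨1⟩
      rw [hc, hc, h]))
    rw [← this, hc]

lemma rs_ext {U : S.Etale} {R : Sieve U} (hR : R ∈ S.smallEtaleTopology U) {s t : Sec F U}
    (h : ∀ (Y : S.Etale) (f : Y ⟶ U), R f → rs F f s = rs F f t) : s = t :=
  (existsUnique_glue hR (fun _ f _ => rs F f t) (fun _ _ _ _ _ => rs_rs _ _ _)).unique h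
    fun _ _ _ => rfl

lemma epi_iff_locally_surjective (a : F ⟶ F') : Epi a ↔ ∀ (U : S.Etale) (y : Sec F' U),
    ∃ R ∈ S.smallEtaleTopology U, ∀ (V : S.Etale) (f : V ⟶ U), R f →
      ∃ x : Sec F V, hs a V x = rs F' f y := by
  rw [← Sheaf.isLocallySurjective_iff_epi' AddCommGrpCat.{u} a]
  constructor
  · intro h U y
    refine ⟨_, Presheaf.imageSieve_mem S.smallEtaleTopology a.hom y, fun V f hf => hf⟩
  · intro h
    refine ⟨fun {U} y => ?_⟩
    obtain ⟨R, hR, hx⟩ := h U y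
    exact S.smallEtaleTopology.superset_covering (fun V f hf => hx V f hf) hR

end

end Sheaves

/-! ### The autoequivalences `U ↦ gU` of the étale site. -/

section Twist

variable {S : Scheme.{u}} {Γ : Type v} [Group Γ] (ρ : Γ →* Aut S)

lemma etale_hom_ext {U V : S.Etale} {f g : U ⟶ V} (h : f.left = g.left) : f = g :=
  MorphismProperty.Over.Hom.ext h

variable {ρ} in
lemma act_cancel {g : Γ} {T : Scheme.{u}} {a b : T ⟶ S} (h : a ≫ act ρ g = b ≫ act ρ g) :
    a = b := (cancel_mono _).1 h

lemma comp_act_act_inv (g : Γ) {T : Scheme.{u}} (a : T ⟶ S) : (a ≫ act ρ g) ≫ act ρ g⁻¹ = a := by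
  rw [Category.assoc, act_comp, inv_mul_cancel, act_one, Category.comp_id]

lemma comp_act_inv_act (g : Γ) {T : Scheme.{u}} (a : T ⟶ S) : (a ≫ act ρ g⁻¹) ≫ act ρ g = a := by
  rw [Category.assoc, act_comp, mul_inv_cancel, act_one, Category.comp_id]

variable {ρ} in
lemma comp_act_eq {g : Γ} {T T' : Scheme.{u}} {a : T ⟶ S} {f : T' ⟶ T} {b : T' ⟶ S}
    (h : f ≫ a = b ≫ act ρ g) : f ≫ a ≫ act ρ g⁻¹ = b := by
  rw [← Category.assoc, h, comp_act_act_inv]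

variable {ρ} in
lemma comp_eq_act {g : Γ} {T T' : Scheme.{u}} {a : T ⟶ S} {f : T' ⟶ T} {b : T' ⟶ S}
    (h : f ≫ a ≫ act ρ g = b) : f ≫ a = b ≫ act ρ g⁻¹ := by
  rw [← h, Category.assoc, Category.assoc, act_comp, inv_mul_cancel, act_one, Category.comp_id]

/-- The functor `U ↦ gU`. -/
def twistFunctor (g : Γ) : S.Etale ⥤ S.Etale where
  obj := twist ρ g
  map := twistMap ρ g
  map_id _ := etale_hom_ext rfl
  map_comp _ _ := etale_hom_ext rfl

/-- The morphism of `S`-schemes `U ⟶ V` underlying a morphism `gU ⟶ gV`. -/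
def untwist (g : Γ) {U V : S.Etale} (f : twist ρ g U ⟶ twist ρ g V) : U ⟶ V :=
  etaleHom (U := U) (V := V) f.left
    (act_cancel ((Category.assoc f.left (str V) (act ρ g)).trans (str_w f)))

instance (g : Γ) : (twistFunctor ρ g).Full where
  map_surjective f := ⟨untwist ρ g f, etale_hom_ext rfl⟩

instance (g : Γ) : (twistFunctor ρ g).Faithful where
  map_injective {U V a b} h := by
    have : (twistMap ρ g a).left = (twistMap ρ g b).left := congrArg (fun x => x.left) h
    exact etale_hom_ext this

/-- The identification `g(g⁻¹U) = U`. -/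
def twistTwistInv (g : Γ) (U : S.Etale) : twist ρ g (twist ρ g⁻¹ U) ≅ U where
  hom := etaleHom (U := twist ρ g (twist ρ g⁻¹ U)) (V := U) (𝟙 U.left)
    ((Category.id_comp _).trans (comp_act_inv_act ρ g (str U)).symm)
  inv := etaleHom (U := U) (V := twist ρ g (twist ρ g⁻¹ U)) (𝟙 U.left)
    ((Category.id_comp _).trans (comp_act_inv_act ρ g (str U)))
  hom_inv_id := etale_hom_ext (Category.id_comp (𝟙 U.left))
  inv_hom_id := etale_hom_ext (Category.id_comp (𝟙 U.left))

/-- Every étale scheme is isomorphic to a twist, and twisting leaves the underlying morphisms of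
schemes unchanged, so coverings go to coverings. -/
instance (g : Γ) : (twistFunctor ρ g).IsContinuous S.smallEtaleTopology S.smallEtaleTopology := by
  apply Functor.isContinuous_of_coverPreserving
  · exact compatiblePreservingOfDownwardsClosed _ (twistFunctor ρ g) fun {_ d} _ => ⟨twist ρ g⁻¹ d, twistTwistInv ρ g d⟩
  · refine ⟨fun {U R} hR => mem_smallEtaleTopology_iff.2 fun x => ?_⟩
    obtain ⟨Y, f, y, hf, hy⟩ := mem_smallEtaleTopology_iff.1 hR x
    exact ⟨twist ρ g Y, twistMap ρ g f, y,
      Presieve.image_mem_functorPushforward (twistFunctor ρ g) R.arrows hf, hy⟩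

/-- The sheaf `U ↦ F(gU)`. -/
def tw (g : Γ) : Sheaf S.smallEtaleTopology AddCommGrpCat.{u} ⥤
    Sheaf S.smallEtaleTopology AddCommGrpCat.{u} :=
  (twistFunctor ρ g).sheafPushforwardContinuous _ _ _

instance (g : Γ) : (tw ρ g).Additive where

/-- The sieve of the morphisms `Y ⟶ U` whose composition with the morphism `f : U ⟶ V` over `g`
belongs to a sieve on `V`. -/
def semilinearPullback (g : Γ) {U V : S.Etale} (f : U.left ⟶ V.left)
    (w : f ≫ str V = str U ≫ act ρ g) (R : Sieve V) : Sieve U where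
  arrows Y e := R (ofSemilinear ρ g (U := Y) (e.left ≫ f)
    (by rw [Category.assoc, w, ← Category.assoc, str_w]))
  downward_closed {Y Z e} he d := by
    have h := R.downward_closed he (twistMap ρ g d)
    rwa [show twistMap ρ g d ≫ ofSemilinear ρ g (U := Y) (e.left ≫ f) _ =
      ofSemilinear ρ g (U := Z) ((d ≫ e).left ≫ f)
        (by rw [Category.assoc, w, ← Category.assoc, str_w]) from
      etale_hom_ext (Category.assoc d.left e.left f).symm] at h

/-- The sieve is pulled back along `gU ⟶ V`, and its members are then untwisted by `g⁻¹`. -/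
lemma semilinearPullback_mem (g : Γ) {U V : S.Etale} (f : U.left ⟶ V.left)
    (w : f ≫ str V = str U ≫ act ρ g) {R : Sieve V} (hR : R ∈ S.smallEtaleTopology V) :
    semilinearPullback ρ g f w R ∈ S.smallEtaleTopology U := by
  refine mem_smallEtaleTopology_iff.2 fun x => ?_
  obtain ⟨Y, e, y, he, hy⟩ := mem_smallEtaleTopology_iff.1
    (S.smallEtaleTopology.pullback_stable (ofSemilinear ρ g f w) hR) x
  have hw : e.left ≫ str U = str Y ≫ act ρ g⁻¹ := comp_eq_act (str_w e)
  refine ⟨twist ρ g⁻¹ Y, etaleHom (U := twist ρ g⁻¹ Y) e.left hw, y, ?_, hy⟩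
  have h := R.downward_closed he (twistTwistInv ρ g Y).hom
  rwa [show (twistTwistInv ρ g Y).hom ≫ e ≫ ofSemilinear ρ g f w =
      ofSemilinear ρ g (U := twist ρ g⁻¹ Y) (e.left ≫ f) _ from
      etale_hom_ext (Category.id_comp (e.left ≫ f))] at h
  
end Twist

/-! ### The calculus of the maps `x ↦ f^*(hx)`. -/

namespace EquivariantSheaf

variable {S : Scheme.{u}} {Γ : Type v} [Group Γ] {ρ : Γ →* Aut S}

/-- The map `E(V) ⟶ E(U)` given by `x ↦ f^*(hx)` for a morphism `f : U ⟶ V` over the automorphism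
`h⁻¹` of `S`, viewed as a morphism `U ⟶ hV`. -/
def pull (E : EquivariantSheaf ρ) (h : Γ) {U V : S.Etale} (f : U.left ⟶ V.left)
    (w : f ≫ str V ≫ act ρ h = str U) : E.sec V →+ E.sec U :=
  (E.res (etaleHom (V := twist ρ h V) f w)).comp (E.smul h V)

variable (E E' : EquivariantSheaf ρ)

lemma smul_one (U : S.Etale) (x : E.sec U) : E.smul 1 U x = E.res (twistOne ρ U) x :=
  ConcreteCategory.congr_hom (E.σ_one U) x

lemma res_id {U : S.Etale} (x : E.sec U) : E.res (𝟙 U) x = x := rs_id x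

lemma res_eq_pull {U V : S.Etale} (f : U ⟶ V) (w) (x : E.sec V) :
    E.res f x = E.pull 1 f.left w x := by
  simp only [pull, AddMonoidHom.comp_apply, smul_one, res_res]
  rfl

lemma smul_eq_pull (h : Γ) (U : S.Etale) (w) (x : E.sec U) :
    E.smul h U x = E.pull h (U := twist ρ h U) (𝟙 U.left) w x :=
  (E.res_id (E.smul h U x)).symm

/-- Restrictions and the action are both instances of `pull`, so this one composition law stands for
functoriality, naturality and the cocycle condition. The equalities of group elements and of
morphisms are hypotheses, so that the law also applies where they do not hold by definition. -/
lemma pull_pull {h h' : Γ} {U V W : S.Etale} {f : U.left ⟶ V.left} {f' : V.left ⟶ W.left}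
    {w : f ≫ str V ≫ act ρ h = str U} {w' : f' ≫ str W ≫ act ρ h' = str V} {c : Γ}
    {d : U.left ⟶ W.left} {wd : d ≫ str W ≫ act ρ c = str U} (hc : c = h * h') (hd : d = f ≫ f')
    (x : E.sec W) : E.pull h f w (E.pull h' f' w' x) = E.pull c d wd x := by
  subst hc hd
  simp only [pull, AddMonoidHom.comp_apply, smul_mul, smul_res, res_res]
  rfl

lemma pull_congr {h h' : Γ} {U V : S.Etale} {f f' : U.left ⟶ V.left}
    {w : f ≫ str V ≫ act ρ h = str U} {w' : f' ≫ str V ≫ act ρ h' = str U} (hh : h = h')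
    (hf : f = f') (x : E.sec V) : E.pull h f w x = E.pull h' f' w' x := by
  subst hh hf; rfl

lemma pull_one {U : S.Etale} {h : Γ} (hh : h = 1) {f : U.left ⟶ U.left} (hf : f = 𝟙 _)
    {w : f ≫ str U ≫ act ρ h = str U} (x : E.sec U) : E.pull h f w x = x := by
  subst hh hf
  exact (E.res_eq_pull (𝟙 U) w x).symm.trans (E.res_id x)

lemma pull_res {h : Γ} {U V W : S.Etale} {f : U.left ⟶ V.left} {f' : V ⟶ W}
    {w : f ≫ str V ≫ act ρ h = str U} {d : U.left ⟶ W.left} {wd : d ≫ str W ≫ act ρ h = str U}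
    (hd : d = f ≫ f'.left) (x : E.sec W) : E.pull h f w (E.res f' x) = E.pull h d wd x := by
  rw [E.res_eq_pull f' (by rw [act_one, Category.comp_id, str_w])]
  exact E.pull_pull (mul_one h).symm hd x

lemma res_pull {h : Γ} {U V W : S.Etale} {f : U ⟶ V} {f' : V.left ⟶ W.left}
    {w : f' ≫ str W ≫ act ρ h = str V} {d : U.left ⟶ W.left} {wd : d ≫ str W ≫ act ρ h = str U}
    (hd : d = f.left ≫ f') (x : E.sec W) : E.res f (E.pull h f' w x) = E.pull h d wd x := by
  rw [E.res_eq_pull f (by rw [act_one, Category.comp_id, str_w])]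
  exact E.pull_pull (one_mul h).symm hd x

variable {E E'}

lemma hom_smul (a : E ⟶ E') (g : Γ) (U : S.Etale) (x : E.sec U) :
    hs a.hom (twist ρ g U) (E.smul g U x) = E'.smul g U (hs a.hom U x) :=
  ConcreteCategory.congr_hom (a.comm g U) x

lemma hom_pull (a : E ⟶ E') {h : Γ} {U V : S.Etale} {f : U.left ⟶ V.left}
    {w : f ≫ str V ≫ act ρ h = str U} (x : E.sec V) :
    hs a.hom U (E.pull h f w x) = E'.pull h f w (hs a.hom V x) := by
  refine (hs_rs a.hom _ _).trans ?_
  rw [hom_smul]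
  rfl

lemma es_hom_ext {a b : E ⟶ E'} (h : ∀ U x, hs a.hom U x = hs b.hom U x) : a = b :=
  hom_ext (sheaf_hom_ext h)

/-- Constructor for morphisms of equivariant sheaves from maps on sections. -/
def mkES (a : ∀ U, E.sec U →+ E'.sec U)
    (h : ∀ (g : Γ) (U V : S.Etale) (f : U.left ⟶ V.left) (w : f ≫ str V ≫ act ρ g = str U)
      (x : E.sec V), a U (E.pull g f w x) = E'.pull g f w (a V x)) : E ⟶ E' where
  hom := mkHom a fun U V f x => by
    have w : f.left ≫ str V ≫ act ρ 1 = str U := by rw [act_one, Category.comp_id, str_w]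
    exact (congrArg (a U) (E.res_eq_pull f w x)).trans ((h 1 U V f.left w x).trans
      (E'.res_eq_pull f w (a V x)).symm)
  comm g U := by
    ext x
    have w : 𝟙 U.left ≫ str U ≫ act ρ g = str (twist ρ g U) := Category.id_comp _
    exact (congrArg (a _) (E.smul_eq_pull g U w x)).trans ((h g (twist ρ g U) U _ w x).trans
      (E'.smul_eq_pull g U w (a U x)).symm)

variable (E) in
/-- The action of `g` as a morphism of sheaves. -/
def sigma (g : Γ) : E.sheaf ⟶ (tw ρ g).obj E.sheaf :=
  mkHom (E.smul g) fun _ _ f x => E.smul_res g f x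

variable (ρ) in
/-- The forgetful functor to sheaves of abelian groups. -/
def forgetAction : EquivariantSheaf ρ ⥤ Sheaf S.smallEtaleTopology AddCommGrpCat.{u} where
  obj E := E.sheaf
  map a := a.hom

instance : (forgetAction ρ).Additive where

end EquivariantSheaf

lemma rs_comm {S : Scheme.{u}} (F : Sheaf S.smallEtaleTopology AddCommGrpCat.{u})
    {U V V' W : S.Etale} {f : U ⟶ V} {g : V ⟶ W} {f' : U ⟶ V'} {g' : V' ⟶ W}
    (h : f ≫ g = f' ≫ g') (x : Sec F W) : rs F f (rs F g x) = rs F f' (rs F g' x) := by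
  rw [rs_rs, rs_rs, h]

lemma biprod_total {C : Type*} [Category C] [Preadditive C] (X Y : C) [HasBinaryBiproduct X Y] :
    biprod.desc (𝟙 X) 0 ≫ biprod.inl + biprod.desc 0 (𝟙 Y) ≫ biprod.inr = 𝟙 (X ⊞ Y) := by
  apply biprod.hom_ext' <;> simp

/-! ### Cokernels, direct sums, subsheaves and kernels of equivariant sheaves. -/

namespace EquivariantSheaf

variable {S : Scheme.{u}} {Γ : Type v} [Group Γ] {ρ : Γ →* Aut S}

section Quotient

variable {ι : Type*} (E : ι → EquivariantSheaf ρ)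
  (Q : Sheaf S.smallEtaleTopology AddCommGrpCat.{u}) (j : ∀ i, (E i).sheaf ⟶ Q)
  (hj : ∀ {Z : Sheaf S.smallEtaleTopology AddCommGrpCat.{u}} (a b : Q ⟶ Z),
    (∀ i, j i ≫ a = j i ≫ b) → a = b)
  (s : ∀ g, Q ⟶ (tw ρ g).obj Q) (hjs : ∀ i g, j i ≫ s g = (E i).sigma g ≫ (tw ρ g).map (j i))

variable {E Q j s} in
include hjs in
lemma hs_quotient_action (i : ι) (g : Γ) (U : S.Etale) (x : (E i).sec U) :
    hs (s g) U (hs (j i) U x) = hs (j i) (twist ρ g U) ((E i).smul g U x) := by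
  have := congrArg (fun a => hs a U x) (hjs i g)
  exact this

/-- The action on a sheaf `Q` that makes a jointly epimorphic family of morphisms of sheaves from
equivariant sheaves to `Q` equivariant. -/
def ofJointlyEpi : EquivariantSheaf ρ where
  sheaf := Q
  σ g U := (s g).hom.app (op U)
  naturality g U V f := (s g).hom.naturality f.op
  σ_one U := by
    -- The identity is one of morphisms out of `Q`, so it may be tested on the `E i`, where it is
    -- the unit law of their action.
    have h : s 1 = mkHom (F' := (tw ρ 1).obj Q) (fun U => rs Q (twistOne ρ U)) (fun U V f x => rs_comm Q
        (etale_hom_ext ((Category.id_comp f.left).trans (Category.comp_id f.left).symm)) x) :=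
      hj _ _ fun i => sheaf_hom_ext fun U x => by
        refine (hs_quotient_action hjs i 1 U x).trans ?_
        rw [smul_one]
        exact hs_rs (j i) _ x
    rw [h]
    rfl
  σ_mul g h U := by
    let m : (tw ρ h).obj ((tw ρ g).obj Q) ⟶ (tw ρ (g * h)).obj Q :=
      mkHom (fun U => rs Q (twistMul ρ g h U)) (fun U V f x => rs_comm Q
        (etale_hom_ext ((Category.id_comp f.left).trans (Category.comp_id f.left).symm)) x)
    have h : s (g * h) = s h ≫ (tw ρ h).map (s g) ≫ m :=
      hj _ _ fun i => sheaf_hom_ext fun U x => by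
        refine (hs_quotient_action hjs i (g * h) U x).trans ?_
        rw [smul_mul]
        refine (hs_rs (j i) _ _).trans ?_
        refine congrArg (rs Q (twistMul ρ g h U)) ?_
        refine (hs_quotient_action hjs i g _ _).symm.trans ?_
        exact congrArg (hs (s g) _) (hs_quotient_action hjs i h _ _).symm
    rw [h]
    rfl

/-- The morphisms to `Q` as morphisms of equivariant sheaves. -/
def toOfJointlyEpi (i : ι) : E i ⟶ ofJointlyEpi E Q j hj s hjs where
  hom := j i
  comm g U := congrArg (fun a => a.hom.app (op U)) (hjs i g).symm

variable {E'' : EquivariantSheaf ρ}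

/-- The morphism from `Q` to an equivariant sheaf is equivariant if its compositions with the given
morphisms to `Q` are. -/
def descOfJointlyEpi (a : Q ⟶ E''.sheaf) (b : ∀ i, E i ⟶ E'') (hab : ∀ i, j i ≫ a = (b i).hom) :
    ofJointlyEpi E Q j hj s hjs ⟶ E'' where
  hom := a
  comm g U := by
    have h : s g ≫ (tw ρ g).map a = a ≫ E''.sigma g := hj _ _ fun i => by
      rw [← Category.assoc, hjs, Category.assoc, ← Functor.map_comp, ← Category.assoc, hab]
      exact sheaf_hom_ext fun U x => hom_smul (b i) g U x
    exact congrArg (fun a => a.hom.app (op U)) h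

end Quotient

lemma sigma_naturality {E E' : EquivariantSheaf ρ} (a : E ⟶ E') (g : Γ) :
    a.hom ≫ E'.sigma g = E.sigma g ≫ (tw ρ g).map a.hom :=
  sheaf_hom_ext fun U x => (hom_smul a g U x).symm

section Cokernel

variable {E E' : EquivariantSheaf ρ} (a : E ⟶ E')

/-- The action on the cokernel of a morphism of equivariant sheaves. -/
def cokernelSigma (g : Γ) : cokernel a.hom ⟶ (tw ρ g).obj (cokernel a.hom) :=
  cokernel.desc a.hom (E'.sigma g ≫ (tw ρ g).map (cokernel.π a.hom)) (by
    rw [← Category.assoc, sigma_naturality, Category.assoc, ← Functor.map_comp,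
      cokernel.condition, Functor.map_zero, comp_zero])

lemma π_cokernelSigma (g : Γ) : cokernel.π a.hom ≫ cokernelSigma a g =
    E'.sigma g ≫ (tw ρ g).map (cokernel.π a.hom) := cokernel.π_desc _ _ _

/-- The cokernel of a morphism of equivariant sheaves. -/
def coker : EquivariantSheaf ρ :=
  ofJointlyEpi (fun _ : Unit => E') (cokernel a.hom) (fun _ => cokernel.π a.hom)
    (fun b c h => (cancel_epi _).1 (h ())) (cokernelSigma a) (fun _ => π_cokernelSigma a)

/-- The projection to the cokernel. -/
def cokerπ : E' ⟶ coker a :=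
  toOfJointlyEpi (fun _ : Unit => E') (cokernel a.hom) (fun _ => cokernel.π a.hom)
    (fun b c h => (cancel_epi _).1 (h ())) (cokernelSigma a) (fun _ => π_cokernelSigma a) ()

lemma comp_cokerπ : a ≫ cokerπ a = 0 := hom_ext (cokernel.condition a.hom)

instance : Epi (cokerπ a).hom := inferInstanceAs (Epi (cokernel.π a.hom))

/-- The universal property of the cokernel. -/
def isColimitCoker : IsColimit (CokernelCofork.ofπ (cokerπ a) (comp_cokerπ a)) :=
  CokernelCofork.IsColimit.ofπ _ _
    (fun {_} b hb => descOfJointlyEpi (fun _ : Unit => E') (cokernel a.hom)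
      (fun _ => cokernel.π a.hom) (fun b c h => (cancel_epi _).1 (h ())) (cokernelSigma a)
      (fun _ => π_cokernelSigma a) (cokernel.desc a.hom b.hom (congrArg Hom.hom hb)) (fun _ => b)
      (fun _ => cokernel.π_desc _ _ _))
    (fun b hb => hom_ext (cokernel.π_desc _ _ _))
    (fun b hb c hc => hom_ext ((cancel_epi (cokernel.π a.hom)).1
      ((congrArg Hom.hom hc).trans (cokernel.π_desc _ _ _).symm)))

instance : HasCokernels (EquivariantSheaf ρ) := ⟨fun a => ⟨_, isColimitCoker a⟩⟩

end Cokernel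

section Biproduct

variable (E E' : EquivariantSheaf ρ)

/-- The action on the direct sum of equivariant sheaves. -/
def biprodSigma (g : Γ) : E.sheaf ⊞ E'.sheaf ⟶ (tw ρ g).obj (E.sheaf ⊞ E'.sheaf) :=
  biprod.desc (E.sigma g ≫ (tw ρ g).map biprod.inl) (E'.sigma g ≫ (tw ρ g).map biprod.inr)

/-- The equivariant sheaves of a pair as a family. -/
abbrev pairFamily (b : Bool) : EquivariantSheaf ρ := bif b then E else E'

/-- The inclusions of the summands as a family. -/
def biprodIncl : ∀ b, (pairFamily E E' b).sheaf ⟶ E.sheaf ⊞ E'.sheaf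
  | true => biprod.inl
  | false => biprod.inr

lemma biprodIncl_jointly_epi {Z : Sheaf S.smallEtaleTopology AddCommGrpCat.{u}}
    (b c : E.sheaf ⊞ E'.sheaf ⟶ Z) (h : ∀ i, biprodIncl E E' i ≫ b = biprodIncl E E' i ≫ c) :
    b = c := biprod.hom_ext' _ _ (h true) (h false)

lemma biprodIncl_sigma (i : Bool) (g : Γ) : biprodIncl E E' i ≫ biprodSigma E E' g =
    (pairFamily E E' i).sigma g ≫ (tw ρ g).map (biprodIncl E E' i) := by
  cases i
  · exact biprod.inr_desc _ _
  · exact biprod.inl_desc _ _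

/-- The direct sum of equivariant sheaves. -/
def directSum : EquivariantSheaf ρ :=
  ofJointlyEpi (pairFamily E E') (E.sheaf ⊞ E'.sheaf) (biprodIncl E E')
    (biprodIncl_jointly_epi E E') (biprodSigma E E') (biprodIncl_sigma E E')

/-- A morphism from the direct sum of equivariant sheaves. -/
def directSumDesc {E'' : EquivariantSheaf ρ} (a : E ⟶ E'') (b : E' ⟶ E'') :
    directSum E E' ⟶ E'' :=
  descOfJointlyEpi (pairFamily E E') (E.sheaf ⊞ E'.sheaf) (biprodIncl E E')
    (biprodIncl_jointly_epi E E') (biprodSigma E E') (biprodIncl_sigma E E')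
    (biprod.desc a.hom b.hom) (fun | true => a | false => b)
    (fun | true => biprod.inl_desc _ _ | false => biprod.inr_desc _ _)

/-- The direct sum as a bicone. -/
def directSumBicone : BinaryBicone E E' where
  pt := directSum E E'
  inl := toOfJointlyEpi (pairFamily E E') (E.sheaf ⊞ E'.sheaf) (biprodIncl E E')
    (biprodIncl_jointly_epi E E') (biprodSigma E E') (biprodIncl_sigma E E') true
  inr := toOfJointlyEpi (pairFamily E E') (E.sheaf ⊞ E'.sheaf) (biprodIncl E E')
    (biprodIncl_jointly_epi E E') (biprodSigma E E') (biprodIncl_sigma E E') false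
  fst := directSumDesc E E' (𝟙 E) 0
  snd := directSumDesc E E' 0 (𝟙 E')
  inl_fst := hom_ext (biprod.inl_desc _ _)
  inl_snd := hom_ext (biprod.inl_desc _ _)
  inr_fst := hom_ext (biprod.inr_desc _ _)
  inr_snd := hom_ext (biprod.inr_desc _ _)

instance : HasBinaryBiproducts (EquivariantSheaf ρ) where
  has_binary_biproduct E E' := ⟨⟨directSumBicone E E', isBinaryBilimitOfTotal _ (hom_ext
    (biprod_total E.sheaf E'.sheaf))⟩⟩

instance : HasFiniteProducts (EquivariantSheaf ρ) := hasFiniteProducts_of_has_binary_and_terminal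

end Biproduct

/-- An equivariant subsheaf of an equivariant sheaf. -/
structure Sub (E : EquivariantSheaf ρ) where
  /-- The sections of the subsheaf. -/
  carrier : ∀ U, AddSubgroup (E.sec U)
  pull_mem : ∀ (g : Γ) (U V : S.Etale) (f : U.left ⟶ V.left) (w : f ≫ str V ≫ act ρ g = str U)
    (x : E.sec V), x ∈ carrier V → E.pull g f w x ∈ carrier U
  local_mem : ∀ (U : S.Etale) (R : Sieve U), R ∈ S.smallEtaleTopology U → ∀ x : E.sec U,
    (∀ (V : S.Etale) (f : V ⟶ U), R f → E.res f x ∈ carrier V) → x ∈ carrier U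

namespace Sub

variable {E : EquivariantSheaf ρ} (Z : E.Sub)

lemma res_mem {U V : S.Etale} (f : U ⟶ V) {x : E.sec V} (hx : x ∈ Z.carrier V) :
    E.res f x ∈ Z.carrier U := by
  rw [E.res_eq_pull f (by rw [act_one, Category.comp_id, str_w])]
  exact Z.pull_mem _ _ _ _ _ _ hx

lemma smul_mem (g : Γ) (U : S.Etale) {x : E.sec U} (hx : x ∈ Z.carrier U) :
    E.smul g U x ∈ Z.carrier (twist ρ g U) := by
  rw [E.smul_eq_pull g U (Category.id_comp _)]
  exact Z.pull_mem _ _ _ _ _ _ hx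

/-- The restriction of sections of a subsheaf. -/
def resHom {U V : S.Etale} (f : U ⟶ V) : Z.carrier V →+ Z.carrier U :=
  ((E.res f).comp (Z.carrier V).subtype).codRestrict _ fun x => Z.res_mem f x.2

/-- The presheaf of sections of a subsheaf. -/
def presheaf : (S.Etale)ᵒᵖ ⥤ AddCommGrpCat.{u} where
  obj U := AddCommGrpCat.of (Z.carrier U.unop)
  map f := AddCommGrpCat.ofHom (Z.resHom f.unop)
  map_id U := AddCommGrpCat.hom_ext (AddMonoidHom.ext fun x => Subtype.ext (E.res_id x.1))
  map_comp f g := AddCommGrpCat.hom_ext (AddMonoidHom.ext fun x =>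
    Subtype.ext (E.res_res g.unop f.unop x.1).symm)

/-- Sections glue in `E`, and the result belongs to the subsheaf because membership is local. -/
lemma isSheaf : Presheaf.IsSheaf S.smallEtaleTopology Z.presheaf :=
  isSheaf_of_existsUnique _ fun U R hR x hx => by
    obtain ⟨s, hs, hu⟩ := existsUnique_glue (F := E.sheaf) hR
      (fun Y f hf => (show Z.carrier Y from x Y f hf).1)
      (fun Y W f hf g => congrArg Subtype.val (hx Y W f hf g))
    have hs' : s ∈ Z.carrier U := Z.local_mem U R hR s fun V f hf => by
      have : E.res f s = _ := hs V f hf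
      rw [this]
      exact (show Z.carrier V from x V f hf).2
    exact ⟨⟨s, hs'⟩, fun Y f hf => Subtype.ext (hs Y f hf), fun y hy =>
      Subtype.ext (hu _ fun Y f hf => congrArg Subtype.val (hy Y f hf))⟩

/-- An equivariant subsheaf as an equivariant sheaf. -/
def toES : EquivariantSheaf ρ where
  sheaf := ⟨Z.presheaf, Z.isSheaf⟩
  σ g U := AddCommGrpCat.ofHom
    (((E.smul g U).comp (Z.carrier U).subtype).codRestrict (Z.carrier (twist ρ g U))
      fun x => Z.smul_mem g U x.2)
  naturality g U V f := AddCommGrpCat.hom_ext (AddMonoidHom.ext fun x =>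
    Subtype.ext (E.smul_res g f x.1))
  σ_one U := AddCommGrpCat.hom_ext (AddMonoidHom.ext fun x => Subtype.ext (E.smul_one U x.1))
  σ_mul g h U := AddCommGrpCat.hom_ext (AddMonoidHom.ext fun x => Subtype.ext (E.smul_mul g h U x.1))

/-- The inclusion of a subsheaf. -/
def incl : Z.toES ⟶ E where
  hom := ⟨{ app U := AddCommGrpCat.ofHom (Z.carrier U.unop).subtype
            naturality _ _ _ := rfl }⟩
  comm _ _ := rfl

/-- The section of the subsheaf given by a section of the sheaf. -/
def toSec {U : S.Etale} (x : E.sec U) (hx : x ∈ Z.carrier U) : Z.toES.sec U := ⟨x, hx⟩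

lemma incl_mem {U : S.Etale} (x : Z.toES.sec U) : hs Z.incl.hom U x ∈ Z.carrier U :=
  Subtype.prop (p := (· ∈ Z.carrier U)) x

lemma incl_injective (U : S.Etale) : Function.Injective (hs Z.incl.hom U) :=
  Subtype.val_injective (p := (· ∈ Z.carrier U))

instance : Mono Z.incl where
  right_cancellation a b h := es_hom_ext fun U x => Z.incl_injective U
    (congrArg (fun c => hs (Hom.hom c) U x) h)

/-- A morphism with values in a subsheaf. -/
def lift {E' : EquivariantSheaf ρ} (a : E' ⟶ E) (h : ∀ U x, hs a.hom U x ∈ Z.carrier U) :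
    E' ⟶ Z.toES :=
  mkES (fun U => (hs a.hom U).codRestrict (Z.carrier U) (h U)) fun g U V f w x =>
    Z.incl_injective U ((hom_pull a x).trans (hom_pull Z.incl (Z.toSec (hs a.hom V x) (h V x))).symm)

lemma lift_incl {E' : EquivariantSheaf ρ} (a : E' ⟶ E) (h : ∀ U x, hs a.hom U x ∈ Z.carrier U) :
    Z.lift a h ≫ Z.incl = a := es_hom_ext fun _ _ => rfl

end Sub

section Kernel

variable {E E' : EquivariantSheaf ρ} (a : E ⟶ E')

/-- The kernel of a morphism as a subsheaf. -/
def ker : E.Sub where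
  carrier U := (hs a.hom U).ker
  pull_mem g U V f w x hx := by
    rw [AddMonoidHom.mem_ker] at hx ⊢
    rw [hom_pull, hx, map_zero]
  local_mem U R hR x hx := by
    refine rs_ext hR fun V f hf => ?_
    rw [map_zero, ← hs_rs]
    exact hx V f hf

lemma ker_comp : (ker a).incl ≫ a = 0 := es_hom_ext fun _ x => (ker a).incl_mem x

/-- The universal property of the kernel. -/
def isLimitKer : IsLimit (KernelFork.ofι (ker a).incl (ker_comp a)) :=
  KernelFork.IsLimit.ofι' _ _ fun {_} b hb =>
    ⟨(ker a).lift b fun U x => congrArg (fun c => hs (Hom.hom c) U x) hb, Sub.lift_incl _ _ _⟩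

instance : HasKernels (EquivariantSheaf ρ) := ⟨fun a => ⟨_, isLimitKer a⟩⟩

end Kernel

end EquivariantSheaf

/-! ### Coinduction from the trivial group: the right adjoint of forgetting the action. -/

namespace EquivariantSheaf

lemma id_comp_act_one {S : Scheme.{u}} {Γ : Type v} [Group Γ] (ρ : Γ →* Aut S) {T : Scheme.{u}}
    (a : T ⟶ S) : 𝟙 T ≫ a ≫ act ρ 1 = a := by
  rw [act_one, Category.comp_id, Category.id_comp]

lemma id_comp_act_mul {S : Scheme.{u}} {Γ : Type v} [Group Γ] (ρ : Γ →* Aut S) {T : Scheme.{u}}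
    (a : T ⟶ S) (x g h : Γ) :
    𝟙 T ≫ a ≫ act ρ (x * g * h) = (a ≫ act ρ (g * h)) ≫ act ρ x := by
  rw [Category.assoc, act_comp, Category.id_comp, mul_assoc]

lemma comp_act_mul {S : Scheme.{u}} {Γ : Type v} [Group Γ] {ρ : Γ →* Aut S} {T T' : Scheme.{u}}
    {f : T' ⟶ T} {a : T ⟶ S} {b : T' ⟶ S} {g : Γ} (w : f ≫ a ≫ act ρ g = b) (h : Γ) :
    f ≫ a ≫ act ρ (h * g) = b ≫ act ρ h := by
  rw [← act_comp, ← w]; simp only [Category.assoc]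

lemma smul_pull {S : Scheme.{u}} {Γ : Type v} [Group Γ] {ρ : Γ →* Aut S} (E : EquivariantSheaf ρ)
    (h g : Γ) {U V : S.Etale} (f : U.left ⟶ V.left) (w : f ≫ str V ≫ act ρ g = str U)
    (w' : f ≫ str V ≫ act ρ (h * g) = str U ≫ act ρ h) (x : E.sec V) :
    E.smul h U (E.pull g f w x) =
      E.res (twistHom ρ h (h * g) f w') (E.smul (h * g) V x) := by
  rw [E.smul_eq_pull h U (Category.id_comp _)]
  exact (E.pull_pull (U := twist ρ h U) (wd := w') rfl (Category.id_comp f).symm x)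

section Coinduced

variable {S : Scheme.{u}} {Γ : Type u} [Group Γ] {ρ : Γ →* Aut S}

section
variable {Γ' : Type v} [Group Γ'] (ρ' : Γ' →* Aut S)

/-- The restriction `F(hV) ⟶ F(gU)` along a morphism `U ⟶ V` over the automorphism `h⁻¹g`. -/
def rt (F : Sheaf S.smallEtaleTopology AddCommGrpCat.{u}) (g h : Γ') {U V : S.Etale}
    (f : U.left ⟶ V.left) (w : f ≫ str V ≫ act ρ' h = str U ≫ act ρ' g) :
    Sec F (twist ρ' h V) →+ Sec F (twist ρ' g U) := rs F (twistHom ρ' g h f w)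

variable {ρ'} {F F' : Sheaf S.smallEtaleTopology AddCommGrpCat.{u}}

lemma rt_rt {a b c : Γ'} {U V W : S.Etale} {f : U.left ⟶ V.left} {f' : V.left ⟶ W.left}
    {w : f ≫ str V ≫ act ρ' b = str U ≫ act ρ' a} {w' : f' ≫ str W ≫ act ρ' c = str V ≫ act ρ' b}
    {d : U.left ⟶ W.left} {wd : d ≫ str W ≫ act ρ' c = str U ≫ act ρ' a} (hd : d = f ≫ f')
    (x : Sec F (twist ρ' c W)) : rt ρ' F a b f w (rt ρ' F b c f' w' x) = rt ρ' F a c d wd x := by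
  subst hd
  exact rs_rs _ _ _

lemma rt_congr {a b b' : Γ'} {U V : S.Etale} {f f' : U.left ⟶ V.left}
    {w : f ≫ str V ≫ act ρ' b = str U ≫ act ρ' a} {w' : f' ≫ str V ≫ act ρ' b' = str U ≫ act ρ' a}
    (s : ∀ h, Sec F (twist ρ' h V)) (hb : b = b') (hf : f = f') :
    rt ρ' F a b f w (s b) = rt ρ' F a b' f' w' (s b') := by
  subst hb hf; rfl

lemma rt_id {a : Γ'} {U : S.Etale} {f : U.left ⟶ U.left}
    {w : f ≫ str U ≫ act ρ' a = str U ≫ act ρ' a} (hf : f = 𝟙 _) (x : Sec F (twist ρ' a U)) :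
    rt ρ' F a a f w x = x := by
  subst hf; exact rs_id x

lemma hs_rt (α : F ⟶ F') {a b : Γ'} {U V : S.Etale} {f : U.left ⟶ V.left}
    {w : f ≫ str V ≫ act ρ' b = str U ≫ act ρ' a} (x : Sec F (twist ρ' b V)) :
    hs α _ (rt ρ' F a b f w x) = rt ρ' F' a b f w (hs α _ x) := hs_rs _ _ _

end

variable (ρ) (F F' : Sheaf S.smallEtaleTopology AddCommGrpCat.{u})

/-- The presheaf `U ↦ ∏_g F(gU)`. -/
def piPresheaf : (S.Etale)ᵒᵖ ⥤ AddCommGrpCat.{u} where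
  obj U := AddCommGrpCat.of (∀ g : Γ, Sec F (twist ρ g U.unop))
  map f := AddCommGrpCat.ofHom (AddMonoidHom.mk' (fun s g => rs F (twistMap ρ g f.unop) (s g))
    fun s t => funext fun g => map_add _ (s g) (t g))
  map_id U := AddCommGrpCat.hom_ext (AddMonoidHom.ext fun s => funext fun g => rs_id (s g))
  map_comp f f' := AddCommGrpCat.hom_ext (AddMonoidHom.ext fun s => funext fun g =>
    (rs_rs (twistMap ρ g f'.unop) (twistMap ρ g f.unop) (s g)).symm)

lemma isSheaf_piPresheaf : Presheaf.IsSheaf S.smallEtaleTopology (piPresheaf ρ F) :=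
  isSheaf_of_existsUnique _ fun U R hR x hx => by
    have h (g : Γ) := existsUnique_glue (F := (tw ρ g).obj F) hR
      (fun Y f hf => (show ∀ g : Γ, Sec F (twist ρ g Y) from x Y f hf) g)
      (fun Y W f hf d => congrFun (hx Y W f hf d) g)
    choose s hs hu using h
    exact ⟨s, fun Y f hf => funext fun g => hs g Y f hf, fun t ht => funext fun g =>
      hu g _ fun Y f hf => congrFun (ht Y f hf) g⟩

/-- The equivariant sheaf `U ↦ ∏_g F(gU)`, on which `g` acts by `(gs)_h = s_{hg}`. -/
def pi : EquivariantSheaf ρ where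
  sheaf := ⟨piPresheaf ρ F, isSheaf_piPresheaf ρ F⟩
  σ g U := AddCommGrpCat.ofHom (AddMonoidHom.mk'
    (fun s h => rt ρ F h (h * g) (U := twist ρ g U) (V := U) (𝟙 U.left)
      ((Category.id_comp _).trans ((Category.assoc _ _ _).trans
        (congrArg _ (act_comp ρ h g))).symm) (s (h * g)))
    fun s t => funext fun h => map_add _ (s (h * g)) (t (h * g)))
  naturality g U V f := AddCommGrpCat.hom_ext (AddMonoidHom.ext fun s => funext fun h =>
    rs_comm F (etale_hom_ext ((Category.id_comp f.left).trans (Category.comp_id f.left).symm)) _)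
  σ_one U := AddCommGrpCat.hom_ext (AddMonoidHom.ext fun s => funext fun h =>
    rt_congr (U := twist ρ 1 U) s (mul_one h) rfl)
  σ_mul g h U := AddCommGrpCat.hom_ext (AddMonoidHom.ext fun s => funext fun a => by
    refine Eq.trans ?_ (rs_rs _ _ _).symm
    refine Eq.trans ?_ (rs_rs _ _ _).symm
    refine (rt_congr (U := twist ρ (g * h) U) s (mul_assoc a g h).symm rfl
      (w' := id_comp_act_mul ρ (str U) a g h)).trans ?_
    exact congrArg (fun e => rs F e (s (a * g * h)))
      (etale_hom_ext ((congrArg _ (Category.id_comp _)).trans (Category.id_comp _)).symm))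

variable {ρ F F'}

/-- The component in `F(hU)` of a section of `∏_g F(gU)`. -/
def piEval (h : Γ) {U : S.Etale} : (pi ρ F).sec U →+ Sec F (twist ρ h U) :=
  Pi.evalAddMonoidHom (fun g : Γ => Sec F (twist ρ g U)) h

/-- The section of `∏_g F(gU)` with given components. -/
def piMk {U : S.Etale} (s : ∀ h : Γ, Sec F (twist ρ h U)) : (pi ρ F).sec U := s

lemma pi_ext {U : S.Etale} {s t : (pi ρ F).sec U} (h : ∀ g, piEval g s = piEval g t) : s = t :=
  funext h

lemma piEval_congr {a b b' : Γ} {U V : S.Etale} {f f' : U.left ⟶ V.left}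
    {w : f ≫ str V ≫ act ρ b = str U ≫ act ρ a} {w' : f' ≫ str V ≫ act ρ b' = str U ≫ act ρ a}
    (s : (pi ρ F).sec V) (hb : b = b') (hf : f = f') :
    rt ρ F a b f w (piEval b s) = rt ρ F a b' f' w' (piEval b' s) :=
  rt_congr s hb hf

lemma piEval_pull (h : Γ) {g : Γ} {U V : S.Etale} {f : U.left ⟶ V.left}
    {w : f ≫ str V ≫ act ρ g = str U} {w' : f ≫ str V ≫ act ρ (h * g) = str U ≫ act ρ h}
    (s : (pi ρ F).sec V) :
    piEval h ((pi ρ F).pull g f w s) = rt ρ F h (h * g) f w' (piEval (h * g) s) := by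
  refine (rs_rs _ _ _).trans ?_
  exact congrArg (fun e => rs F e (s (h * g))) (etale_hom_ext (Category.comp_id f))

/-- The map between the sheaves `U ↦ ∏_g F(gU)` induced by a morphism of sheaves. -/
def piMap (a : F ⟶ F') : pi ρ F ⟶ pi ρ F' :=
  mkES (fun U => AddMonoidHom.mk' (fun s => piMk fun h => hs a _ (piEval h s)) fun s t =>
      pi_ext fun h => map_add (hs a _) (piEval h s) (piEval h t))
    fun g U V f w s => pi_ext fun h => by
      have w' : f ≫ str V ≫ act ρ (h * g) = str U ≫ act ρ h := comp_act_mul w h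
      refine (congrArg (hs a _) (piEval_pull h (w' := w') s)).trans ?_
      refine (hs_rt a _).trans ?_
      exact (piEval_pull h (w' := w') (piMk fun h => hs a _ (piEval h s))).symm

/-- The morphism `E ⟶ ∏_g F(gU)` corresponding to a morphism of sheaves `E ⟶ F`. -/
def toPi {E : EquivariantSheaf ρ} (a : E.sheaf ⟶ F) : E ⟶ pi ρ F :=
  mkES (fun U => AddMonoidHom.mk' (fun x => piMk fun h => hs a _ (E.smul h U x)) fun x y =>
      pi_ext fun h => ((congrArg (hs a _) (map_add (E.smul h U) x y)).trans (map_add (hs a _) _ _)))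
    fun g U V f w x => pi_ext fun h => by
      have w' : f ≫ str V ≫ act ρ (h * g) = str U ≫ act ρ h := comp_act_mul w h
      refine Eq.trans ?_ (piEval_pull h (w' := w') (piMk fun h => hs a _ (E.smul h V x))).symm
      refine Eq.trans ?_ (hs_rs a _ _)
      exact congrArg (hs a _) (E.smul_pull h g f w w' x)

lemma piEval_toPi {E : EquivariantSheaf ρ} (a : E.sheaf ⟶ F) (U : S.Etale) (x : E.sec U) (h : Γ) :
    piEval h (hs (toPi a).hom U x) = hs a _ (E.smul h U x) := rfl

variable (ρ F) in
/-- The evaluation `∏_g F(gU) ⟶ F(U)`, `s ↦ s_1`. -/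
def piCounit : (pi ρ F).sheaf ⟶ F :=
  mkHom (fun U => (rs F (etaleHom (U := U) (V := twist ρ 1 U) (𝟙 U.left)
      (id_comp_act_one ρ (str U)))).comp
      (piEval 1)) fun U V f s =>
    rs_comm F (etale_hom_ext ((Category.id_comp f.left).trans (Category.comp_id f.left).symm)) _

lemma toPi_counit {E : EquivariantSheaf ρ} (a : E.sheaf ⟶ F) : (toPi a).hom ≫ piCounit ρ F = a :=
  sheaf_hom_ext fun U x => by
    refine (hs_rs a _ _).symm.trans (congrArg (hs a U) ?_)
    rw [smul_one]
    refine (E.res_res _ _ x).trans ?_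
    refine Eq.trans ?_ (E.res_id x)
    exact congrArg (fun e => E.res e x) (etale_hom_ext (Category.id_comp _))

/-- All components are recovered from the one at `1` by acting, so an equivariant morphism to `∏_g
F(gU)` is determined by its composition with the counit. -/
lemma hs_piCounit_smul {U : S.Etale} (h : Γ) (s : (pi ρ F).sec U) :
    hs (piCounit ρ F) (twist ρ h U) ((pi ρ F).smul h U s) = piEval h s := by
  have w : 𝟙 U.left ≫ str U ≫ act ρ (1 * h) = str U ≫ act ρ h := by
    rw [one_mul, Category.id_comp]
  refine Eq.trans (b := rt ρ F h (1 * h) (𝟙 U.left) w (piEval (1 * h) s)) ?_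
    ((piEval_congr s (one_mul h) rfl).trans (rt_id (w := Category.id_comp _) rfl _))
  refine (rs_rs _ _ _).trans ?_
  exact congrArg (fun e => rs F e (piEval (1 * h) s)) (etale_hom_ext (Category.id_comp _))

lemma toPi_comp_counit {E : EquivariantSheaf ρ} (b : E ⟶ pi ρ F) :
    toPi (b.hom ≫ piCounit ρ F) = b :=
  es_hom_ext fun U x => pi_ext fun h => by
    rw [piEval_toPi, hs_comp, hom_smul, hs_piCounit_smul]

variable (ρ) in
/-- The functor `F ↦ (U ↦ ∏_g F(gU))`. -/
def piFunctor : Sheaf S.smallEtaleTopology AddCommGrpCat.{u} ⥤ EquivariantSheaf ρ where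
  obj := pi ρ
  map := piMap

variable (ρ) in
/-- The functor `F ↦ (U ↦ ∏_g F(gU))` is right adjoint to the forgetful functor. -/
def piAdjunction : forgetAction ρ ⊣ piFunctor ρ :=
  Adjunction.mkOfHomEquiv
    { homEquiv E F := ⟨toPi, fun b => b.hom ≫ piCounit ρ F, toPi_counit, toPi_comp_counit⟩
      homEquiv_naturality_left_symm _ _ := rfl
      homEquiv_naturality_right _ _ := rfl }

instance : (forgetAction ρ).IsLeftAdjoint := ⟨_, ⟨piAdjunction ρ⟩⟩

end Coinduced

/-! ### Equivariant sheaves form an abelian category with enough injectives. -/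

section Abelian

variable {S : Scheme.{u}} {Γ : Type u} [Group Γ] {ρ : Γ →* Aut S}

lemma injective_of_mono {F F' : Sheaf S.smallEtaleTopology AddCommGrpCat.{u}} (a : F ⟶ F') [Mono a]
    (U : S.Etale) : Function.Injective (hs a U) := by
  have : Mono a.hom := inferInstanceAs (Mono ((sheafToPresheaf _ _).map a))
  have : Mono (a.hom.app (op U)) := inferInstance
  exact (AddCommGrpCat.mono_iff_injective _).1 this

lemma mono_of_injective {F F' : Sheaf S.smallEtaleTopology AddCommGrpCat.{u}} (a : F ⟶ F')
    (h : ∀ U, Function.Injective (hs a U)) : Mono a where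
  right_cancellation b c hbc := sheaf_hom_ext fun U x => h U
    (congrArg (fun d => hs d U x) hbc)

instance {E : EquivariantSheaf ρ} (Z : E.Sub) : Mono Z.incl.hom :=
  mono_of_injective _ Z.incl_injective

instance {E E' : EquivariantSheaf ρ} (a : E ⟶ E') :
    PreservesLimit (parallelPair a 0) (forgetAction ρ) :=
  preservesLimit_of_preserves_limit_cone (isLimitKer a)
    ((KernelFork.isLimitMapConeEquiv _ (forgetAction ρ)).symm
      (KernelFork.IsLimit.ofι' _ (congrArg Hom.hom (ker_comp a)) fun {G} b hb =>
        ⟨mkHom (fun U => (hs b U).codRestrict ((ker a).carrier U)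
          fun x => congrArg (fun c => hs c U x) hb) fun U V f x =>
            (ker a).incl_injective U (hs_rs b f x), sheaf_hom_ext fun _ _ => rfl⟩))

instance : (forgetAction ρ).ReflectsIsomorphisms where
  reflects {E E'} a ha := by
    have ha : IsIso a.hom := ha
    refine ⟨⟨inv a.hom, fun g U => ?_⟩, hom_ext (IsIso.hom_inv_id a.hom),
      hom_ext (IsIso.inv_hom_id a.hom)⟩
    have h : E'.sigma g ≫ (tw ρ g).map (inv a.hom) = inv a.hom ≫ E.sigma g := by
      rw [IsIso.eq_inv_comp, ← Category.assoc, sigma_naturality, Category.assoc, ← Functor.map_comp,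
        IsIso.hom_inv_id, CategoryTheory.Functor.map_id, Category.comp_id]
    exact congrArg (fun a => a.hom.app (op U)) h

/-- Forgetting the action preserves kernels by their construction and cokernels as a left adjoint,
and it reflects isomorphisms. The comparison is therefore inherited from the abelian category of
sheaves. -/
instance {E E' : EquivariantSheaf ρ} (a : E ⟶ E') : IsIso (Abelian.coimageImageComparison a) := by
  have := IsIso.of_isIso_fac_right (Abelian.PreservesCoimage.hom_coimageImageComparison
    (forgetAction ρ) a).symm
  exact isIso_of_reflects_iso _ (forgetAction ρ)

instance : Abelian (EquivariantSheaf ρ) := Abelian.ofCoimageImageComparisonIsIso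

instance : PreservesFiniteLimits (forgetAction ρ) :=
  Functor.preservesFiniteLimits_of_preservesKernels _

/-- An embedding of the underlying sheaf into an injective sheaf corresponds under the adjunction to
an embedding of the equivariant sheaf into an injective coinduced one. -/
instance : EnoughInjectives (EquivariantSheaf ρ) :=
  EnoughInjectives.of_adjunction (piAdjunction ρ)

end Abelian
end EquivariantSheaf

open EquivariantSheaf

/-! ### Smooth sections, and `𝒯_Ĝ` as an abelian subcategory. -/

section Continuity

variable {k : Type u} [Field k] {kbar : Type u} [Field kbar] [Algebra k kbar]
variable {X : Scheme.{u}} {p : X ⟶ Spec (CommRingCat.of k)}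

/-- A section over a quasi-compact étale scheme is smooth if it is fixed by an open subgroup. -/
def IsSmooth (E : EquivariantSheaf (galAction kbar p)) (P : Model kbar p) (s : E.sec P.U) : Prop :=
  ∃ N : Subgroup Gal(kbar/k), IsOpen (N : Set Gal(kbar/k)) ∧
    ∀ g ∈ N, ∀ hg : g ∈ P.stab, E.pull g (P.alpha ⟨g⁻¹, inv_mem hg⟩) (P.alpha_inv_w g hg) s = s

section
variable {E E' : EquivariantSheaf (galAction kbar p)} {P : Model kbar p}

lemma isSmooth_zero : IsSmooth E P 0 := ⟨⊤, isOpen_univ, fun _ _ _ => map_zero _⟩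

lemma IsSmooth.add {s t : E.sec P.U} (hs : IsSmooth E P s) (ht : IsSmooth E P t) :
    IsSmooth E P (s + t) := by
  obtain ⟨N, hN, h⟩ := hs
  obtain ⟨N', hN', h'⟩ := ht
  refine ⟨N ⊓ N', hN.inter hN', fun g hg hg' => ?_⟩
  rw [map_add, h g hg.1 hg', h' g hg.2 hg']

lemma IsSmooth.neg {s : E.sec P.U} (hs : IsSmooth E P s) : IsSmooth E P (-s) := by
  obtain ⟨N, hN, h⟩ := hs
  refine ⟨N, hN, fun g hg hg' => ?_⟩
  rw [map_neg, h g hg hg']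

lemma IsSmooth.map {s : E.sec P.U} (h : IsSmooth E P s) (a : E ⟶ E') :
    IsSmooth E' P (hs a.hom P.U s) := by
  obtain ⟨N, hN, h⟩ := h
  refine ⟨N, hN, fun g hg hg' => ?_⟩
  rw [← hom_pull, h g hg hg']

lemma IsSmooth.of_map {s : E.sec P.U} (a : E ⟶ E') (ha : Function.Injective (hs a.hom P.U))
    (h : IsSmooth E' P (hs a.hom P.U s)) : IsSmooth E P s := by
  obtain ⟨N, hN, h⟩ := h
  refine ⟨N, hN, fun g hg hg' => ha ?_⟩
  rw [hom_pull, h g hg hg']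

lemma isContinuous_of_injective (a : E ⟶ E') (ha : ∀ U, Function.Injective (hs a.hom U))
    (h : IsContinuous E') : IsContinuous E :=
  fun P s => IsSmooth.of_map a (ha P.U) (h P (hs a.hom P.U s))

lemma isSmooth (M : TGhat kbar p) (s : M.obj.sec P.U) : IsSmooth M.obj P s := M.property P s

lemma exists_open_subset {ι : Type*} [Finite ι] (N : ι → Subgroup Gal(kbar/k))
    (h : ∀ i, IsOpen (N i : Set Gal(kbar/k))) :
    ∃ N' : Subgroup Gal(kbar/k), IsOpen (N' : Set Gal(kbar/k)) ∧ ∀ i, N' ≤ N i := by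
  refine ⟨⨅ i, N i, ?_, iInf_le N⟩
  rw [Subgroup.coe_iInf]
  exact isOpen_iInter_of_finite h

end

variable [Finite k] [IsAlgClosure k kbar] [LocallyOfFiniteType p]

section
variable {E E' : EquivariantSheaf (galAction kbar p)} {P : Model kbar p}

/-- The morphism commutes with an open subgroup, and `g` commutes with it because `Ĝ` is abelian. So
the intersection with a subgroup fixing `s` fixes the pullback. -/
lemma IsSmooth.pull {s : E.sec P.U} (hs : IsSmooth E P s) {Q : Model kbar p} {g : Gal(kbar/k)}
    {f : Q.U.left ⟶ P.U.left} (w : f ≫ str P.U ≫ act (galAction kbar p) g = str Q.U) :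
    IsSmooth E Q (E.pull g f w s) := by
  obtain ⟨N, hN, h⟩ := hs
  obtain ⟨N', hN', h'⟩ := exists_alpha_comm f (comp_eq_act w)
  refine ⟨N ⊓ N', hN.inter hN', fun n hn hnQ => ?_⟩
  obtain ⟨_, hnP, e⟩ := h' n⁻¹ (inv_mem hn.2)
  have hnP' : n ∈ P.stab := (inv_mem_iff (x := n)).1 hnP
  have w' : (f ≫ P.alpha ⟨n⁻¹, hnP⟩) ≫ str P.U ≫ act (galAction kbar p) (g * n) = str Q.U := by
    rw [Category.assoc, comp_act_mul (P.alpha_inv_w n hnP') g, w]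
  have e1 := E.pull_pull (w := w) (w' := P.alpha_inv_w n hnP') (wd := w') rfl rfl s
  rw [h n hn.1 hnP'] at e1
  exact (E.pull_pull (wd := w') (gal_mul_comm g n) e.symm s).trans e1.symm

/-- By quasi-compactness finitely many members of the covering suffice, and a finite intersection of
open subgroups is open. One shrinks it further until it commutes with the covering morphisms. -/
lemma isSmooth_of_local {s : E.sec P.U} {R : Sieve P.U}
    (hR : R ∈ (Xbar kbar p).smallEtaleTopology P.U)
    (h : ∀ (Q : Model kbar p) (f : Q.U ⟶ P.U), R f → IsSmooth E Q (E.res f s)) :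
    IsSmooth E P s := by
  have := IsAlgClosure.isAlgebraic (R := k) (K := kbar)
  obtain ⟨ι, _, Q, f, hf, hcov⟩ := exists_finite_model_cover P hR
  choose N hN h using fun i => h (Q i) (f i) (hf i)
  choose N' hN' h' using fun i => exists_alpha_comm (g := 1) (f i).left
    (by rw [act_one, Category.comp_id, str_w])
  obtain ⟨M, hM, hMN⟩ := exists_open_subset (fun i => N i ⊓ N' i) fun i => (hN i).inter (hN' i)
  refine ⟨M, hM, fun g hg hgP => rs_ext hcov ?_⟩
  rintro Y _ ⟨_, d, _, ⟨i⟩, rfl⟩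
  obtain ⟨hgQ, _, e⟩ := h' i g⁻¹ (inv_mem (hMN i hg).2)
  have hgQ' : g ∈ (Q i).stab := (inv_mem_iff (x := g)).1 hgQ
  have e2 := h i g (hMN i hg).1 hgQ'
  have w : ((f i).left ≫ P.alpha ⟨g⁻¹, inv_mem hgP⟩) ≫ str P.U ≫ act (galAction kbar p) g =
      str (Q i).U := by rw [Category.assoc, P.alpha_inv_w g hgP, str_w]
  rw [E.pull_res (wd := w) e.symm] at e2
  have e3 := E.res_pull (f := f i) (w := P.alpha_inv_w g hgP) (wd := w) rfl s
  rw [← rs_rs, ← rs_rs]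
  exact congrArg (rs E.sheaf d) (e3.trans e2)

/-- The sieve lives on `U` while the test object maps to `U` over `g⁻¹`; the sieve is transported
along this semilinear morphism before locality is applied. -/
lemma isSmooth_pull_of_local {U : (Xbar kbar p).Etale} {R : Sieve U}
    (hR : R ∈ (Xbar kbar p).smallEtaleTopology U) {x : E.sec U}
    (hx : ∀ (V : (Xbar kbar p).Etale) (f : V ⟶ U), R f → ∀ (g : Gal(kbar/k)) (P : Model kbar p)
      (e : P.U.left ⟶ V.left) (w : e ≫ str V ≫ act (galAction kbar p) g = str P.U),
      IsSmooth E P (E.pull g e w (E.res f x))) {g : Gal(kbar/k)} {f : P.U.left ⟶ U.left}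
    (w : f ≫ str U ≫ act (galAction kbar p) g = str P.U) : IsSmooth E P (E.pull g f w x) := by
  have w1 : f ≫ str U = str P.U ≫ act (galAction kbar p) g⁻¹ := comp_eq_act w
  refine isSmooth_of_local (semilinearPullback_mem _ g⁻¹ f w1 hR) fun Q d hd => ?_
  have hw : (d.left ≫ f) ≫ str U ≫ act (galAction kbar p) g = str Q.U := by
    rw [Category.assoc, w, str_w]
  have w2 : 𝟙 Q.U.left ≫ (str Q.U ≫ act (galAction kbar p) g⁻¹) ≫ act (galAction kbar p) g =
      str Q.U := by rw [Category.id_comp, comp_act_inv_act]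
  have h := hx _ _ hd g Q (𝟙 Q.U.left) w2
  have e := E.pull_res (V := twist (galAction kbar p) g⁻¹ Q.U)
    (f' := ofSemilinear (galAction kbar p) g⁻¹ (U := Q.U) (d.left ≫ f)
    (comp_eq_act hw)) (h := g) (f := 𝟙 Q.U.left) (wd := hw) (w := w2) (Category.id_comp _).symm x
  rw [E.res_pull (wd := hw) rfl]
  exact Eq.mp (congrArg (IsSmooth E Q) e) h

variable (E) in
/-- The largest subsheaf on which the action is continuous. -/
def smoothPart : E.Sub where
  carrier U :=
    { carrier := {s | ∀ (g : Gal(kbar/k)) (P : Model kbar p) (f : P.U.left ⟶ U.left)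
        (w : f ≫ str U ≫ act (galAction kbar p) g = str P.U), IsSmooth E P (E.pull g f w s)}
      zero_mem' g P f w := by
        rw [map_zero]; exact isSmooth_zero
      add_mem' hs ht g P f w := by
        rw [map_add]; exact (hs g P f w).add (ht g P f w)
      neg_mem' hs g P f w := by
        rw [map_neg]; exact (hs g P f w).neg }
  pull_mem g U V f w x hx g' P f' w' := by
    have wd : (f' ≫ f) ≫ str V ≫ act (galAction kbar p) (g' * g) = str P.U := by
      rw [Category.assoc, comp_act_mul w g', w']
    have e := E.pull_pull (w := w') (w' := w) (wd := wd) rfl rfl x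
    exact Eq.mpr (congrArg (IsSmooth E P) e) (hx (g' * g) P (f' ≫ f) wd)
  local_mem U R hR x hx g P f w := isSmooth_pull_of_local hR (fun V f hf => hx V f hf) w

/-- The subsheaf is defined on all étale schemes by testing every pullback to a model. On a model
the identity suffices, since smoothness is stable under pullback. -/
lemma mem_smoothPart_iff {s : E.sec P.U} : s ∈ (smoothPart E).carrier P.U ↔ IsSmooth E P s := by
  refine ⟨fun h => ?_, fun h g Q f w => h.pull w⟩
  have := h 1 P (𝟙 _) (by rw [Category.id_comp, act_one, Category.comp_id])
  rwa [E.pull_one rfl rfl] at this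

variable (E) in
/-- The largest subsheaf with continuous action, as an object of `𝒯_Ĝ`. -/
def smoothSheaf : TGhat kbar p :=
  ⟨(smoothPart E).toES, fun P s => IsSmooth.of_map (smoothPart E).incl
    ((smoothPart E).incl_injective P.U) (mem_smoothPart_iff.1 ((smoothPart E).incl_mem s))⟩

lemma mem_smoothPart_of_isContinuous (hE : IsContinuous E) {U : (Xbar kbar p).Etale}
    (s : E.sec U) : s ∈ (smoothPart E).carrier U := fun _ P _ _ => hE P _

/-- Sections lift locally, images of smooth sections are smooth, and smoothness is local. -/
lemma isContinuous_of_epi (a : E ⟶ E') [Epi a.hom] (h : IsContinuous E) : IsContinuous E' := by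
  intro P s
  obtain ⟨R, hR, hx⟩ := (epi_iff_locally_surjective a.hom).1 inferInstance P.U s
  refine isSmooth_of_local hR fun Q f hf => ?_
  obtain ⟨x, hx⟩ := hx Q.U f hf
  have := IsSmooth.map (h Q x : IsSmooth E Q x) a
  rwa [hx] at this

end

instance {E E' : EquivariantSheaf (galAction kbar p)} (a : E ⟶ E') [Mono a] : Mono a.hom :=
  inferInstanceAs (Mono ((forgetAction _).map a))

instance {E E' : EquivariantSheaf (galAction kbar p)} (a : E ⟶ E') [Epi a] : Epi a.hom :=
  inferInstanceAs (Epi ((forgetAction _).map a))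

instance : (IsContinuous (kbar := kbar) (p := p)).ContainsZero where
  exists_zero := ⟨zero, isZero_zero, fun _ _ => ⟨⊤, isOpen_univ, fun _ _ _ =>
    Subsingleton.elim (α := PUnit) _ _⟩⟩

instance : (IsContinuous (kbar := kbar) (p := p)).IsClosedUnderKernels where
  kernels_le := by
    rintro _ ⟨f, c, hc, hE, -⟩
    have : Mono c.ι := Fork.IsLimit.mono hc
    exact isContinuous_of_injective c.ι (injective_of_mono c.ι.hom) hE

instance : (IsContinuous (kbar := kbar) (p := p)).IsClosedUnderCokernels where
  cokernels_le := by
    rintro _ ⟨f, c, hc, -, hE⟩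
    have : Epi c.π := Cofork.IsColimit.epi hc
    exact isContinuous_of_epi c.π hE

/-- The difference `s - t` is a section of the intersection of the two kernels, and the inclusion of
this intersection is killed by both `a` and `b`. -/
lemma eq_of_jointly_mono {S : Scheme.{u}} {Γ : Type v} [Group Γ] {ρ : Γ →* Aut S}
    {E E₁ E₂ : EquivariantSheaf ρ} (a : E ⟶ E₁) (b : E ⟶ E₂)
    (hab : ∀ {E' : EquivariantSheaf ρ} (c : E' ⟶ E), c ≫ a = 0 → c ≫ b = 0 → c = 0)
    {U : S.Etale} {s t : E.sec U} (h₁ : hs a.hom U s = hs a.hom U t)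
    (h₂ : hs b.hom U s = hs b.hom U t) : s = t := by
  let Z := ker ((ker a).incl ≫ b)
  have h0 : Z.incl ≫ (ker a).incl = 0 := hab _
    (by rw [Category.assoc, ker_comp, comp_zero]) ((Category.assoc _ _ _).trans (ker_comp _))
  have e1 : s - t ∈ (ker a).carrier U := (map_sub _ s t).trans (sub_eq_zero.2 h₁)
  have e2 : (ker a).toSec (s - t) e1 ∈ Z.carrier U := (map_sub _ s t).trans (sub_eq_zero.2 h₂)
  exact sub_eq_zero.1 (congrArg (fun c => hs (Hom.hom c) U (Z.toSec _ e2)) h0)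

instance : (IsContinuous (kbar := kbar) (p := p)).IsClosedUnderBinaryProducts where
  limitsOfShape_le := by
    rintro E ⟨c⟩
    intro P s
    obtain ⟨N, hN, h⟩ := c.prop_diag_obj ⟨.left⟩ P (hs (c.π.app ⟨.left⟩).hom P.U s)
    obtain ⟨N', hN', h'⟩ := c.prop_diag_obj ⟨.right⟩ P (hs (c.π.app ⟨.right⟩).hom P.U s)
    refine ⟨N ⊓ N', hN.inter hN', fun g hg hgP => ?_⟩
    refine eq_of_jointly_mono (c.π.app ⟨.left⟩) (c.π.app ⟨.right⟩) ?_
      ((hom_pull (c.π.app ⟨.left⟩) s).trans (h g hg.1 hgP))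
      ((hom_pull (c.π.app ⟨.right⟩) s).trans (h' g hg.2 hgP))
    intro E' a hl hr
    exact c.isLimit.hom_ext fun
      | ⟨.left⟩ => hl.trans zero_comp.symm
      | ⟨.right⟩ => hr.trans zero_comp.symm

instance : (IsContinuous (kbar := kbar) (p := p)).IsClosedUnderIsomorphisms where
  of_iso e h := isContinuous_of_epi e.hom h

instance : (IsContinuous (kbar := kbar) (p := p)).IsClosedUnderFiniteProducts :=
  ObjectProperty.IsClosedUnderFiniteProducts.mk'

/-- A full subcategory of an abelian category that is closed under kernels, cokernels and finite
products is abelian. -/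
instance : Abelian (TGhat kbar p) := inferInstance

end Continuity

/-! ### The kernel of an endomorphism of a complex, and its total complex. -/

section Roof

variable {C : Type*} [Category C] [Abelian C]

namespace Cocone

variable (W : CochainComplex C ℕ) (τ : W ⟶ W)

open scoped ZeroObject in
/-- The terms of a complex shifted by one. -/
def shiftX : ℕ → C
  | 0 => 0
  | n + 1 => W.X n

/-- The identification of a term of the shifted complex. -/
def up (n : ℕ) : W.X n ⟶ shiftX W (n + 1) := 𝟙 (W.X n)

instance (n : ℕ) : IsIso (up W n) := inferInstanceAs (IsIso (𝟙 (W.X n)))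

/-- The differentials of a complex shifted by one. -/
def shiftD : ∀ n, shiftX W n ⟶ W.X n
  | 0 => 0
  | n + 1 => W.d n (n + 1)

lemma shiftD_zero : shiftD W 0 = 0 := rfl

lemma up_shiftD (n : ℕ) : up W n ≫ shiftD W (n + 1) = W.d n (n + 1) := Category.id_comp _

lemma shiftD_d (n : ℕ) : shiftD W n ≫ W.d n (n + 1) = 0 := by
  cases n
  · exact zero_comp
  · exact W.d_comp_d _ _ _

lemma up_shiftD_assoc (n : ℕ) {Z : C} (h : W.X (n + 1) ⟶ Z) :
    up W n ≫ shiftD W (n + 1) ≫ h = W.d n (n + 1) ≫ h := by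
  rw [← Category.assoc, up_shiftD]

lemma shiftD_d_assoc (n : ℕ) {Z : C} (h : W.X (n + 1) ⟶ Z) :
    shiftD W n ≫ W.d n (n + 1) ≫ h = 0 := by
  rw [← Category.assoc, shiftD_d, zero_comp]

/-- The differentials of the total complex of `τ : W ⟶ W`. -/
def totD (n : ℕ) : W.X n ⊞ shiftX W n ⟶ W.X (n + 1) ⊞ shiftX W (n + 1) :=
  -- On generalized elements this is `(x, y) ↦ (dx, τx - dy)`; the sign makes the square vanish.
  biprod.lift (biprod.fst ≫ W.d n (n + 1))
    ((biprod.fst ≫ τ.f n - biprod.snd ≫ shiftD W n) ≫ up W n)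

lemma totD_totD (n : ℕ) : totD W τ n ≫ totD W τ (n + 1) = 0 := by
  apply biprod.hom_ext
  · simp [totD]
  · simp [totD, up_shiftD_assoc, shiftD_d_assoc]

/-- The total complex of `τ : W ⟶ W`. -/
def tot : CochainComplex C ℕ := CochainComplex.of (fun n => W.X n ⊞ shiftX W n) (totD W τ)
  (totD_totD W τ)

/-- The first component of the total complex. -/
def p₁ (n : ℕ) : (tot W τ).X n ⟶ W.X n := (biprod.fst : W.X n ⊞ shiftX W n ⟶ _)

/-- The second component of the total complex. -/
def p₂ (n : ℕ) : (tot W τ).X n ⟶ shiftX W n := (biprod.snd : W.X n ⊞ shiftX W n ⟶ _)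

lemma tot_d (n : ℕ) : (tot W τ).d n (n + 1) = totD W τ n :=
  CochainComplex.of_d (fun n => W.X n ⊞ shiftX W n) (totD W τ) n

lemma d_p₁ (n : ℕ) : (tot W τ).d n (n + 1) ≫ p₁ W τ (n + 1) = p₁ W τ n ≫ W.d n (n + 1) := by
  rw [tot_d]
  exact biprod.lift_fst _ _

lemma d_p₂ (n : ℕ) : (tot W τ).d n (n + 1) ≫ p₂ W τ (n + 1) =
    (p₁ W τ n ≫ τ.f n - p₂ W τ n ≫ shiftD W n) ≫ up W n := by
  rw [tot_d]
  exact biprod.lift_snd _ _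

variable {W τ}

lemma tot_hom_ext {A : C} {n : ℕ} {z z' : A ⟶ (tot W τ).X n} (h₁ : z ≫ p₁ W τ n = z' ≫ p₁ W τ n)
    (h₂ : z ≫ p₂ W τ n = z' ≫ p₂ W τ n) : z = z' := biprod.hom_ext _ _ h₁ h₂

/-- The generalized element `(x, y)` of the total complex. -/
def pair {A : C} {n : ℕ} (x : A ⟶ W.X n) (y : A ⟶ shiftX W n) : A ⟶ (tot W τ).X n :=
  biprod.lift x y

@[simp] lemma pair_p₁ {A : C} {n : ℕ} (x : A ⟶ W.X n) (y : A ⟶ shiftX W n) :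
    pair x y ≫ p₁ W τ n = x := biprod.lift_fst _ _

@[simp] lemma pair_p₂ {A : C} {n : ℕ} (x : A ⟶ W.X n) (y : A ⟶ shiftX W n) :
    pair x y ≫ p₂ W τ n = y := biprod.lift_snd _ _

lemma exists_pair {A : C} {n : ℕ} (z : A ⟶ (tot W τ).X n) : ∃ x y, z = pair x y :=
  ⟨z ≫ p₁ W τ n, z ≫ p₂ W τ n, tot_hom_ext (pair_p₁ _ _).symm (pair_p₂ _ _).symm⟩

lemma exists_up {A : C} {n : ℕ} (y : A ⟶ shiftX W (n + 1)) : ∃ x, y = x ≫ up W n :=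
  ⟨y ≫ inv (up W n), by simp⟩

lemma eq_zero_of_shiftX_zero {A : C} (y : A ⟶ shiftX W 0) : y = 0 :=
  (Limits.isZero_zero C).eq_of_tgt _ _

lemma pair_d {A : C} {n : ℕ} (x : A ⟶ W.X n) (y : A ⟶ shiftX W n) :
    pair (τ := τ) x y ≫ (tot W τ).d n (n + 1) =
      pair (x ≫ W.d n (n + 1)) ((x ≫ τ.f n - y ≫ shiftD W n) ≫ up W n) := by
  apply tot_hom_ext
  · rw [Category.assoc, d_p₁, ← Category.assoc, pair_p₁, pair_p₁]
  · rw [Category.assoc, d_p₂, ← Category.assoc, Preadditive.comp_sub, ← Category.assoc,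
      ← Category.assoc, pair_p₁, pair_p₂, pair_p₂]

lemma comp_pair {A A' : C} {n : ℕ} (π : A' ⟶ A) (x : A ⟶ W.X n) (y : A ⟶ shiftX W n) :
    π ≫ pair (τ := τ) x y = pair (π ≫ x) (π ≫ y) := by
  apply tot_hom_ext <;> simp

lemma pair_inj {A : C} {n : ℕ} {x x' : A ⟶ W.X n} {y y' : A ⟶ shiftX W n} :
    pair (τ := τ) x y = pair x' y' ↔ x = x' ∧ y = y' :=
  ⟨fun h => ⟨by simpa using congrArg (· ≫ p₁ W τ n) h, by simpa using congrArg (· ≫ p₂ W τ n) h⟩,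
    fun h => by rw [h.1, h.2]⟩

lemma pair_eq_zero {A : C} {n : ℕ} {x : A ⟶ W.X n} {y : A ⟶ shiftX W n} :
    pair (τ := τ) x y = 0 ↔ x = 0 ∧ y = 0 := by
  rw [show (0 : A ⟶ (tot W τ).X n) = pair 0 0 by apply tot_hom_ext <;> simp, pair_inj]

lemma pair_add {A : C} {n : ℕ} (x x' : A ⟶ W.X n) (y y' : A ⟶ shiftX W n) :
    pair (τ := τ) x y + pair x' y' = pair (x + x') (y + y') := by
  apply tot_hom_ext <;> simp

lemma comp_up_eq_zero {A : C} {n : ℕ} {x : A ⟶ W.X n} : x ≫ up W n = 0 ↔ x = 0 :=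
  ⟨fun h => by rwa [← cancel_mono (up W n), zero_comp], fun h => by rw [h, zero_comp]⟩

end Cocone

open Cocone

variable {W K : CochainComplex C ℕ} {τ : W ⟶ W} {ι : K ⟶ W} (hιτ : ι ≫ τ = 0)

/-- The morphism from the kernel of `τ` to the total complex. -/
def kerToTot : K ⟶ tot W τ where
  f n := pair (ι.f n) 0
  comm' i j hij := by
    obtain rfl : i + 1 = j := hij
    have h : ι.f i ≫ τ.f i = 0 := congrArg (fun a => a.f i) hιτ
    rw [pair_d, comp_pair, pair_inj, ι.comm, h]
    simp

lemma kerToTot_f (n : ℕ) : (kerToTot hιτ).f n = pair (ι.f n) 0 := rfl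

lemma prev_zero : (ComplexShape.up ℕ).prev 0 = 0 := by simp

lemma prev_succ (n : ℕ) : (ComplexShape.up ℕ).prev (n + 1) = n := by simp

lemma next_nat (n : ℕ) : (ComplexShape.up ℕ).next n = n + 1 := by simp

section
variable (hS : ∀ n, (ShortComplex.mk (ι.f n) (τ.f n) (congrArg (fun a => a.f n) hιτ)).ShortExact)
include hS

lemma exists_lift_ker {A : C} {n : ℕ} (x : A ⟶ W.X n) (hx : x ≫ τ.f n = 0) :
    ∃ y, y ≫ ι.f n = x :=
  have := (hS n).mono_f
  ⟨(hS n).exact.lift x hx, (hS n).exact.lift_f x hx⟩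

/-- If `τx = dy`, then `x` is homologous to an element of the kernel of `τ`. -/
lemma exists_lift_sub {A : C} {n : ℕ} (x : A ⟶ W.X (n + 1)) (y : A ⟶ W.X n)
    (h : x ≫ τ.f (n + 1) = y ≫ W.d n (n + 1)) :
    ∃ (A' : C) (π : A' ⟶ A) (_ : Epi π) (w : A' ⟶ W.X n) (k : A' ⟶ K.X (n + 1)),
      π ≫ y = w ≫ τ.f n ∧ k ≫ ι.f (n + 1) = π ≫ x - w ≫ W.d n (n + 1) := by
  have : Epi (τ.f n) := (hS n).epi_g
  obtain ⟨A', π, hπ, w, hw⟩ := surjective_up_to_refinements_of_epi (τ.f n) y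
  obtain ⟨k, hk⟩ := exists_lift_ker hιτ hS (π ≫ x - w ≫ W.d n (n + 1)) (by
    rw [Preadditive.sub_comp, Category.assoc, Category.assoc, ← τ.comm, h, ← Category.assoc, hw,
      Category.assoc, sub_self])
  exact ⟨A', π, hπ, w, k, hw, hk⟩

/-- If `(ιx, 0) = d(u, v)`, then `τu = dv`. Subtracting from `u` the differential of a `τ`-preimage
of `v` gives an element of the kernel with the same differential, so `x` is a boundary in `K`. -/
lemma mono_homologyMap_kerToTot (n : ℕ) :
    Mono (HomologicalComplex.homologyMap (kerToTot hιτ) n) := by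
  have hmono (n) : Mono (ι.f n) := (hS n).mono_f
  cases n with
  | zero =>
    rw [HomologicalComplex.mono_homologyMap_iff_up_to_refinements _ 0 0 1 prev_zero (next_nat 0)]
    intro A x hx y hy
    refine ⟨A, 𝟙 A, inferInstance, 0, ?_⟩
    rw [(tot W τ).shape 0 0 (by simp), comp_zero, kerToTot_f, comp_pair, pair_eq_zero] at hy
    rw [zero_comp, Category.id_comp, ← cancel_mono (ι.f 0), hy.1, zero_comp]
  | succ n =>
    rw [HomologicalComplex.mono_homologyMap_iff_up_to_refinements _ n (n + 1) (n + 2)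
      (prev_succ n) (next_nat _)]
    intro A x hx z hz
    obtain ⟨u, v, rfl⟩ := exists_pair z
    rw [kerToTot_f, comp_pair, pair_d, pair_inj, comp_zero] at hz
    obtain ⟨h1, h2⟩ := hz
    have h2 := comp_up_eq_zero.1 h2.symm
    cases n with
    | zero =>
      obtain ⟨w, rfl⟩ := exists_lift_ker hιτ hS u (by simpa [shiftD_zero] using h2)
      refine ⟨A, 𝟙 A, inferInstance, w, ?_⟩
      rw [Category.id_comp, ← cancel_mono (ι.f 1), h1, Category.assoc, Category.assoc, ι.comm]
    | succ n =>
      obtain ⟨v, rfl⟩ := exists_up v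
      rw [Category.assoc, up_shiftD, sub_eq_zero] at h2
      obtain ⟨A', π, hπ, w, y, -, hy⟩ := exists_lift_sub hιτ hS u v h2
      refine ⟨A', π, hπ, y, ?_⟩
      rw [← cancel_mono (ι.f (n + 2)), Category.assoc, h1, Category.assoc, ← ι.comm,
        ← Category.assoc y, hy, Preadditive.sub_comp, Category.assoc, Category.assoc, W.d_comp_d,
        comp_zero, sub_zero]

/-- A cocycle `(x, y)` satisfies `τx = dy`. If `y = τw`, then `(x, y) - d(w, 0) = (x - dw, 0)` comes
from `K`. -/
lemma epi_homologyMap_kerToTot (n : ℕ) :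
    Epi (HomologicalComplex.homologyMap (kerToTot hιτ) n) := by
  have hmono (n) : Mono (ι.f n) := (hS n).mono_f
  cases n with
  | zero =>
    rw [HomologicalComplex.epi_homologyMap_iff_up_to_refinements _ 0 0 1 prev_zero (next_nat 0)]
    intro A z hz
    obtain ⟨x, y, rfl⟩ := exists_pair z
    rw [pair_d, pair_eq_zero, comp_up_eq_zero] at hz
    obtain ⟨w, rfl⟩ := exists_lift_ker hιτ hS x (by simpa [shiftD_zero] using hz.2)
    refine ⟨A, 𝟙 A, inferInstance, w, ?_, 0, ?_⟩
    · rw [← cancel_mono (ι.f 1), Category.assoc, ← ι.comm, ← Category.assoc, hz.1, zero_comp]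
    · rw [zero_comp, add_zero, Category.id_comp, kerToTot_f, comp_pair, comp_zero,
        eq_zero_of_shiftX_zero y]
  | succ n =>
    rw [HomologicalComplex.epi_homologyMap_iff_up_to_refinements _ n (n + 1) (n + 2)
      (prev_succ n) (next_nat _)]
    intro A z hz
    obtain ⟨x, y, rfl⟩ := exists_pair z
    obtain ⟨y, rfl⟩ := exists_up y
    rw [pair_d, pair_eq_zero, comp_up_eq_zero, Category.assoc, up_shiftD, sub_eq_zero] at hz
    obtain ⟨A', π, hπ, w, k, hw, hk⟩ := exists_lift_sub hιτ hS x y hz.2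
    refine ⟨A', π, hπ, k, ?_, pair w 0, ?_⟩
    · rw [← cancel_mono (ι.f (n + 2)), Category.assoc, ← ι.comm, ← Category.assoc, hk,
        Preadditive.sub_comp, Category.assoc, Category.assoc, hz.1, W.d_comp_d, comp_zero,
        comp_zero, sub_zero, zero_comp]
    · rw [kerToTot_f, comp_pair, comp_pair, hk, pair_d, pair_add, pair_inj]
      refine ⟨by rw [sub_add_cancel], ?_⟩
      rw [comp_zero, zero_add, zero_comp, sub_zero, ← Category.assoc, hw]

lemma quasiIso_kerToTot : QuasiIso (kerToTot hιτ) := by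
  rw [quasiIso_iff]
  intro n
  rw [quasiIsoAt_iff_isIso_homologyMap]
  have := mono_homologyMap_kerToTot hιτ hS n
  have := epi_homologyMap_kerToTot hιτ hS n
  exact isIso_of_mono_of_epi _

end

section Augmentation

variable {A : C} {t : A ⟶ A} {a : A ⟶ W.X 0} (had : a ≫ W.d 0 1 = 0) (ha : a ≫ τ.f 0 = t ≫ a)

/-- The morphism from the two-term complex `t : A ⟶ A` to the total complex given by an
augmentation `A ⟶ W`. -/
def augToTot : twoTerm t ⟶ tot W τ :=
  HomologicalComplex.mkHomFromDouble _ (by simp) (pair a 0) (pair 0 (a ≫ up W 0))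
    ((pair_d a 0).trans (by rw [comp_pair]; exact pair_inj.2 ⟨by rw [had, comp_zero], by simp [ha]⟩))
    (by
      rintro j (rfl : 1 + 1 = j)
      rw [pair_d, pair_eq_zero, Category.assoc, up_shiftD, had]
      simp)

lemma augToTot_f_zero : (augToTot had ha).f 0 =
    (HomologicalComplex.doubleXIso₀ t (c := ComplexShape.up ℕ) (i₀ := 0) (i₁ := 1)
      (by simp)).hom ≫ pair a 0 := HomologicalComplex.mkHomFromDouble_f₀ ..

lemma augToTot_f_one : (augToTot had ha).f 1 =
    (HomologicalComplex.doubleXIso₁ t (c := ComplexShape.up ℕ) (i₀ := 0) (i₁ := 1)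
      (by simp) (by simp)).hom ≫ pair 0 (a ≫ up W 0) := HomologicalComplex.mkHomFromDouble_f₁ ..

lemma twoTerm_d : (twoTerm t).d 0 1 =
    (HomologicalComplex.doubleXIso₀ t (c := ComplexShape.up ℕ) (i₀ := 0) (i₁ := 1)
      (by simp)).hom ≫ t ≫ (HomologicalComplex.doubleXIso₁ t (c := ComplexShape.up ℕ) (i₀ := 0)
      (i₁ := 1) (by simp) (by simp)).inv := HomologicalComplex.double_d _ _ _

section
variable (hW : ∀ n, W.ExactAt (n + 1))
  (haW : (ShortComplex.mk a (W.d 0 1) had).Exact)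

include haW in
lemma exists_lift_aug [Mono a] {B : C} (x : B ⟶ W.X 0) (hx : x ≫ W.d 0 1 = 0) : ∃ y, y ≫ a = x :=
  ⟨haW.lift x hx, haW.lift_f x hx⟩

include hW in
lemma exists_lift_d {B : C} {n : ℕ} (x : B ⟶ W.X (n + 1)) (hx : x ≫ W.d (n + 1) (n + 2) = 0) :
    ∃ (B' : C) (π : B' ⟶ B) (_ : Epi π) (y : B' ⟶ W.X n), π ≫ x = y ≫ W.d n (n + 1) :=
  (W.exactAt_iff_exact_up_to_refinements n (n + 1) (n + 2) (prev_succ n) (next_nat _)).1 (hW n) x hx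

include hW in
-- For a cocycle `(x, y)` write `x = du`. Then `τu - y` is a cocycle, hence some `dv`, and `(x, y) =
-- d(u, v)`. From degree 2 on, both components lie in positive degrees of `W`.
lemma exactAt_tot (n : ℕ) : (tot W τ).ExactAt (n + 2) := by
  rw [HomologicalComplex.exactAt_iff_exact_up_to_refinements _ (n + 1) (n + 2) (n + 3)
    (prev_succ _) (next_nat _)]
  intro B z hz
  obtain ⟨x, y, rfl⟩ := exists_pair z
  obtain ⟨y, rfl⟩ := exists_up (n := n + 1) y
  have hz := pair_eq_zero.1 ((pair_d _ _).symm.trans hz)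
  rw [comp_up_eq_zero, Category.assoc, up_shiftD, sub_eq_zero] at hz
  obtain ⟨B', π, hπ, u, hu⟩ := exists_lift_d hW (n := n + 1) x hz.1
  obtain ⟨B'', π', hπ', v, hv⟩ := exists_lift_d hW (n := n) (u ≫ τ.f (n + 1) - π ≫ y) (by
    rw [Preadditive.sub_comp, Category.assoc, Category.assoc, τ.comm, ← Category.assoc u, ← hu,
      ← hz.2, Category.assoc, sub_self])
  refine ⟨B'', π' ≫ π, inferInstance, pair (π' ≫ u) (v ≫ up W n), ?_⟩
  rw [comp_pair, pair_d, pair_inj, Category.assoc, hu, Category.assoc, Category.assoc _ _ (shiftD W _),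
    up_shiftD, ← hv, Preadditive.comp_sub]
  simp

variable [Mono a]
include haW

/-- A cocycle of degree 0 is an `x` with `dx = 0` and `τx = 0`, that is, `x = a(w)` with `tw = 0`.
-/
lemma isIso_homologyMap_augToTot_zero :
    IsIso (HomologicalComplex.homologyMap (augToTot had ha) 0) := by
  have h1 : Mono (HomologicalComplex.homologyMap (augToTot had ha) 0) := by
    rw [HomologicalComplex.mono_homologyMap_iff_up_to_refinements _ 0 0 1 prev_zero (next_nat 0)]
    intro B x hx y hy
    refine ⟨B, 𝟙 B, inferInstance, 0, ?_⟩
    rw [(tot W τ).shape 0 0 (by simp), comp_zero, augToTot_f_zero, ← Category.assoc, comp_pair,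
      pair_eq_zero] at hy
    have h2 := (cancel_mono a).1 (hy.1.trans zero_comp.symm)
    rw [zero_comp, Category.id_comp, ← cancel_mono (HomologicalComplex.doubleXIso₀ t
      (c := ComplexShape.up ℕ) (i₀ := 0) (i₁ := 1) (by simp)).hom, h2, zero_comp]
  have h2 : Epi (HomologicalComplex.homologyMap (augToTot had ha) 0) := by
    rw [HomologicalComplex.epi_homologyMap_iff_up_to_refinements _ 0 0 1 prev_zero (next_nat 0)]
    intro B z hz
    obtain ⟨x, y, rfl⟩ := exists_pair z
    have hz := pair_eq_zero.1 ((pair_d x y).symm.trans hz)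
    rw [comp_up_eq_zero, shiftD_zero, comp_zero, sub_zero] at hz
    obtain ⟨w, rfl⟩ := exists_lift_aug had haW x hz.1
    refine ⟨B, 𝟙 B, inferInstance, w ≫ (HomologicalComplex.doubleXIso₀ t
      (c := ComplexShape.up ℕ) (i₀ := 0) (i₁ := 1) (by simp)).inv, ?_, 0, ?_⟩
    · have h3 : w ≫ t = 0 := by
        rw [← cancel_mono a, Category.assoc, ← ha, ← Category.assoc, hz.2, zero_comp]
      rw [twoTerm_d, Category.assoc, Iso.inv_hom_id_assoc, ← Category.assoc, h3, zero_comp]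
    · rw [zero_comp, add_zero, Category.id_comp, augToTot_f_zero, Category.assoc,
        Iso.inv_hom_id_assoc, comp_pair, comp_zero, eq_zero_of_shiftX_zero y]
  exact isIso_of_mono_of_epi _

include hW

/-- For a cocycle `(x, y)` of degree 1 write `x = du`. Then `y - τu` is a cocycle of degree 0, hence
`a(w)`, and `(x, y) = (0, a(w)) + d(u, 0)`. -/
lemma isIso_homologyMap_augToTot_one :
    IsIso (HomologicalComplex.homologyMap (augToTot had ha) 1) := by
  have h1 : Mono (HomologicalComplex.homologyMap (augToTot had ha) 1) := by
    rw [HomologicalComplex.mono_homologyMap_iff_up_to_refinements _ 0 1 2 (prev_succ 0)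
      (next_nat 1)]
    intro B x hx z hz
    obtain ⟨u, v, rfl⟩ := exists_pair z
    rw [augToTot_f_one, ← Category.assoc, comp_pair, comp_zero, ← Category.assoc] at hz
    obtain ⟨h1, h2⟩ := pair_inj.1 (hz.trans (pair_d u v))
    obtain ⟨w, rfl⟩ := exists_lift_aug had haW u h1.symm
    rw [shiftD_zero, comp_zero, sub_zero, cancel_mono,
      Category.assoc w, ha, ← Category.assoc w, cancel_mono] at h2
    refine ⟨B, 𝟙 B, inferInstance, w ≫ (HomologicalComplex.doubleXIso₀ t
      (c := ComplexShape.up ℕ) (i₀ := 0) (i₁ := 1) (by simp)).inv, ?_⟩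
    rw [twoTerm_d, Category.assoc, Iso.inv_hom_id_assoc, Category.id_comp, ← Category.assoc, ← h2,
      Category.assoc, Iso.hom_inv_id, Category.comp_id]
  have h2 : Epi (HomologicalComplex.homologyMap (augToTot had ha) 1) := by
    rw [HomologicalComplex.epi_homologyMap_iff_up_to_refinements _ 0 1 2 (prev_succ 0)
      (next_nat 1)]
    intro B z hz
    obtain ⟨x, y, rfl⟩ := exists_pair z
    obtain ⟨y, rfl⟩ := exists_up (n := 0) y
    have hz := pair_eq_zero.1 ((pair_d _ _).symm.trans hz)
    rw [comp_up_eq_zero, Category.assoc, up_shiftD, sub_eq_zero] at hz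
    obtain ⟨B', π, hπ, u, hu⟩ := exists_lift_d hW (n := 0) x hz.1
    obtain ⟨w, hw⟩ := exists_lift_aug had haW (π ≫ y - u ≫ τ.f 0) (by
      rw [Preadditive.sub_comp, Category.assoc, Category.assoc, τ.comm, ← Category.assoc u]
      erw [← hu, ← hz.2]
      rw [Category.assoc, sub_self])
    refine ⟨B', π, hπ, w ≫ (HomologicalComplex.doubleXIso₁ t (c := ComplexShape.up ℕ) (i₀ := 0)
      (i₁ := 1) (by simp) (by simp)).inv, ?_, pair u 0, ?_⟩
    · rw [HomologicalComplex.double_d_eq_zero₀ _ _ _ _ (by simp), comp_zero]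
    · rw [augToTot_f_one, Category.assoc, Iso.inv_hom_id_assoc, comp_pair, comp_pair, comp_zero,
        ← Category.assoc w, hw]
      refine Eq.trans ?_ (congrArg _ (pair_d u 0).symm)
      rw [pair_add, pair_inj]
      refine ⟨by rw [zero_add]; exact hu, ?_⟩
      rw [← Preadditive.add_comp, zero_comp, sub_zero, sub_add_cancel, Category.assoc]
  exact isIso_of_mono_of_epi _

lemma quasiIso_augToTot : QuasiIso (augToTot had ha) := by
  rw [quasiIso_iff]
  intro n
  match n with
  | 0 =>
    rw [quasiIsoAt_iff_isIso_homologyMap]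
    exact isIso_homologyMap_augToTot_zero had ha haW
  | 1 =>
    rw [quasiIsoAt_iff_isIso_homologyMap]
    exact isIso_homologyMap_augToTot_one had ha hW haW
  | n + 2 =>
    rw [quasiIsoAt_iff_exactAt]
    · exact exactAt_tot hW n
    · exact HomologicalComplex.ExactAt.of_isZero
        (HomologicalComplex.isZero_double_X _ _ _ (by simp) (by simp))
end

end Augmentation

/-- The kernel of an epimorphism `τ` of a resolution `W` of `A` is quasi-isomorphic to the complex
given by the endomorphism of `A` that induces `τ`. -/
lemma quasiIsomorphic_twoTerm
    (hS : ∀ n, (ShortComplex.mk (ι.f n) (τ.f n) (congrArg (fun a => a.f n) hιτ)).ShortExact)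
    {A : C} {t : A ⟶ A} {a : A ⟶ W.X 0} [Mono a] (had : a ≫ W.d 0 1 = 0)
    (ha : a ≫ τ.f 0 = t ≫ a) (hW : ∀ n, W.ExactAt (n + 1))
    (haW : (ShortComplex.mk a (W.d 0 1) had).Exact) : QuasiIsomorphic K (twoTerm t) :=
  ⟨tot W τ, kerToTot hιτ, augToTot had ha, quasiIso_kerToTot hιτ hS,
    quasiIso_augToTot had ha hW haW⟩

lemma QuasiIsomorphic.homologyIso {K L : CochainComplex C ℕ} (h : QuasiIsomorphic K L) (n : ℕ) :
    Nonempty (K.homology n ≅ L.homology n) := by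
  obtain ⟨M, α, β, hα, hβ⟩ := h
  exact ⟨isoOfQuasiIsoAt α n ≪≫ (isoOfQuasiIsoAt β n).symm⟩

lemma isZero_homology_twoTerm {A : C} (t : A ⟶ A) (n : ℕ) (hn : 1 < n) :
    IsZero ((twoTerm t).homology n) := by
  have h : (twoTerm t).ExactAt n := HomologicalComplex.ExactAt.of_isZero
    (HomologicalComplex.isZero_double_X _ _ _ (by omega) (by omega))
  exact (HomologicalComplex.exactAt_iff_isZero_homology _ _).1 h

/-- The first cohomology of a two-term complex is the cokernel. -/
lemma exists_cokernel_homology_twoTerm {A : C} (t : A ⟶ A) :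
    ∃ (π : A ⟶ (twoTerm t).homology 1) (w : t ≫ π = 0),
      Nonempty (IsColimit (CokernelCofork.ofπ π w)) := by
  let e₀ := HomologicalComplex.doubleXIso₀ t (c := ComplexShape.up ℕ) (i₀ := 0) (i₁ := 1) (by simp)
  let e₁ := HomologicalComplex.doubleXIso₁ t (c := ComplexShape.up ℕ) (i₀ := 0) (i₁ := 1) (by simp)
    (by simp)
  have hd : (twoTerm t).d 1 2 = 0 := HomologicalComplex.double_d_eq_zero₀ _ _ _ _ (by simp)
  -- The term of degree 2 is zero, so all of `A` in degree 1 consists of cocycles.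
  let l : A ⟶ (twoTerm t).cycles 1 := (twoTerm t).liftCycles e₁.inv 2 (next_nat 1) (by
    rw [hd, comp_zero])
  have hl : l ≫ (twoTerm t).iCycles 1 = e₁.inv := HomologicalComplex.liftCycles_i _ _ _ _ _
  have hl' : ((twoTerm t).iCycles 1 ≫ e₁.hom) ≫ l = 𝟙 _ := by
    rw [← cancel_mono ((twoTerm t).iCycles 1), Category.assoc, hl, Category.assoc,
      Iso.hom_inv_id, Category.comp_id, Category.id_comp]
  have hc := (twoTerm t).homologyIsCokernel 0 1 (prev_succ 0)
  have ht : t ≫ l = e₀.inv ≫ (twoTerm t).toCycles 0 1 := by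
    rw [← cancel_mono ((twoTerm t).iCycles 1), Category.assoc, hl, Category.assoc,
      HomologicalComplex.toCycles_i, twoTerm_d, Iso.inv_hom_id_assoc]
  have hk' {Z : C} (k : A ⟶ Z) (hk : t ≫ k = 0) :
      (twoTerm t).toCycles 0 1 ≫ ((twoTerm t).iCycles 1 ≫ e₁.hom) ≫ k = 0 := by
    rw [← Category.assoc, ← Category.assoc, HomologicalComplex.toCycles_i, twoTerm_d,
      Category.assoc e₀.hom, Category.assoc t, Iso.inv_hom_id, Category.comp_id, Category.assoc,
      hk, comp_zero]
  have hfac {Z : C} (k : A ⟶ Z) (hk : t ≫ k = 0) : (twoTerm t).homologyπ 1 ≫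
      hc.desc (CokernelCofork.ofπ (((twoTerm t).iCycles 1 ≫ e₁.hom) ≫ k) (hk' k hk)) =
        ((twoTerm t).iCycles 1 ≫ e₁.hom) ≫ k :=
    hc.fac (CokernelCofork.ofπ (((twoTerm t).iCycles 1 ≫ e₁.hom) ≫ k) (hk' k hk)) .one
  refine ⟨l ≫ (twoTerm t).homologyπ 1, ?_, ⟨CokernelCofork.IsColimit.ofπ _ _
    (fun k hk => hc.desc (CokernelCofork.ofπ (((twoTerm t).iCycles 1 ≫ e₁.hom) ≫ k) (hk' k hk)))
    (fun {Z} k hk => ?_) (fun {Z} k hk m hm => ?_)⟩⟩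
  · rw [← Category.assoc, ht, Category.assoc, HomologicalComplex.toCycles_comp_homologyπ, comp_zero]
  · rw [Category.assoc]
    refine (congrArg (l ≫ ·) (hfac k hk)).trans ?_
    change l ≫ ((twoTerm t).iCycles 1 ≫ e₁.hom) ≫ k = k
    rw [← Category.assoc, ← Category.assoc, hl, Iso.inv_hom_id, Category.id_comp]
  · refine Cofork.IsColimit.hom_ext hc ((?_ : (twoTerm t).homologyπ 1 ≫ m = _).trans
      (hfac k hk).symm)
    rw [← hm, Category.assoc l, ← Category.assoc _ l, hl', Category.id_comp]

end Roof

/-! ### The group elements with which a morphism of sheaves commutes. -/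

section Commute

variable {S : Scheme.{u}} {Γ : Type v} [Group Γ] {ρ : Γ →* Aut S} {E E' : EquivariantSheaf ρ}

lemma pull_injective {g : Γ} {U V : S.Etale} {f : U.left ⟶ V.left} {f' : V.left ⟶ U.left}
    {w : f ≫ str V ≫ act ρ g = str U} (h : f' ≫ f = 𝟙 _) :
    Function.Injective (E.pull g f w) := by
  have w' : f' ≫ str U ≫ act ρ g⁻¹ = str V := by
    rw [← w, ← Category.assoc, ← Category.assoc, h, Category.id_comp, Category.assoc, act_comp,
      inv_mul_cancel, act_one, Category.comp_id]
  have wd : 𝟙 V.left ≫ str V ≫ act ρ 1 = str V := id_comp_act_one ρ _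
  intro x y hxy
  have e := congrArg (E.pull g⁻¹ f' w') hxy
  rwa [E.pull_pull (wd := wd) (inv_mul_cancel g).symm h.symm,
    E.pull_pull (wd := wd) (inv_mul_cancel g).symm h.symm, E.pull_one rfl rfl,
    E.pull_one rfl rfl] at e

/-- The subgroup of the elements with which a morphism of sheaves commutes. -/
def commSubgroup (b : E.sheaf ⟶ E'.sheaf) : Subgroup Γ where
  carrier := {g | ∀ (U V : S.Etale) (f : U.left ⟶ V.left) (w : f ≫ str V ≫ act ρ g = str U)
    (x : E.sec V), hs b U (E.pull g f w x) = E'.pull g f w (hs b V x)}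
  one_mem' U V f w x := by
    have w' : f ≫ str V = str U := by rw [← w, act_one, Category.comp_id]
    have e := E.res_eq_pull (etaleHom f w') w x
    have e' := E'.res_eq_pull (etaleHom f w') w (hs b V x)
    exact (congrArg (hs b U) e.symm).trans ((hs_rs b _ x).trans e')
  mul_mem' {g h} hg hh U V f w x := by
    have w1 : f ≫ (str V ≫ act ρ h) ≫ act ρ g = str U := by
      rw [Category.assoc, act_comp, w]
    have w2 : 𝟙 V.left ≫ str V ≫ act ρ h = str V ≫ act ρ h := Category.id_comp _
    have e := E.pull_pull (U := U) (V := twist ρ h V) (w := w1) (w' := w2) (wd := w) rfl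
      (Category.comp_id f).symm x
    have e' := E'.pull_pull (U := U) (V := twist ρ h V) (w := w1) (w' := w2) (wd := w) rfl
      (Category.comp_id f).symm (hs b V x)
    rw [← e, ← e']
    exact (hg U (twist ρ h V) f w1 _).trans (congrArg _ (hh (twist ρ h V) V _ w2 x))
  inv_mem' {g} hg U V f w x := by
    have w2 : 𝟙 U.left ≫ str U ≫ act ρ g = str U ≫ act ρ g := Category.id_comp _
    have w3 : f ≫ str V = str U ≫ act ρ g := by
      rw [← w]; simp [act_comp, act_one]
    have wd : f ≫ str V ≫ act ρ 1 = str U ≫ act ρ g := by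
      rw [act_one, Category.comp_id, w3]
    refine pull_injective (E := E') (U := twist ρ g U) (f := 𝟙 U.left) (w := w2) (Category.id_comp _) ?_
    refine (hg (twist ρ g U) U _ w2 _).symm.trans ?_
    have e := E.pull_pull (U := twist ρ g U) (w := w2) (w' := w) (wd := wd)
      (mul_inv_cancel g).symm (Category.id_comp f).symm x
    have e' := E'.pull_pull (U := twist ρ g U) (w := w2) (w' := w) (wd := wd)
      (mul_inv_cancel g).symm (Category.id_comp f).symm (hs b V x)
    refine (congrArg _ e).trans (Eq.trans ?_ e'.symm)
    have e := E.res_eq_pull (etaleHom (U := twist ρ g U) f w3) wd x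
    have e' := E'.res_eq_pull (etaleHom (U := twist ρ g U) f w3) wd (hs b V x)
    exact (congrArg (hs b _) e.symm).trans ((hs_rs b _ x).trans e')

lemma mem_commSubgroup_of_smul {b : E.sheaf ⟶ E'.sheaf} {g : Γ}
    (h : ∀ U (x : E.sec U), hs b (twist ρ g U) (E.smul g U x) = E'.smul g U (hs b U x)) :
    g ∈ commSubgroup b :=
  fun _ V _ _ x => (hs_rs b _ _).trans (congrArg (rs E'.sheaf _) (h V x))

lemma smul_of_mem_commSubgroup {b : E.sheaf ⟶ E'.sheaf} {g : Γ} (h : g ∈ commSubgroup b)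
    (U : S.Etale) (x : E.sec U) :
    hs b (twist ρ g U) (E.smul g U x) = E'.smul g U (hs b U x) := by
  have w : 𝟙 U.left ≫ str U ≫ act ρ g = str U ≫ act ρ g := Category.id_comp _
  have e := E.smul_eq_pull g U w x
  have e' := E'.smul_eq_pull g U w (hs b U x)
  exact (congrArg _ e).trans ((h (twist ρ g U) U _ w x).trans e'.symm)

/-- A morphism of sheaves that commutes with the action as a morphism of equivariant sheaves. -/
def homOfCommute (b : E.sheaf ⟶ E'.sheaf) (h : commSubgroup b = ⊤) : E ⟶ E' where
  hom := b
  comm g U := by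
    ext x
    exact smul_of_mem_commSubgroup (h ▸ Subgroup.mem_top g : g ∈ commSubgroup b) U x

lemma commSubgroup_hom (b : E ⟶ E') : commSubgroup b.hom = ⊤ :=
  eq_top_iff.2 fun _ _ => mem_commSubgroup_of_smul fun U x => hom_smul b _ U x

end Commute

/-! ### Smooth coinduction, right adjoint to forgetting a continuous action. -/

section Coind

variable {k : Type u} [Field k] {kbar : Type u} [Field kbar] [Algebra k kbar]
variable {X : Scheme.{u}} {p : X ⟶ Spec (CommRingCat.of k)}
variable [Finite k] [IsAlgClosure k kbar] [LocallyOfFiniteType p]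

lemma map_mem_smoothPart {E E' : EquivariantSheaf (galAction kbar p)} (a : E ⟶ E')
    {U : (Xbar kbar p).Etale} {s : E.sec U} (h : s ∈ (smoothPart E).carrier U) :
    hs a.hom U s ∈ (smoothPart E').carrier U := fun g P f w => by
  rw [← hom_pull]
  exact (h g P f w).map a

variable (kbar p) in
/-- The right adjoint of the inclusion of the sheaves with continuous action. -/
def smoothFunctor : EquivariantSheaf (galAction kbar p) ⥤ TGhat kbar p where
  obj := smoothSheaf
  map {E E'} a := ObjectProperty.homMk ((smoothPart E').lift ((smoothPart E).incl ≫ a)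
    fun _ x => map_mem_smoothPart a ((smoothPart E).incl_mem x))

variable (kbar p) in
/-- The sheaf of smooth sections is right adjoint to the inclusion. -/
def smoothAdjunction :
    ObjectProperty.ι (IsContinuous (kbar := kbar) (p := p)) ⊣ smoothFunctor kbar p :=
  Adjunction.mkOfHomEquiv
    { homEquiv M E :=
        { toFun a := ObjectProperty.homMk ((smoothPart E).lift a fun _ x =>
            map_mem_smoothPart a (mem_smoothPart_of_isContinuous M.property x))
          invFun c := c.hom ≫ (smoothPart E).incl
          left_inv _ := rfl
          right_inv _ := rfl }
      homEquiv_naturality_left_symm _ _ := rfl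
      homEquiv_naturality_right _ _ := rfl }

variable (kbar p) in
/-- The coinduction functor, the right adjoint of the forgetful functor from `𝒯_Ĝ` to sheaves. -/
def coind : Sheaf (Xbar kbar p).smallEtaleTopology AddCommGrpCat.{u} ⥤ TGhat kbar p :=
  piFunctor (galAction kbar p) ⋙ smoothFunctor kbar p

variable (kbar p) in
/-- Coinduction is right adjoint to the forgetful functor. -/
def coindAdjunction : ObjectProperty.ι (IsContinuous (kbar := kbar) (p := p)) ⋙
    forgetAction (galAction kbar p) ⊣ coind kbar p :=
  (smoothAdjunction kbar p).comp (piAdjunction (galAction kbar p))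

variable {F F' : Sheaf (Xbar kbar p).smallEtaleTopology AddCommGrpCat.{u}}

/-- The component in `F(hU)` of a section of the coinduced sheaf. -/
def ev (h : Gal(kbar/k)) {U : (Xbar kbar p).Etale} :
    ((coind kbar p).obj F).obj.sec U →+ Sec F (twist (galAction kbar p) h U) :=
  (piEval h).comp (hs (smoothPart (pi (galAction kbar p) F)).incl.hom U)

lemma ev_ext {U : (Xbar kbar p).Etale} {s t : ((coind kbar p).obj F).obj.sec U}
    (h : ∀ g, ev g s = ev g t) : s = t :=
  (smoothPart (pi (galAction kbar p) F)).incl_injective U (pi_ext h)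

lemma ev_map (a : F ⟶ F') (h : Gal(kbar/k)) {U : (Xbar kbar p).Etale}
    (s : ((coind kbar p).obj F).obj.sec U) :
    ev h (hs ((coind kbar p).map a).hom.hom U s) = hs a _ (ev h s) := rfl

lemma ev_pull (h : Gal(kbar/k)) {g : Gal(kbar/k)} {U V : (Xbar kbar p).Etale} {f : U.left ⟶ V.left}
    {w : f ≫ str V ≫ act (galAction kbar p) g = str U}
    {w' : f ≫ str V ≫ act (galAction kbar p) (h * g) = str U ≫ act (galAction kbar p) h}
    (s : ((coind kbar p).obj F).obj.sec V) :
    ev h (((coind kbar p).obj F).obj.pull g f w s) =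
      rt (galAction kbar p) F h (h * g) f w' (ev (h * g) s) := by
  have e := hom_pull (smoothPart (pi (galAction kbar p) F)).incl (w := w) s
  exact (congrArg (piEval h) e).trans (piEval_pull h (w := w) (w' := w')
    (hs (smoothPart (pi (galAction kbar p) F)).incl.hom V s))

/-- The section of the coinduced sheaf with given components. -/
def coindMk {P : Model kbar p} (s : ∀ h, Sec F (twist (galAction kbar p) h P.U))
    (h : IsSmooth (pi (galAction kbar p) F) P (piMk s)) : ((coind kbar p).obj F).obj.sec P.U :=
  (smoothPart (pi (galAction kbar p) F)).toSec _ (mem_smoothPart_iff.2 h)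

variable {M M' : TGhat kbar p}

/-- The morphism to the coinduced sheaf corresponding to a morphism of sheaves. -/
def toCoind (b : M.obj.sheaf ⟶ F) : M ⟶ (coind kbar p).obj F :=
  (coindAdjunction kbar p).homEquiv M F b

lemma ev_toCoind (b : M.obj.sheaf ⟶ F) (h : Gal(kbar/k)) (U : (Xbar kbar p).Etale)
    (x : M.obj.sec U) : ev h (hs (toCoind b).hom.hom U x) = hs b _ (M.obj.smul h U x) := rfl

lemma ev_one_toCoind (b : M.obj.sheaf ⟶ F) (U : (Xbar kbar p).Etale) (x : M.obj.sec U) :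
    ev 1 (hs (toCoind b).hom.hom U x) = rs F (twistOne (galAction kbar p) U) (hs b U x) := by
  rw [ev_toCoind, EquivariantSheaf.smul_one]
  exact hs_rs b _ x

lemma toCoind_injective : Function.Injective (toCoind (M := M) (F := F)) :=
  ((coindAdjunction kbar p).homEquiv M F).injective

lemma exists_toCoind (c : M ⟶ (coind kbar p).obj F) : ∃ b, toCoind b = c :=
  ((coindAdjunction kbar p).homEquiv M F).surjective c

lemma comp_toCoind (a : M' ⟶ M) (b : M.obj.sheaf ⟶ F) : a ≫ toCoind b = toCoind (a.hom.hom ≫ b) :=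
  ((coindAdjunction kbar p).homEquiv_naturality_left a b).symm

lemma toCoind_comp_map (b : M.obj.sheaf ⟶ F) (a : F ⟶ F') :
    toCoind b ≫ (coind kbar p).map a = toCoind (b ≫ a) := rfl

omit [Finite k] [IsAlgClosure k kbar] [LocallyOfFiniteType p] in
lemma thom_ext {a b : M ⟶ M'} (h : ∀ U x, hs a.hom.hom U x = hs b.hom.hom U x) : a = b :=
  ObjectProperty.hom_ext _ (es_hom_ext h)

end Coind

/-! ### The endomorphism `t` and the existence of `γ_*`. -/

section Shift

variable {k : Type u} [Field k] [Finite k] {kbar : Type u} [Field kbar] [Algebra k kbar]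
variable [IsAlgClosure k kbar] {X : Scheme.{u}} {p : X ⟶ Spec (CommRingCat.of k)}

lemma act_weil (g : weilGroup k kbar) :
    act (weilAction kbar p) g = act (galAction kbar p) (g : Gal(kbar/k)) := rfl

lemma comp_act_weil {T T' : Scheme.{u}} {f : T' ⟶ T} {a : T ⟶ Xbar kbar p}
    {c : T' ⟶ Xbar kbar p} {g : weilGroup k kbar} {b : Gal(kbar/k)}
    (w : f ≫ a ≫ act (galAction kbar p) (g * b) = c) :
    f ≫ (a ≫ act (galAction kbar p) b) ≫ act (weilAction kbar p) g = c := by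
  rw [act_weil, Category.assoc, act_comp, w]

variable {F F' : TG kbar p}

/-- The map `F(bV) ⟶ F(aU)`, `x ↦ f^*(gx)`, for `g ∈ G` and a morphism `f : aU ⟶ gbV` over `X̄`. -/
def gp (F : TG kbar p) (g : weilGroup k kbar) (a b : Gal(kbar/k)) {U V : (Xbar kbar p).Etale}
    (f : U.left ⟶ V.left)
    (w : f ≫ str V ≫ act (galAction kbar p) (g * b) = str U ≫ act (galAction kbar p) a) :
    Sec F.sheaf (twist (galAction kbar p) b V) →+ Sec F.sheaf (twist (galAction kbar p) a U) :=
  F.pull g (U := twist (galAction kbar p) a U) (V := twist (galAction kbar p) b V) f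
    (comp_act_weil w)

section
variable {a b c : Gal(kbar/k)} {g h : weilGroup k kbar} {U V W : (Xbar kbar p).Etale}
  {f : U.left ⟶ V.left}

lemma gp_gp {f' : V.left ⟶ W.left}
    {w : f ≫ str V ≫ act (galAction kbar p) (g * b) = str U ≫ act (galAction kbar p) a}
    {w' : f' ≫ str W ≫ act (galAction kbar p) (h * c) = str V ≫ act (galAction kbar p) b}
    {e : weilGroup k kbar} {d : U.left ⟶ W.left}
    {wd : d ≫ str W ≫ act (galAction kbar p) (e * c) = str U ≫ act (galAction kbar p) a}
    (he : e = g * h) (hd : d = f ≫ f') (x : Sec F.sheaf (twist (galAction kbar p) c W)) :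
    gp F g a b f w (gp F h b c f' w' x) = gp F e a c d wd x :=
  F.pull_pull (U := twist (galAction kbar p) a U) (V := twist (galAction kbar p) b V)
    (W := twist (galAction kbar p) c W) he hd x

lemma gp_congr {b' : Gal(kbar/k)} {g' : weilGroup k kbar} {f' : U.left ⟶ V.left}
    {w : f ≫ str V ≫ act (galAction kbar p) (g * b) = str U ≫ act (galAction kbar p) a}
    {w' : f' ≫ str V ≫ act (galAction kbar p) (g' * b') = str U ≫ act (galAction kbar p) a}
    (s : ∀ h, Sec F.sheaf (twist (galAction kbar p) h V)) (hg : g = g') (hb : b = b')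
    (hf : f = f') : gp F g a b f w (s b) = gp F g' a b' f' w' (s b') := by
  subst hg hb hf; rfl

lemma rt_eq_gp (w : f ≫ str V ≫ act (galAction kbar p) b = str U ≫ act (galAction kbar p) a)
    (w' : f ≫ str V ≫ act (galAction kbar p) ((1 : weilGroup k kbar) * b) =
      str U ≫ act (galAction kbar p) a) (x : Sec F.sheaf (twist (galAction kbar p) b V)) :
    rt (galAction kbar p) F.sheaf a b f w x = gp F 1 a b f w' x :=
  F.res_eq_pull (twistHom (galAction kbar p) a b f w) (comp_act_weil w') x

lemma hs_gp (α : F ⟶ F')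
    {w : f ≫ str V ≫ act (galAction kbar p) (g * b) = str U ≫ act (galAction kbar p) a}
    (x : Sec F.sheaf (twist (galAction kbar p) b V)) :
    hs α.hom _ (gp F g a b f w x) = gp F' g a b f w (hs α.hom _ x) := hom_pull α x

lemma id_comp_act_frob (a : Gal(kbar/k)) {T : Scheme.{u}} (s : T ⟶ Xbar kbar p) :
    𝟙 T ≫ s ≫ act (galAction kbar p) ((frobG k kbar : Gal(kbar/k)) * ((frob k kbar)⁻¹ * a)) =
      s ≫ act (galAction kbar p) a := by
  rw [Category.id_comp]
  congr 2
  exact mul_inv_cancel_left (frob k kbar) a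

end

lemma gp_rs_twistOne {g : weilGroup k kbar} {U : (Xbar kbar p).Etale}
    (w : 𝟙 U.left ≫ str U ≫ act (galAction kbar p) ((g : Gal(kbar/k)) * 1) =
      str U ≫ act (galAction kbar p) (g : Gal(kbar/k))) (x : F.sec U) :
    gp F g g 1 (𝟙 U.left) w (rs F.sheaf (twistOne (galAction kbar p) U) x) = F.smul g U x := by
  have e := F.smul_eq_pull g U (Category.id_comp _) x
  refine Eq.trans ?_ e.symm
  exact F.pull_res (U := twist (galAction kbar p) (g : Gal(kbar/k)) U)
    (V := twist (galAction kbar p) 1 U) (W := U) (f := 𝟙 U.left) (h := g)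
    (f' := twistOne (galAction kbar p) U) (w := comp_act_weil w)
    (wd := Category.id_comp _) (Category.id_comp (𝟙 U.left)).symm x

lemma gp_comm {a b c : Gal(kbar/k)} {g h g' h' : weilGroup k kbar}
    {U V V' W : (Xbar kbar p).Etale} {f : U.left ⟶ V.left} {e : V.left ⟶ W.left}
    {f' : U.left ⟶ V'.left} {e' : V'.left ⟶ W.left} {b' c' : Gal(kbar/k)}
    {w : f ≫ str V ≫ act (galAction kbar p) (g * b) = str U ≫ act (galAction kbar p) a}
    {w₂ : e ≫ str W ≫ act (galAction kbar p) (h * c) = str V ≫ act (galAction kbar p) b}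
    {w' : f' ≫ str V' ≫ act (galAction kbar p) (g' * b') = str U ≫ act (galAction kbar p) a}
    {w₂' : e' ≫ str W ≫ act (galAction kbar p) (h' * c') = str V' ≫ act (galAction kbar p) b'}
    (s : ∀ h, Sec F.sheaf (twist (galAction kbar p) h W)) (hg : g * h = g' * h') (hc : c = c')
    (hf : f ≫ e = f' ≫ e') :
    gp F g a b f w (gp F h b c e w₂ (s c)) = gp F g' a b' f' w' (gp F h' b' c' e' w₂' (s c')) := by
  have hw {U V W : (Xbar kbar p).Etale} {f : U.left ⟶ V.left} {e : V.left ⟶ W.left}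
      {g h : weilGroup k kbar} {b c : Gal(kbar/k)}
      (w : f ≫ str V ≫ act (galAction kbar p) (g * b) = str U ≫ act (galAction kbar p) a)
      (w₂ : e ≫ str W ≫ act (galAction kbar p) (h * c) = str V ≫ act (galAction kbar p) b) :
      (f ≫ e) ≫ str W ≫ act (galAction kbar p) ((g * h : weilGroup k kbar) * c) =
        str U ≫ act (galAction kbar p) a := by
    rw [Category.assoc, Subgroup.coe_mul, mul_assoc, comp_act_mul w₂ g, Category.assoc, act_comp, w]
  exact (gp_gp (wd := hw w w₂) rfl rfl (s c)).trans ((gp_congr s hg hc hf).trans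
    (gp_gp (wd := hw w' w₂') rfl rfl (s c')).symm)

variable [LocallyOfFiniteType p]

variable (F) in
/-- The endomorphism `(ts)_h = φ s_{φ⁻¹h}` of `∏_h F(hU)`. -/
def piShift : pi (galAction kbar p) F.sheaf ⟶ pi (galAction kbar p) F.sheaf :=
  mkES (fun U => AddMonoidHom.mk' (fun s => piMk fun h =>
      gp F (frobG k kbar) h ((frob k kbar)⁻¹ * h) (𝟙 U.left) (id_comp_act_frob h (str U))
        (piEval ((frob k kbar)⁻¹ * h) s)) fun s t => pi_ext fun h => map_add
          ((gp F (frobG k kbar) h ((frob k kbar)⁻¹ * h) (𝟙 U.left) _).comp (piEval _)) s t)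
    -- The action multiplies the index by `g` on the right while `t` multiplies it by `φ⁻¹` on the
    -- left, so the two commute.
    fun g U V f w s => pi_ext fun h => by
      have w1 : f ≫ str V ≫ act (galAction kbar p) (h * g) = str U ≫ act (galAction kbar p) h :=
        comp_act_mul w h
      have w2 : f ≫ str V ≫ act (galAction kbar p) ((frob k kbar)⁻¹ * h * g) =
        str U ≫ act (galAction kbar p) ((frob k kbar)⁻¹ * h) := comp_act_mul w _
      have w3 {x : Gal(kbar/k)} : ((1 : weilGroup k kbar) : Gal(kbar/k)) * x = x := one_mul x
      have e1 := piEval_pull ((frob k kbar)⁻¹ * h) (w := w) (w' := w2) s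
      rw [rt_eq_gp w2 (w3.symm ▸ w2)] at e1
      refine (congrArg (gp F _ h _ _ (id_comp_act_frob h (str U))) e1).trans ?_
      refine Eq.trans ?_ (piEval_pull h (w := w) (w' := w1) _).symm
      refine Eq.trans ?_ (rt_eq_gp w1 (w3.symm ▸ w1) _).symm
      exact gp_comm (w₂' := id_comp_act_frob (h * g) (str V)) (fun h => piEval h s) ((mul_one _).trans (one_mul _).symm) (mul_assoc _ _ _)
        ((Category.id_comp _).trans (Category.comp_id _).symm)

variable (F) in
/-- The endomorphism `(ts)_h = φ s_{φ⁻¹h}` of the coinduced sheaf. -/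
def shift : (coind kbar p).obj F.sheaf ⟶ (coind kbar p).obj F.sheaf :=
  (smoothFunctor kbar p).map (piShift F)

lemma ev_shift (h : Gal(kbar/k)) {U : (Xbar kbar p).Etale}
    (s : ((coind kbar p).obj F.sheaf).obj.sec U) : ev h (hs (shift F).hom.hom U s) =
      gp F (frobG k kbar) h ((frob k kbar)⁻¹ * h) (𝟙 U.left) (id_comp_act_frob h (str U))
        (ev ((frob k kbar)⁻¹ * h) s) := rfl

lemma shift_map (a : F ⟶ F') :
    shift F ≫ (coind kbar p).map a.hom = (coind kbar p).map a.hom ≫ shift F' :=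
  thom_ext fun U s => ev_ext fun h => hs_gp a (w := id_comp_act_frob h (str U))
    (ev ((frob k kbar)⁻¹ * h) s)

omit [LocallyOfFiniteType p] in
lemma commSubgroup_eq_top {E E' : TG kbar p} {b : E.sheaf ⟶ E'.sheaf}
    (h : frobG k kbar ∈ commSubgroup b) : commSubgroup b = ⊤ := by
  refine eq_top_iff.2 fun g _ => ?_
  obtain ⟨i, hi⟩ := Subgroup.mem_zpowers_iff.1 g.2
  have : g = frobG k kbar ^ i := Subtype.ext hi.symm
  rw [this]
  exact Subgroup.zpow_mem _ h i

/-- The component at `h` of the image of `x` is `b(hx)`; after applying `t` it is `φ b(φ⁻¹hx)`. The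
component at `h = φ` shows that `b` commutes with `φ`, which generates `G`, and conversely this
gives equality at every `h`. -/
lemma toCoind_shift_iff {M : TGhat kbar p} (b : M.obj.sheaf ⟶ F.sheaf) :
    toCoind b ≫ shift F = toCoind b ↔
      commSubgroup (E := (gammaUpper kbar p).obj M) (E' := F) b = ⊤ := by
  constructor
  · intro h
    refine commSubgroup_eq_top (mem_commSubgroup_of_smul fun U x => ?_)
    have e := congrArg (fun c => ev (frob k kbar) (hs c.hom.hom U x)) h
    refine e.symm.trans ?_
    have h1 : (frob k kbar)⁻¹ * frob k kbar = 1 := inv_mul_cancel _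
    have w : 𝟙 U.left ≫ str U ≫ act (galAction kbar p) ((frobG k kbar : Gal(kbar/k)) * 1) =
        str U ≫ act (galAction kbar p) (frob k kbar) := by
      rw [Category.id_comp, mul_one]; rfl
    refine (ev_shift _ _).trans ?_
    refine (gp_congr (fun h => ev h (hs (toCoind b).hom.hom U x)) rfl h1 rfl (w' := w)).trans ?_
    have e2 := ev_one_toCoind b U x
    refine (congrArg (gp F _ _ _ _ w) e2).trans ?_
    exact gp_rs_twistOne w _
  · intro h
    have hφ : frobG k kbar ∈ commSubgroup (E := (gammaUpper kbar p).obj M) (E' := F) b :=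
      h ▸ Subgroup.mem_top _
    refine thom_ext fun U x => ev_ext fun h => ?_
    refine (ev_shift h _).trans ?_
    refine (hφ (twist (galAction kbar p) h U) (twist (galAction kbar p) ((frob k kbar)⁻¹ * h) U) _
      _ (M.obj.smul ((frob k kbar)⁻¹ * h) U x)).symm.trans ?_
    refine (congrArg (hs b _) ?_).trans (ev_toCoind b h U x).symm
    have w1 : 𝟙 U.left ≫ str U ≫ act (galAction kbar p) h = str U ≫ act (galAction kbar p) h :=
      Category.id_comp _
    have w2 : 𝟙 U.left ≫ str U ≫ act (galAction kbar p) ((frob k kbar)⁻¹ * h) =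
        str U ≫ act (galAction kbar p) ((frob k kbar)⁻¹ * h) := Category.id_comp _
    rw [M.obj.smul_eq_pull h U w1, M.obj.smul_eq_pull _ U w2]
    exact M.obj.pull_pull (U := twist (galAction kbar p) h U)
      (V := twist (galAction kbar p) ((frob k kbar)⁻¹ * h) U) (wd := w1) (mul_inv_cancel_left _ _).symm
      (Category.id_comp _).symm x

lemma toCoind_shift_sub_iff {M : TGhat kbar p} (b : M.obj.sheaf ⟶ F.sheaf) :
    toCoind b ≫ (shift F - 𝟙 _) = 0 ↔
      commSubgroup (E := (gammaUpper kbar p).obj M) (E' := F) b = ⊤ := by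
  rw [Preadditive.comp_sub, Category.comp_id, sub_eq_zero, toCoind_shift_iff]

variable (kbar p) in
/-- Morphisms `γ^*M ⟶ F` correspond to morphisms from `M` to the kernel of `t - 1` on the
coinduced sheaf. -/
def gammaHomEquiv (M : TGhat kbar p) (F : TG kbar p) :
    ((gammaUpper kbar p).obj M ⟶ F) ≃ (M ⟶ kernel (shift F - 𝟙 _)) where
  toFun a := kernel.lift _ (toCoind a.hom) ((toCoind_shift_sub_iff _).2 (commSubgroup_hom a))
  invFun c := homOfCommute (E := (gammaUpper kbar p).obj M) (E' := F)
    (exists_toCoind (c ≫ kernel.ι _)).choose ((toCoind_shift_sub_iff _).1 (by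
      rw [(exists_toCoind (c ≫ kernel.ι _)).choose_spec, Category.assoc, kernel.condition,
        comp_zero]))
  left_inv a := hom_ext (toCoind_injective
    ((exists_toCoind _).choose_spec.trans (kernel.lift_ι _ _ _)))
  right_inv c := by
    rw [← cancel_mono (kernel.ι _), kernel.lift_ι]
    exact (exists_toCoind _).choose_spec

/-- Each functor `M ↦ Hom(γ^*M, F)` is represented by `ker(t - 1)`. Naturality in `M` suffices,
since functoriality in `F` then follows from representability. -/
instance : (gammaUpper kbar p).IsLeftAdjoint :=
  ⟨_, ⟨Adjunction.adjunctionOfEquivRight (gammaHomEquiv kbar p) fun M' M F a b => by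
    rw [← cancel_mono (kernel.ι _), Category.assoc]
    refine (kernel.lift_ι _ _ _).trans (Eq.trans ?_ (congrArg (a ≫ ·) (kernel.lift_ι _ _ _)).symm)
    exact (comp_toCoind a b.hom).symm⟩⟩

variable (kbar p) in
/-- The adjunction between `γ^*` and `γ_*`. -/
abbrev gammaAdjunction : gammaUpper kbar p ⊣ gammaLower kbar p :=
  Adjunction.ofIsLeftAdjoint (gammaUpper kbar p)

variable (F) in
/-- The morphism from `γ_* F` to the coinduced sheaf corresponding to the counit. -/
def gammaIncl : (gammaLower kbar p).obj F ⟶ (coind kbar p).obj F.sheaf :=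
  toCoind ((gammaAdjunction kbar p).counit.app F).hom

/-- `γ_*` is an unspecified right adjoint rather than the kernel itself. This formula, which passes
through the adjunction, is what lets it be compared with the coinduced sheaf. -/
lemma comp_gammaIncl {M : TGhat kbar p} (a : M ⟶ (gammaLower kbar p).obj F) :
    a ≫ gammaIncl F = toCoind (((gammaAdjunction kbar p).homEquiv M F).symm a).hom := by
  rw [Adjunction.homEquiv_counit]
  exact comp_toCoind _ _

lemma gammaIncl_shift : gammaIncl F ≫ (shift F - 𝟙 _) = 0 :=
  (toCoind_shift_sub_iff _).2 (commSubgroup_hom ((gammaAdjunction kbar p).counit.app F))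

instance : Mono (gammaIncl F) where
  right_cancellation {M} a b h := by
    rw [comp_gammaIncl, comp_gammaIncl] at h
    have h' : (((gammaAdjunction kbar p).homEquiv M F).symm a).hom =
      (((gammaAdjunction kbar p).homEquiv M F).symm b).hom :=
        toCoind_injective (M := M) (F := F.sheaf) h
    exact ((gammaAdjunction kbar p).homEquiv _ F).symm.injective (hom_ext h')

variable (F) in
/-- `γ_* F` is the kernel of `t - 1` on the coinduced sheaf. -/
def isLimitGammaIncl : IsLimit (KernelFork.ofι (gammaIncl F) gammaIncl_shift) :=
  KernelFork.IsLimit.ofι' _ _ fun {M} c hc =>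
    have hb := (exists_toCoind c).choose_spec
    let b' : (gammaUpper kbar p).obj M ⟶ F :=
      homOfCommute (E := (gammaUpper kbar p).obj M) (E' := F) (exists_toCoind c).choose
        ((toCoind_shift_sub_iff _).1 (by rw [hb, hc]))
    ⟨(gammaAdjunction kbar p).homEquiv M F b', by
      have e := comp_gammaIncl ((gammaAdjunction kbar p).homEquiv M F b')
      rw [Equiv.symm_apply_apply] at e
      exact e.trans hb⟩

lemma gammaLower_map_incl (a : F ⟶ F') :
    (gammaLower kbar p).map a ≫ gammaIncl F' = gammaIncl F ≫ (coind kbar p).map a.hom := by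
  have e := comp_gammaIncl ((gammaLower kbar p).map a)
  have h : ((gammaAdjunction kbar p).homEquiv _ F').symm ((gammaLower kbar p).map a) =
      (gammaAdjunction kbar p).counit.app F ≫ a := by
    rw [Adjunction.homEquiv_counit]
    exact (gammaAdjunction kbar p).counit.naturality a
  rw [h] at e
  exact e.trans (toCoind_comp_map ((gammaAdjunction kbar p).counit.app F).hom a.hom).symm

end Shift

/-! ### Sections of the coinduced sheaf supported on one coset. -/

section Spread

variable {k : Type u} [Field k] [Finite k] {kbar : Type u} [Field kbar] [Algebra k kbar]
variable [IsAlgClosure k kbar] {X : Scheme.{u}} {p : X ⟶ Spec (CommRingCat.of k)}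

namespace Model

variable {P : Model kbar p}

lemma Level.le_stab (n : P.Level) : levelGroup k kbar n.val ≤ P.stab :=
  levelGroup_le_fixingSubgroup n.mem

lemma Level.exists_le (n : P.Level) {N : Subgroup Gal(kbar/k)}
    (hN : IsOpen (N : Set Gal(kbar/k))) : ∃ n' : P.Level, n ≤ n' ∧ levelGroup k kbar n'.val ≤ N := by
  obtain ⟨m, hm, h⟩ := exists_levelGroup_le hN
  exact ⟨⟨n.val * m, Nat.mul_pos n.pos hm, by rw [pow_mul]; exact Subgroup.pow_mem _ n.mem m⟩,
    Dvd.intro _ rfl, (levelGroup_anti (Dvd.intro_left _ rfl)).trans h⟩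

instance : Nonempty P.Level := by
  obtain ⟨n, hn, h⟩ := exists_frob_pow_mem P.finite
  exact ⟨⟨n, hn, h⟩⟩

instance : IsDirectedOrder P.Level where
  directed n m := ⟨⟨n.val * m.val, Nat.mul_pos n.pos m.pos, by
    rw [pow_mul]; exact Subgroup.pow_mem _ n.mem m.val⟩, Dvd.intro _ rfl, Dvd.intro_left _ rfl⟩

omit [Finite k] [IsAlgClosure k kbar] in
lemma alpha_one (h) : P.alpha ⟨1, h⟩ = 𝟙 _ := by
  refine pullback.hom_ext (f := P.π) (g := toLevel kbar p P.L) ?_ ?_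
  · exact (P.alphaTotal_fst _).trans (Category.id_comp _).symm
  · refine (P.alphaTotal_snd _).trans ?_
    change P.snd ≫ act (galAction kbar p) 1 = 𝟙 _ ≫ P.snd
    rw [act_one, Category.comp_id, Category.id_comp]

lemma alpha_comp {g h x : Gal(kbar/k)} {hg : g ∈ P.stab} {hh : h ∈ P.stab} {hx : x ∈ P.stab}
    (e : x = g * h) : P.alpha ⟨g, hg⟩ ≫ P.alpha ⟨h, hh⟩ = P.alpha ⟨x, hx⟩ := by
  rw [← P.alpha_mul]
  congr 1
  exact Subtype.ext ((gal_mul_comm h g).trans e.symm)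

omit [Finite k] [IsAlgClosure k kbar] in
lemma alpha_congr {g h : Gal(kbar/k)} {hg : g ∈ P.stab} {hh : h ∈ P.stab} (e : g = h) :
    P.alpha ⟨g, hg⟩ = P.alpha ⟨h, hh⟩ := by
  subst e; rfl

omit [Finite k] [IsAlgClosure k kbar] in
lemma alpha_comp_act {c h : Gal(kbar/k)} (hm : c⁻¹ * h ∈ P.stab) :
    P.alpha ⟨c⁻¹ * h, hm⟩ ≫ str P.U ≫ act (galAction kbar p) c =
      str P.U ≫ act (galAction kbar p) h := by
  rw [← Category.assoc, P.alpha_w, Category.assoc, act_comp, mul_inv_cancel_left]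

variable {F : Sheaf (Xbar kbar p).smallEtaleTopology AddCommGrpCat.{u}}

/-- The identification `F(cU) = F(hU)` for `c⁻¹h` in the stabilizer of `U`. -/
def tp (P : Model kbar p) (F : Sheaf (Xbar kbar p).smallEtaleTopology AddCommGrpCat.{u})
    (c h : Gal(kbar/k)) (hm : c⁻¹ * h ∈ P.stab) :
    Sec F (twist (galAction kbar p) c P.U) →+ Sec F (twist (galAction kbar p) h P.U) :=
  rt (galAction kbar p) F h c (P.alpha ⟨c⁻¹ * h, hm⟩) (alpha_comp_act hm)

lemma tp_tp {a b c : Gal(kbar/k)} {hab : a⁻¹ * b ∈ P.stab} {hbc : b⁻¹ * c ∈ P.stab}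
    {hac : a⁻¹ * c ∈ P.stab} (x : Sec F (twist (galAction kbar p) a P.U)) :
    P.tp F b c hbc (P.tp F a b hab x) = P.tp F a c hac x :=
  rt_rt (alpha_comp (by rw [gal_mul_comm (b⁻¹ * c), mul_assoc, mul_inv_cancel_left])).symm x

omit [Finite k] [IsAlgClosure k kbar] in
lemma tp_self {a : Gal(kbar/k)} {h : a⁻¹ * a ∈ P.stab}
    (x : Sec F (twist (galAction kbar p) a P.U)) : P.tp F a a h x = x :=
  rt_id ((alpha_congr (inv_mul_cancel a)).trans (alpha_one (one_mem _))) x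

/-- The section over `U` given by `x ∈ F(cU)` on the coset of `c`, and by `0` elsewhere. -/
def spreadFun (n : P.Level) (c : Gal(kbar/k)) (x : Sec F (twist (galAction kbar p) c P.U))
    (h : Gal(kbar/k)) : Sec F (twist (galAction kbar p) h P.U) :=
  open Classical in
  if hm : c⁻¹ * h ∈ levelGroup k kbar n.val then P.tp F c h (n.le_stab hm) x else 0

lemma spreadFun_of_mem (n : P.Level) {c h : Gal(kbar/k)}
    (x : Sec F (twist (galAction kbar p) c P.U)) (hm : c⁻¹ * h ∈ levelGroup k kbar n.val)
    (hm' : c⁻¹ * h ∈ P.stab) : spreadFun n c x h = P.tp F c h hm' x := dif_pos hm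

lemma spreadFun_of_notMem (n : P.Level) {c h : Gal(kbar/k)}
    (x : Sec F (twist (galAction kbar p) c P.U)) (hm : c⁻¹ * h ∉ levelGroup k kbar n.val) :
    spreadFun n c x h = 0 := dif_neg hm

variable [LocallyOfFiniteType p]

/-- A section over `U` is fixed by the subgroup of level `n`. -/
def IsFixed (E : EquivariantSheaf (galAction kbar p)) (n : P.Level) (s : E.sec P.U) : Prop :=
  ∀ g ∈ levelGroup k kbar n.val, ∀ hg : g ∈ P.stab,
    E.pull g (P.alpha ⟨g⁻¹, inv_mem hg⟩) (P.alpha_inv_w g hg) s = s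

omit [LocallyOfFiniteType p] in
lemma isSmooth_of_isFixed {E : EquivariantSheaf (galAction kbar p)} {n : P.Level} {s : E.sec P.U}
    (h : IsFixed E n s) : IsSmooth E P s := ⟨_, isOpen_levelGroup n.pos, h⟩

omit [LocallyOfFiniteType p] in
lemma exists_isFixed {E : EquivariantSheaf (galAction kbar p)} {s : E.sec P.U}
    (h : IsSmooth E P s) (n : P.Level) : ∃ n' : P.Level, n ≤ n' ∧ IsFixed E n' s := by
  obtain ⟨N, hN, h⟩ := h
  obtain ⟨n', hn', h'⟩ := n.exists_le hN
  exact ⟨n', hn', fun g hg => h g (h' hg)⟩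

omit [LocallyOfFiniteType p] in
-- The support is a coset of the level group, hence stable under right multiplication by it, and on
-- the support the identifications `F(cU) = F(hU)` compose.
lemma isFixed_spreadFun (n : P.Level) (c : Gal(kbar/k))
    (x : Sec F (twist (galAction kbar p) c P.U)) :
    IsFixed (pi (galAction kbar p) F) n (piMk (spreadFun n c x)) := by
  intro g hg hgP
  refine pi_ext fun h => ?_
  have w : P.alpha ⟨g⁻¹, inv_mem hgP⟩ ≫ str P.U ≫ act (galAction kbar p) (h * g) =
    str P.U ≫ act (galAction kbar p) h := comp_act_mul (P.alpha_inv_w g hgP) h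
  refine (piEval_pull h (w' := w) _).trans ?_
  change rt _ _ _ _ _ w (spreadFun n c x (h * g)) = spreadFun n c x h
  have e : c⁻¹ * (h * g) = (c⁻¹ * h) * g := (mul_assoc _ _ _).symm
  by_cases hm : c⁻¹ * h ∈ levelGroup k kbar n.val
  · have hm2 : c⁻¹ * (h * g) ∈ levelGroup k kbar n.val := by
      rw [e]; exact mul_mem hm hg
    rw [spreadFun_of_mem n x hm (n.le_stab hm), spreadFun_of_mem n x hm2 (n.le_stab hm2)]
    refine rt_rt ?_ x
    refine (alpha_comp ?_).symm
    rw [e, gal_mul_comm _ g, inv_mul_cancel_left]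
  · have hm2 : c⁻¹ * (h * g) ∉ levelGroup k kbar n.val := fun h2 =>
      hm ((Subgroup.mul_mem_cancel_right _ hg).1 (e ▸ h2))
    rw [spreadFun_of_notMem n x hm, spreadFun_of_notMem n x hm2, map_zero]

/-- The section over `U` of the coinduced sheaf given by `x ∈ F(cU)` on the coset of `c`, and by
`0` elsewhere. -/
def spread (n : P.Level) (c : Gal(kbar/k)) :
    Sec F (twist (galAction kbar p) c P.U) →+ ((coind kbar p).obj F).obj.sec P.U :=
  AddMonoidHom.mk' (fun x => coindMk (spreadFun n c x)
    (isSmooth_of_isFixed (isFixed_spreadFun n c x))) fun x y => ev_ext fun h => by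
      refine Eq.trans ?_ (map_add (ev h) _ _).symm
      change spreadFun n c (x + y) h = spreadFun n c x h + spreadFun n c y h
      by_cases hm : c⁻¹ * h ∈ levelGroup k kbar n.val
      · simp only [spreadFun_of_mem n _ hm (n.le_stab hm), map_add]
      · simp only [spreadFun_of_notMem n _ hm, add_zero]

lemma ev_spread_of_mem (n : P.Level) {c h : Gal(kbar/k)}
    (x : Sec F (twist (galAction kbar p) c P.U)) (hm : c⁻¹ * h ∈ levelGroup k kbar n.val)
    (hm' : c⁻¹ * h ∈ P.stab) : ev h (spread n c x) = P.tp F c h hm' x :=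
  spreadFun_of_mem n x hm hm'

lemma ev_spread_of_notMem (n : P.Level) {c h : Gal(kbar/k)}
    (x : Sec F (twist (galAction kbar p) c P.U)) (hm : c⁻¹ * h ∉ levelGroup k kbar n.val) :
    ev h (spread n c x) = 0 :=
  spreadFun_of_notMem n x hm

omit [LocallyOfFiniteType p] in
lemma mem_level_iff (n : P.Level) {a b c : Gal(kbar/k)} (h : a⁻¹ * b ∈ levelGroup k kbar n.val) :
    b⁻¹ * c ∈ levelGroup k kbar n.val ↔ a⁻¹ * c ∈ levelGroup k kbar n.val := by
  rw [← Subgroup.mul_mem_cancel_left _ h, mul_assoc, mul_inv_cancel_left]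

/-- The construction depends on `c` only through its coset, once `x` is transported along. -/
lemma spread_tp (n : P.Level) {c c' : Gal(kbar/k)} (h : c⁻¹ * c' ∈ levelGroup k kbar n.val)
    (h' : c⁻¹ * c' ∈ P.stab) (x : Sec F (twist (galAction kbar p) c P.U)) :
    spread n c' (P.tp F c c' h' x) = spread n c x := by
  refine ev_ext fun g => ?_
  have e := mem_level_iff n h (c := g)
  by_cases hm : c⁻¹ * g ∈ levelGroup k kbar n.val
  · rw [ev_spread_of_mem n _ hm (n.le_stab hm),
      ev_spread_of_mem n _ (e.2 hm) (n.le_stab (e.2 hm)), tp_tp]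
  · rw [ev_spread_of_notMem n _ hm, ev_spread_of_notMem n _ (e.not.2 hm)]

/-- Evaluation of a sum of sections that are supported on different cosets. -/
lemma ev_sum_spread {ι : Type*} (s : Finset ι) (n : P.Level) (c : ι → Gal(kbar/k))
    (y : ∀ i, Sec F (twist (galAction kbar p) (c i) P.U)) {h : Gal(kbar/k)} {i : ι} (hi : i ∈ s)
    (hm : (c i)⁻¹ * h ∈ levelGroup k kbar n.val) (hm' : (c i)⁻¹ * h ∈ P.stab)
    (hne : ∀ j ∈ s, (c j)⁻¹ * h ∈ levelGroup k kbar n.val → j = i) :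
    ev h (∑ j ∈ s, spread n (c j) (y j)) = P.tp F (c i) h hm' (y i) := by
  rw [map_sum, Finset.sum_eq_single i, ev_spread_of_mem n _ hm hm']
  · intro j hj hji
    exact ev_spread_of_notMem n _ fun h' => hji (hne j hj h')
  · exact fun h' => (h' hi).elim

omit [LocallyOfFiniteType p] in
lemma dvd_of_mem_level (n : P.Level) {i j : ℤ} {c h : Gal(kbar/k)}
    (hi : (c * frob k kbar ^ i)⁻¹ * h ∈ levelGroup k kbar n.val)
    (hj : (c * frob k kbar ^ j)⁻¹ * h ∈ levelGroup k kbar n.val) : (n.val : ℤ) ∣ i - j := by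
  rw [← frob_zpow_mem_levelGroup_iff (k := k) (kbar := kbar) n.pos]
  have := mul_mem hj (inv_mem hi)
  rwa [mul_inv_rev, mul_inv_rev, mul_assoc, inv_inv, mul_inv_cancel_left,
    ← mul_assoc, inv_mul_cancel_right, ← zpow_neg, ← zpow_add, neg_add_eq_sub] at this

/-- The coset of `c` at level `n` is the disjoint union of the `n'/n` cosets of `c φ^(nj)` at level
`n'`. This is the origin of the transition maps `δ`. -/
lemma spread_eq_sum {n n' : P.Level} (hn : n ≤ n') {c : Gal(kbar/k)} (c' : ℕ → Gal(kbar/k))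
    (hc : ∀ j, c' j = c * frob k kbar ^ ((n.val : ℤ) * j)) (hm : ∀ j, c⁻¹ * c' j ∈ P.stab)
    (x : Sec F (twist (galAction kbar p) c P.U)) :
    spread n c x =
      ∑ j ∈ Finset.range (n'.val / n.val), spread n' (c' j) (P.tp F c (c' j) (hm j) x) := by
  have hmn (j : ℕ) : c⁻¹ * c' j ∈ levelGroup k kbar n.val := by
    rw [hc, inv_mul_cancel_left, frob_zpow_mem_levelGroup_iff n.pos]
    exact Dvd.intro _ rfl
  have hle : levelGroup k kbar n'.val ≤ levelGroup k kbar n.val := levelGroup_anti hn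
  refine ev_ext fun h => ?_
  by_cases hh : c⁻¹ * h ∈ levelGroup k kbar n.val
  · obtain ⟨i, hi, hi'⟩ := exists_frob_pow_inv_mul_mem n'.pos (c⁻¹ * h)
    obtain ⟨j, rfl⟩ : n.val ∣ i := by
      have := mul_mem hh (inv_mem (hle hi'))
      rw [mul_inv_rev, inv_inv, ← mul_assoc, mul_inv_cancel, one_mul, ← zpow_natCast,
        frob_zpow_mem_levelGroup_iff n.pos] at this
      exact_mod_cast this
    have hj : (c' j)⁻¹ * h ∈ levelGroup k kbar n'.val := by
      rw [hc, mul_inv_rev, mul_assoc]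
      exact_mod_cast hi'
    rw [ev_spread_of_mem n x hh (n.le_stab hh),
      ev_sum_spread _ n' c' (fun j => P.tp F c (c' j) (hm j) x) (i := j) _ hj (n'.le_stab hj)]
    · exact (tp_tp x).symm
    · intro j' hj' h'
      rw [hc] at h' hj
      have := dvd_of_mem_level n' h' hj
      obtain ⟨d, hd⟩ : n.val ∣ n'.val := hn
      rw [hd, ← mul_sub, Nat.cast_mul] at this
      have h1 := Int.dvd_of_mul_dvd_mul_left (by exact_mod_cast n.pos.ne') this
      rw [hd, Nat.mul_div_cancel_left _ n.pos, Finset.mem_range] at hj'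
      rw [hd] at hi
      have h2 := lt_of_mul_lt_mul_left hi (Nat.zero_le _)
      have := Int.eq_zero_of_abs_lt_dvd h1 (by rw [abs_lt]; omega)
      omega
    · rw [Finset.mem_range]
      obtain ⟨d, hd⟩ : n.val ∣ n'.val := hn
      rw [hd, Nat.mul_div_cancel_left _ n.pos]
      rw [hd] at hi
      exact lt_of_mul_lt_mul_left hi (Nat.zero_le _)
  · rw [ev_spread_of_notMem n x hh, map_sum, Finset.sum_eq_zero]
    intro j _
    refine ev_spread_of_notMem n' _ fun h' => hh ?_
    exact (mem_level_iff n (hmn j)).1 (hle h')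

lemma tp_ev_of_isFixed {n : P.Level} {s : ((coind kbar p).obj F).obj.sec P.U}
    (hs : IsFixed ((coind kbar p).obj F).obj n s) {c h : Gal(kbar/k)}
    (hm : c⁻¹ * h ∈ levelGroup k kbar n.val) (hm' : c⁻¹ * h ∈ P.stab) :
    P.tp F c h hm' (ev c s) = ev h s := by
  have e : h * (c⁻¹ * h)⁻¹ = c := by rw [mul_inv_rev, inv_inv, mul_inv_cancel_left]
  have e1 := hs (c⁻¹ * h)⁻¹ (inv_mem hm) (inv_mem hm')
  refine Eq.trans ?_ (congrArg (ev h) e1)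
  have w := comp_act_mul (P.alpha_inv_w (c⁻¹ * h)⁻¹ (inv_mem hm')) h
  refine Eq.trans ?_ (ev_pull h (w' := w) s).symm
  exact rt_congr (fun h => ev h s) e.symm (alpha_congr (inv_inv _).symm)

/-- A section fixed at level `n` is determined on each coset by one component, and the `φ^i` with `i
< n` represent the cosets. -/
lemma eq_sum_spread {n : P.Level} {s : ((coind kbar p).obj F).obj.sec P.U}
    (hs : IsFixed ((coind kbar p).obj F).obj n s) :
    s = ∑ i : Fin n.val, spread n (frob k kbar ^ ((i : ℕ) : ℤ)) (ev _ s) := by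
  refine ev_ext fun h => ?_
  obtain ⟨i, hi, hm⟩ := exists_frob_pow_inv_mul_mem n.pos h
  have hm : (frob k kbar ^ (i : ℤ))⁻¹ * h ∈ levelGroup k kbar n.val := by exact_mod_cast hm
  rw [ev_sum_spread Finset.univ n (fun i : Fin n.val => frob k kbar ^ ((i : ℕ) : ℤ))
    (fun i => ev _ s) (i := ⟨i, hi⟩) (Finset.mem_univ _) hm (n.le_stab hm)]
  · exact (tp_ev_of_isFixed hs hm (n.le_stab hm)).symm
  · intro j _ hj
    have := dvd_of_mem_level n (c := 1) (h := h) (by rwa [one_mul]) (by rwa [one_mul]) (i := j)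
      (j := i)
    have h1 := Int.eq_zero_of_abs_lt_dvd this (by rw [abs_lt]; omega)
    exact Fin.ext (by simpa using (by omega : (j : ℕ) = i))

lemma ev_sum_spread_frob (n : P.Level)
    (y : ∀ i : Fin n.val, Sec F (twist (galAction kbar p) (frob k kbar ^ ((i : ℕ) : ℤ)) P.U))
    (i : Fin n.val) :
    ev _ (∑ j : Fin n.val, spread n (frob k kbar ^ ((j : ℕ) : ℤ)) (y j)) = y i := by
  have hm : (frob k kbar ^ ((i : ℕ) : ℤ))⁻¹ * frob k kbar ^ ((i : ℕ) : ℤ) ∈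
      levelGroup k kbar n.val := by rw [inv_mul_cancel]; exact one_mem _
  rw [ev_sum_spread Finset.univ n (fun i : Fin n.val => frob k kbar ^ ((i : ℕ) : ℤ)) y (i := i)
    (Finset.mem_univ _) hm (n.le_stab hm), tp_self]
  intro j _ hj
  have := dvd_of_mem_level n (c := 1) (h := frob k kbar ^ ((i : ℕ) : ℤ)) (by rwa [one_mul])
    (by rwa [one_mul]) (i := j) (j := i)
  have h1 := Int.eq_zero_of_abs_lt_dvd this (by rw [abs_lt]; omega)
  exact Fin.ext (by omega)

end Model

end Spread

/-! ### The coinduced sheaf as `colim_n ⊕_{i<n} F(φ^i U)`. -/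

section ColimSum

variable {k : Type u} [Field k] [Finite k] {kbar : Type u} [Field kbar] [Algebra k kbar]
variable [IsAlgClosure k kbar] {X : Scheme.{u}} {p : X ⟶ Spec (CommRingCat.of k)}

/-- This rewrites a restriction along `gU ⟶ V` as `g` applied to a section over `U`, the form in
which the naturality conditions are stated. -/
lemma res_ofSemilinear_eq_smul {S : Scheme.{u}} {Γ : Type v} [Group Γ] {ρ : Γ →* Aut S}
    (E : EquivariantSheaf ρ) {g g' : Γ} (hg : g * g' = 1) {U V : S.Etale} {f : U.left ⟶ V.left}
    {w : f ≫ str V = str U ≫ act ρ g} {w' : f ≫ str V ≫ act ρ g' = str U} (x : E.sec V) :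
    E.res (ofSemilinear ρ g f w) x = E.smul g U (E.pull g' f w' x) := by
  have wd : f ≫ str V ≫ act ρ 1 = str U ≫ act ρ g := by
    rw [act_one, Category.comp_id, w]
  have w2 : 𝟙 U.left ≫ str U ≫ act ρ g = str U ≫ act ρ g := Category.id_comp _
  have e1 := E.res_eq_pull (ofSemilinear ρ g f w) wd x
  have e2 := E.smul_eq_pull g U w2 (E.pull g' f w' x)
  have e3 := E.pull_pull (U := twist ρ g U) (w := w2) (w' := w') (wd := wd) hg.symm
    (Category.id_comp f).symm x
  exact e1.trans (e3.symm.trans e2.symm)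

lemma smul_injective {S : Scheme.{u}} {Γ : Type v} [Group Γ] {ρ : Γ →* Aut S}
    (E : EquivariantSheaf ρ) (g : Γ) (U : S.Etale) : Function.Injective (E.smul g U) := by
  intro x y h
  have w2 : 𝟙 U.left ≫ str U ≫ act ρ g = str U ≫ act ρ g := Category.id_comp _
  have ex := E.smul_eq_pull g U w2 x
  have ey := E.smul_eq_pull g U w2 y
  exact pull_injective (E := E) (U := twist ρ g U) (f := 𝟙 U.left) (f' := 𝟙 U.left) (w := w2)
    (Category.id_comp _) (ex.symm.trans (h.trans ey))

namespace Model

variable {P Q : Model kbar p}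

lemma tp_eq_gp {F : TG kbar p} {c h : Gal(kbar/k)} {hm : c⁻¹ * h ∈ P.stab}
    (w : P.alpha ⟨c⁻¹ * h, hm⟩ ≫ str P.U ≫ act (galAction kbar p) ((1 : weilGroup k kbar) * c) =
      str P.U ≫ act (galAction kbar p) h) (x : Sec F.sheaf (twist (galAction kbar p) c P.U)) :
    P.tp F.sheaf c h hm x = gp F 1 h c (P.alpha ⟨c⁻¹ * h, hm⟩) w x := rt_eq_gp _ w x

lemma gp_tp {F : TG kbar p} {g : weilGroup k kbar} {b c h : Gal(kbar/k)} {hm : c⁻¹ * b ∈ P.stab}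
    (w : 𝟙 P.U.left ≫ str P.U ≫ act (galAction kbar p) (g * b) =
      str P.U ≫ act (galAction kbar p) h)
    (wd : P.alpha ⟨c⁻¹ * b, hm⟩ ≫ str P.U ≫ act (galAction kbar p) (g * c) =
      str P.U ≫ act (galAction kbar p) h) (x : Sec F.sheaf (twist (galAction kbar p) c P.U)) :
    gp F g h b (𝟙 P.U.left) w (P.tp F.sheaf c b hm x) =
      gp F g h c (P.alpha ⟨c⁻¹ * b, hm⟩) wd x := by
  have e1 : ((1 : weilGroup k kbar) : Gal(kbar/k)) * c = c := one_mul c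
  have w1 := alpha_comp_act (P := P) (c := c) (h := b) hm
  rw [tp_eq_gp (e1.symm ▸ w1)]
  exact gp_gp (mul_one g).symm (Category.id_comp _).symm x

lemma tp_gp {F : TG kbar p} {g : weilGroup k kbar} {b c h : Gal(kbar/k)} {hm : b⁻¹ * h ∈ P.stab}
    (w : 𝟙 P.U.left ≫ str P.U ≫ act (galAction kbar p) (g * c) =
      str P.U ≫ act (galAction kbar p) b)
    (wd : P.alpha ⟨b⁻¹ * h, hm⟩ ≫ str P.U ≫ act (galAction kbar p) (g * c) =
      str P.U ≫ act (galAction kbar p) h) (x : Sec F.sheaf (twist (galAction kbar p) c P.U)) :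
    P.tp F.sheaf b h hm (gp F g b c (𝟙 P.U.left) w x) =
      gp F g h c (P.alpha ⟨b⁻¹ * h, hm⟩) wd x := by
  have e1 : ((1 : weilGroup k kbar) : Gal(kbar/k)) * b = b := one_mul b
  have w1 := alpha_comp_act (P := P) (c := b) (h := h) hm
  rw [tp_eq_gp (e1.symm ▸ w1)]
  exact gp_gp (one_mul g).symm (Category.comp_id _).symm x

lemma gp_congr' {F : TG kbar p} {a b : Gal(kbar/k)} {g : weilGroup k kbar}
    {U V : (Xbar kbar p).Etale} {f f' : U.left ⟶ V.left}
    {w : f ≫ str V ≫ act (galAction kbar p) (g * b) = str U ≫ act (galAction kbar p) a}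
    {w' : f' ≫ str V ≫ act (galAction kbar p) (g * b) = str U ≫ act (galAction kbar p) a}
    (hf : f = f') (x : Sec F.sheaf (twist (galAction kbar p) b V)) :
    gp F g a b f w x = gp F g a b f' w' x := by
  subst hf; rfl

variable [LocallyOfFiniteType p]

/-- Since `(ts)_h` depends on `s_{φ⁻¹h}`, the support moves from the coset of `c` to that of `φc`.
-/
lemma shift_spread (F : TG kbar p) (n : P.Level) {c c' : Gal(kbar/k)} (hc : c' = frob k kbar * c)
    (w : 𝟙 P.U.left ≫ str P.U ≫ act (galAction kbar p) ((frobG k kbar : Gal(kbar/k)) * c) =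
      str P.U ≫ act (galAction kbar p) c') (x : Sec F.sheaf (twist (galAction kbar p) c P.U)) :
    hs (shift F).hom.hom P.U (spread n c x) =
      spread n c' (gp F (frobG k kbar) c' c (𝟙 P.U.left) w x) := by
  refine ev_ext fun h => ?_
  rw [ev_shift]
  have e : c⁻¹ * ((frob k kbar)⁻¹ * h) = c'⁻¹ * h := by rw [hc, mul_inv_rev, mul_assoc]
  by_cases hm : c'⁻¹ * h ∈ levelGroup k kbar n.val
  · have hm2 : c⁻¹ * ((frob k kbar)⁻¹ * h) ∈ levelGroup k kbar n.val := by rwa [e]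
    rw [ev_spread_of_mem n _ hm (n.le_stab hm), ev_spread_of_mem n _ hm2 (n.le_stab hm2)]
    have w1 : P.alpha ⟨c'⁻¹ * h, n.le_stab hm⟩ ≫ str P.U ≫
        act (galAction kbar p) ((frobG k kbar : Gal(kbar/k)) * c) =
        str P.U ≫ act (galAction kbar p) h := by
      have e2 : act (galAction kbar p) ((frobG k kbar : Gal(kbar/k)) * c) =
        act (galAction kbar p) c' := congrArg _ hc.symm
      rw [e2, alpha_comp_act]
    have w2 : P.alpha ⟨c⁻¹ * ((frob k kbar)⁻¹ * h), n.le_stab hm2⟩ ≫ str P.U ≫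
        act (galAction kbar p) ((frobG k kbar : Gal(kbar/k)) * c) =
        str P.U ≫ act (galAction kbar p) h := by
      rw [alpha_congr e (hh := n.le_stab hm)]; exact w1
    exact (gp_tp _ w2 x).trans ((gp_congr' (alpha_congr e) x).trans (tp_gp w w1 x).symm)
  · have hm2 : c⁻¹ * ((frob k kbar)⁻¹ * h) ∉ levelGroup k kbar n.val := by rwa [e]
    rw [ev_spread_of_notMem n _ hm, ev_spread_of_notMem n _ hm2, map_zero]

/-- Since `(gs)_h = s_{hg}`, the support moves from the coset of `c` to that of `c g⁻¹ = c'`. The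
hypothesis on `f` matches the identifications on both sides. -/
lemma pull_spread {F : Sheaf (Xbar kbar p).smallEtaleTopology AddCommGrpCat.{u}} {n : P.Level}
    {m : Q.Level} (hnm : n.val = m.val) {f : P.U.left ⟶ Q.U.left} {g : Gal(kbar/k)}
    {w : f ≫ str Q.U ≫ act (galAction kbar p) g = str P.U}
    (hf : ∀ g ∈ levelGroup k kbar n.val, ∀ (hP : g ∈ P.stab) (hQ : g ∈ Q.stab),
      P.alpha ⟨g, hP⟩ ≫ f = f ≫ Q.alpha ⟨g, hQ⟩) {c c' : Gal(kbar/k)} (hc : c = c' * g)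
    (w' : f ≫ str Q.U ≫ act (galAction kbar p) c = str P.U ≫ act (galAction kbar p) c')
    (x : Sec F (twist (galAction kbar p) c Q.U)) :
    ((coind kbar p).obj F).obj.pull g f w (spread m c x) =
      spread n c' (rt (galAction kbar p) F c' c f w' x) := by
  refine ev_ext fun h => ?_
  have w1 : f ≫ str Q.U ≫ act (galAction kbar p) (h * g) =
    str P.U ≫ act (galAction kbar p) h := comp_act_mul w h
  rw [ev_pull h (w' := w1)]
  have e : c⁻¹ * (h * g) = c'⁻¹ * h := by
    rw [hc, gal_mul_comm c', mul_inv_rev, mul_assoc, gal_mul_comm h, inv_mul_cancel_left]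
  by_cases hm : c'⁻¹ * h ∈ levelGroup k kbar n.val
  · have hm2 : c⁻¹ * (h * g) ∈ levelGroup k kbar m.val := by rwa [e, ← hnm]
    rw [ev_spread_of_mem n _ hm (n.le_stab hm), ev_spread_of_mem m _ hm2 (m.le_stab hm2)]
    have hQ : c'⁻¹ * h ∈ Q.stab := by rw [← e]; exact m.le_stab hm2
    have h1 := hf _ hm (n.le_stab hm) hQ
    have h2 : f ≫ Q.alpha ⟨c⁻¹ * (h * g), m.le_stab hm2⟩ =
        P.alpha ⟨c'⁻¹ * h, n.le_stab hm⟩ ≫ f := by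
      rw [h1, alpha_congr e]
    have wd : (f ≫ Q.alpha ⟨c⁻¹ * (h * g), m.le_stab hm2⟩) ≫ str Q.U ≫
        act (galAction kbar p) c = str P.U ≫ act (galAction kbar p) h := by
      rw [Category.assoc, alpha_comp_act, w1]
    exact (rt_rt (wd := wd) rfl x).trans (rt_rt (wd := wd) h2 x).symm
  · have hm2 : c⁻¹ * (h * g) ∉ levelGroup k kbar m.val := by rwa [e, ← hnm]
    rw [ev_spread_of_notMem n _ hm, ev_spread_of_notMem m _ hm2, map_zero]

/-- A morphism that is compatible with the identifications `φ^n U = U` is compatible with the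
identifications `gU = U` for all `g` of level `n`. -/
lemma alpha_comm_of_compatibleAt {n : P.Level} {m : Q.Level} {f : P.U.left ⟶ Q.U.left}
    (h : CompatibleAt f n m) {g₀ : Gal(kbar/k)}
    (hf : f ≫ str Q.U = str P.U ≫ act (galAction kbar p) g₀) (g : Gal(kbar/k))
    (hg : g ∈ levelGroup k kbar n.val) (hP : g ∈ P.stab) (hQ : g ∈ Q.stab) :
    P.alpha ⟨g, hP⟩ ≫ f = f ≫ Q.alpha ⟨g, hQ⟩ := by
  obtain ⟨hnm, h⟩ := h
  -- The morphism commutes with some open subgroup, and modulo this subgroup every `g` of level `n`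
  -- is a power of `φ^n`.
  obtain ⟨N, hN, hNc⟩ := exists_alpha_comm f hf
  obtain ⟨n', hn', hN'⟩ := n.exists_le hN
  obtain ⟨i, -, hi⟩ := exists_frob_pow_inv_mul_mem n'.pos g
  obtain ⟨j, rfl⟩ : n.val ∣ i := by
    have := mul_mem hg (inv_mem (levelGroup_anti hn' hi))
    rw [mul_inv_rev, inv_inv, ← mul_assoc, mul_inv_cancel, one_mul, ← zpow_natCast,
      frob_zpow_mem_levelGroup_iff n.pos] at this
    exact_mod_cast this
  have hmul (a b : Gal(kbar/k)) (ha : ∃ (hP : a ∈ P.stab) (hQ : a ∈ Q.stab),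
      P.alpha ⟨a, hP⟩ ≫ f = f ≫ Q.alpha ⟨a, hQ⟩) (hb : ∃ (hP : b ∈ P.stab) (hQ : b ∈ Q.stab),
      P.alpha ⟨b, hP⟩ ≫ f = f ≫ Q.alpha ⟨b, hQ⟩) : ∃ (hP : a * b ∈ P.stab) (hQ : a * b ∈ Q.stab),
      P.alpha ⟨a * b, hP⟩ ≫ f = f ≫ Q.alpha ⟨a * b, hQ⟩ := by
    obtain ⟨aP, aQ, ha⟩ := ha
    obtain ⟨bP, bQ, hb⟩ := hb
    refine ⟨mul_mem aP bP, mul_mem aQ bQ, ?_⟩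
    rw [← alpha_comp (hg := aP) (hh := bP) rfl, ← alpha_comp (hg := aQ) (hh := bQ) rfl,
      Category.assoc, hb, ← Category.assoc, ha, Category.assoc]
  have hpow (i : ℕ) : ∃ (hP : (frob k kbar ^ n.val) ^ i ∈ P.stab)
      (hQ : (frob k kbar ^ n.val) ^ i ∈ Q.stab),
      P.alpha ⟨_, hP⟩ ≫ f = f ≫ Q.alpha ⟨_, hQ⟩ := by
    induction i with
    | zero =>
      refine ⟨by rw [pow_zero]; exact one_mem _, by rw [pow_zero]; exact one_mem _, ?_⟩
      rw [alpha_congr (pow_zero _) (hh := one_mem _), alpha_congr (pow_zero _) (hh := one_mem _),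
        alpha_one, alpha_one, Category.id_comp, Category.comp_id]
    | succ i ih =>
      rw [pow_succ]
      have e : frob k kbar ^ n.val = frob k kbar ^ m.val := by rw [hnm]
      refine hmul _ _ ih ⟨n.mem, e ▸ m.mem, ?_⟩
      rw [alpha_congr e (hh := m.mem), h]
  obtain ⟨_, _, e⟩ := hmul _ _ (hpow j) (hNc _ (hN' hi))
  have eg : (frob k kbar ^ n.val) ^ j * ((frob k kbar ^ (n.val * j))⁻¹ * g) = g := by
    rw [← pow_mul, mul_inv_cancel_left]
  exact (congrArg (· ≫ f) (alpha_congr eg.symm)).trans (e.trans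
    (congrArg (f ≫ ·) (alpha_congr eg)))

section Sum

variable (F : TG kbar p)

omit [LocallyOfFiniteType p] in
lemma transport_eq_tp {i j : ℤ} (h : frob k kbar ^ (j - i) ∈ P.stab)
    (h' : (frob k kbar ^ i)⁻¹ * frob k kbar ^ j ∈ P.stab) (x : F.sec (P.phiU i)) :
    P.transport F h x = P.tp F.sheaf (frob k kbar ^ i) (frob k kbar ^ j) h' x :=
  congrArg (fun e => rs F.sheaf e x) (etale_hom_ext (alpha_congr (by
    rw [← zpow_neg, ← zpow_add, neg_add_eq_sub])))

/-- The section of the coinduced sheaf given by `x ∈ F(φ^i U)` on the coset of `φ^i`. -/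
def spreadPhi (n : P.Level) (i : ℤ) :
    F.sec (P.phiU i) →+ ((coind kbar p).obj F.sheaf).obj.sec P.U :=
  spread (F := F.sheaf) n (frob k kbar ^ i)

variable (P) in
/-- The component in `F(φ^i U)` of a section of the coinduced sheaf. -/
def evPhi (i : ℤ) : ((coind kbar p).obj F.sheaf).obj.sec P.U →+ F.sec (P.phiU i) :=
  ev (frob k kbar ^ i)

lemma spreadPhi_transport (n : P.Level) {i j : ℤ} (h : frob k kbar ^ (j - i) ∈ P.stab)
    (hn : (n.val : ℤ) ∣ j - i) (x : F.sec (P.phiU i)) :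
    spreadPhi F n j (P.transport F h x) = spreadPhi F n i x := by
  have hm : (frob k kbar ^ i)⁻¹ * frob k kbar ^ j ∈ levelGroup k kbar n.val := by
    rwa [← zpow_neg, ← zpow_add, neg_add_eq_sub, frob_zpow_mem_levelGroup_iff n.pos]
  rw [transport_eq_tp F h (n.le_stab hm)]
  exact spread_tp n hm (n.le_stab hm) x

/-- The map from `⊕_{i<n} F(φ^i U)` to the sections of the coinduced sheaf. -/
def sumToSec (n : P.Level) : P.Sum F n →+ ((coind kbar p).obj F.sheaf).obj.sec P.U :=
  ∑ i : Fin n.val, (spreadPhi F n i).comp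
    (Pi.evalAddMonoidHom (fun i : Fin n.val => F.sec (P.phiU ((i : ℕ) : ℤ))) i)

lemma sumToSec_apply (n : P.Level) (y : P.Sum F n) : sumToSec F n y =
    ∑ i : Fin n.val, spreadPhi F n i (y i) :=
  AddMonoidHom.finsetSum_apply _ _ _

lemma evPhi_sum (n : P.Level) (y : P.Sum F n) (i : Fin n.val) :
    evPhi P F i (∑ i : Fin n.val, spreadPhi F n i (y i)) = y i :=
  ev_sum_spread_frob (F := F.sheaf) n y i

lemma sumToSec_injective (n : P.Level) : Function.Injective (sumToSec F n) := by
  intro y z h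
  refine funext fun i => ?_
  rw [sumToSec_apply, sumToSec_apply] at h
  rw [← evPhi_sum F n y i, h, evPhi_sum]

lemma sumToSec_single (n : P.Level) (i : Fin n.val) (x : F.sec (P.phiU ((i : ℕ) : ℤ))) :
    sumToSec F n (AddMonoidHom.single (fun i : Fin n.val => F.sec (P.phiU ((i : ℕ) : ℤ))) i x) =
      spreadPhi F n i x := by
  rw [sumToSec_apply, Finset.sum_eq_single i]
  · rw [AddMonoidHom.single_apply, Pi.single_eq_same]
  · intro j _ hj
    rw [AddMonoidHom.single_apply, Pi.single_eq_of_ne hj, map_zero]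
  · exact fun h => (h (Finset.mem_univ _)).elim

lemma sumToSec_entry (n : P.Level) (i : ℤ) (x : F.sec (P.phiU i)) :
    sumToSec F n (P.entry F n i x) = spreadPhi F n i x := by
  unfold entry
  rw [AddMonoidHom.comp_apply, sumToSec_single]
  refine spreadPhi_transport F n _ ?_ x
  have := n.pos
  have h1 := Int.emod_nonneg i (b := n.val) (by omega)
  refine ⟨-(i / n.val), ?_⟩
  have h2 := Int.emod_add_mul_ediv i n.val
  rw [Int.toNat_of_nonneg h1]
  linarith

lemma spreadPhi_eq_sum {n n' : P.Level} (h : n ≤ n') (i : ℤ) (x : F.sec (P.phiU i)) :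
    spreadPhi F n i x = ∑ j ∈ Finset.range (n'.val / n.val),
      spreadPhi F n' (i + n.val * j) (P.transport F (n.zpow_mem ⟨j, by ring⟩) x) := by
  have hm (j : ℕ) : (frob k kbar ^ i)⁻¹ * frob k kbar ^ (i + n.val * j : ℤ) ∈ P.stab := by
    rw [zpow_add, inv_mul_cancel_left]
    exact n.zpow_mem (Dvd.intro _ rfl)
  refine (spread_eq_sum h (fun j : ℕ => frob k kbar ^ (i + n.val * j : ℤ))
    (fun j => zpow_add _ _ _) hm x).trans ?_
  exact Finset.sum_congr rfl fun j _ =>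
    (congrArg (spreadPhi F n' (i + n.val * j)) (transport_eq_tp F _ (hm j) x)).symm

lemma sumToSec_delta {n n' : P.Level} (h : n ≤ n') (y : P.Sum F n) :
    sumToSec F n' (P.delta F n n' h y) = sumToSec F n y := by
  unfold delta
  rw [AddMonoidHom.finsetSum_apply, map_sum, sumToSec_apply F n y]
  refine Finset.sum_congr rfl fun i _ => ?_
  rw [AddMonoidHom.finsetSum_apply, map_sum, spreadPhi_eq_sum F h]
  refine Finset.sum_congr rfl fun j _ => ?_
  rw [AddMonoidHom.comp_apply, AddMonoidHom.comp_apply, sumToSec_entry]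
  rfl

/-- The map from `colim_n ⊕_{i<n} F(φ^i U)` to the sections of the coinduced sheaf. -/
def colimToSec (P : Model kbar p) :
    P.colimSum F →+ ((coind kbar p).obj F.sheaf).obj.sec P.U :=
  AddCommGroup.DirectLimit.lift (P.Sum F) (P.delta F) _ (sumToSec F)
    fun _ _ h y => sumToSec_delta F h y

lemma colimToSec_of (n : P.Level) (y : P.Sum F n) :
    colimToSec F P (AddCommGroup.DirectLimit.of (P.Sum F) (P.delta F) n y) = sumToSec F n y :=
  AddCommGroup.DirectLimit.lift_of _ _ _ _ _

lemma eq_sum_spreadPhi {n : P.Level} {s : ((coind kbar p).obj F.sheaf).obj.sec P.U}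
    (hs : IsFixed ((coind kbar p).obj F.sheaf).obj n s) :
    s = ∑ i : Fin n.val, spreadPhi F n i (evPhi P F i s) := eq_sum_spread hs

/-- Each level injects because the indices `i < n` lie in distinct cosets. Every section occurs
because it is smooth, hence fixed at some level. -/
lemma colimToSec_bijective (P : Model kbar p) : Function.Bijective (colimToSec F P) := by
  constructor
  · exact AddCommGroup.DirectLimit.lift_injective _ (sumToSec F)
      (fun _ _ h y => sumToSec_delta F h y) (sumToSec_injective F)
  · intro s
    obtain ⟨n, -, hn⟩ := exists_isFixed (isSmooth _ s) (Classical.arbitrary P.Level)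
    refine ⟨AddCommGroup.DirectLimit.of (P.Sum F) (P.delta F) n (fun i => evPhi P F i s), ?_⟩
    rw [colimToSec_of, sumToSec_apply]
    exact (eq_sum_spreadPhi F hn).symm

/-- The sections of the coinduced sheaf form the group `colim_n ⊕_{i<n} F(φ^i U)`. -/
def colimSumEquiv (P : Model kbar p) :
    P.colimSum F ≃+ ((gammaUpper kbar p).obj ((coind kbar p).obj F.sheaf)).sec P.U :=
  AddEquiv.ofBijective (colimToSec F P) (colimToSec_bijective F P)

lemma colimSumEquiv_entryColim (n : P.Level) (i : ℤ) (x : F.sec (P.phiU i)) :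
    colimSumEquiv F P (P.entryColim F n i x) = spreadPhi F n i x :=
  (colimToSec_of F n _).trans (sumToSec_entry F n i x)

lemma shift_spreadPhi (n : P.Level) (i : ℤ) (x : F.sec (P.phiU i)) :
    hs (shift F).hom.hom P.U (spreadPhi F n i x) = spreadPhi F n (i + 1) (P.phi F i x) := by
  have hc : frob k kbar ^ (i + 1) = frob k kbar * frob k kbar ^ i := by
    rw [add_comm, zpow_one_add]
  have w : 𝟙 P.U.left ≫ str P.U ≫ act (galAction kbar p)
      ((frobG k kbar : Gal(kbar/k)) * frob k kbar ^ i) =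
      str P.U ≫ act (galAction kbar p) (frob k kbar ^ (i + 1)) := by
    rw [hc, Category.id_comp]; rfl
  exact shift_spread F n hc w x

lemma pull_spreadPhi {a : ℤ} {f : P.U.left ⟶ Q.U.left} (hf : IsSemilinear a f) {n : P.Level}
    {m : Q.Level} (h : CompatibleAt f n m) (i : ℤ) (x : F.sec (Q.phiU i))
    (w : f ≫ str Q.U ≫ act (weilAction kbar p) (frobG k kbar ^ a)⁻¹ = str P.U) :
    ((gammaUpper kbar p).obj ((coind kbar p).obj F.sheaf)).pull (frobG k kbar ^ a)⁻¹ f w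
      (spreadPhi F m i x) = spreadPhi F n (i + a) (resPhi F hf i x) := by
  have hc : frob k kbar ^ i = frob k kbar ^ (i + a) * (frob k kbar ^ a)⁻¹ := by
    rw [zpow_add, mul_inv_cancel_right]
  have hw : f ≫ str Q.U ≫ act (galAction kbar p) (frob k kbar ^ i) =
      str P.U ≫ act (galAction kbar p) (frob k kbar ^ (i + a)) := by
    rw [hc]
    exact comp_act_mul (ρ := galAction kbar p) w _
  exact pull_spread (w := w) h.1 (fun g hg hP hQ => alpha_comm_of_compatibleAt h hf g hg hP hQ)
    hc hw x

lemma isColimSumSheaf_coind : IsColimSumSheaf F (shift F) (colimSumEquiv F) where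
  natural P Q a f hf n m h i x := by
    rw [colimSumEquiv_entryColim, colimSumEquiv_entryColim]
    have w' : f ≫ str Q.U ≫ act (weilAction kbar p) (frobG k kbar ^ a)⁻¹ = str P.U :=
      comp_act_eq hf
    refine (res_ofSemilinear_eq_smul ((gammaUpper kbar p).obj ((coind kbar p).obj F.sheaf))
      (mul_inv_cancel (frobG k kbar ^ a)) (w' := w') _).trans ?_
    exact congrArg (smul _ _ _) (pull_spreadPhi F hf h i x w')
  t_entry P n i x := by
    rw [colimSumEquiv_entryColim, colimSumEquiv_entryColim]
    exact shift_spreadPhi F n i x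

end Sum

end Model

end ColimSum

/-! ### Components expressed through `F(U)` by the isomorphisms `φ^i : F(U) ≃ F(φ^i U)`. -/

section Base

variable {k : Type u} [Field k] [Finite k] {kbar : Type u} [Field kbar] [Algebra k kbar]
variable [IsAlgClosure k kbar] {X : Scheme.{u}} {p : X ⟶ Spec (CommRingCat.of k)}

lemma res_twistHom_smul {S : Scheme.{u}} {Γ : Type v} [Group Γ] {ρ : Γ →* Aut S}
    (E : EquivariantSheaf ρ) {g h c : Γ} (hc : h = g * c) {U V : S.Etale}
    {f f' : U.left ⟶ V.left} {w : f ≫ str V ≫ act ρ h = str U ≫ act ρ g} (hf : f = f')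
    (w' : f' ≫ str V ≫ act ρ c = str U) (x : E.sec V) :
    E.res (twistHom ρ g h f w) (E.smul h V x) = E.smul g U (E.pull c f' w' x) := by
  subst hf
  have w1 : 𝟙 V.left ≫ str V ≫ act ρ h = str V ≫ act ρ h := Category.id_comp _
  have w2 : 𝟙 U.left ≫ str U ≫ act ρ g = str U ≫ act ρ g := Category.id_comp _
  have e0 := E.smul_eq_pull h V w1 x
  have e1 := E.res_pull (U := twist ρ g U) (V := twist ρ h V) (f := twistHom ρ g h f w)
    (f' := 𝟙 V.left) (w := w1) (d := f) (wd := w) (Category.comp_id f).symm x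
  have e2 := E.smul_eq_pull g U w2 (E.pull c f w' x)
  have e3 := E.pull_pull (U := twist ρ g U) (w := w2) (w' := w') (wd := w) hc
    (Category.id_comp f).symm x
  exact (congrArg (E.res (twistHom ρ g h f w)) e0).trans (e1.trans (e3.symm.trans e2.symm))

namespace Model

variable {P Q : Model kbar p} (F : TG kbar p)

lemma id_comp_phi (i : ℤ) : 𝟙 P.U.left ≫ str P.U ≫ act (weilAction kbar p) (frobG k kbar ^ i) =
    str (P.phiU i) := Category.id_comp _

lemma phiPow_eq_pull (i : ℤ) (x : F.sec P.U) :
    phiPow F P i x = F.pull (frobG k kbar ^ i) (U := P.phiU i) (𝟙 P.U.left) (id_comp_phi i) x :=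
  F.smul_eq_pull _ _ _ x

lemma phiPow_injective (i : ℤ) : Function.Injective (phiPow F P i) := smul_injective F _ _

lemma phiPow_surjective (i : ℤ) : Function.Surjective (phiPow F P i) := by
  intro y
  have w : 𝟙 P.U.left ≫ str (P.phiU i) ≫ act (weilAction kbar p) (frobG k kbar ^ i)⁻¹ =
      str P.U := (Category.id_comp _).trans (comp_act_act_inv (weilAction kbar p) _ _)
  have wd : 𝟙 P.U.left ≫ str (P.phiU i) ≫ act (weilAction kbar p) 1 = str (P.phiU i) :=
    id_comp_act_one (weilAction kbar p) _
  refine ⟨F.pull (frobG k kbar ^ i)⁻¹ (V := P.phiU i) (𝟙 P.U.left) w y, ?_⟩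
  rw [phiPow_eq_pull]
  refine (F.pull_pull (U := P.phiU i) (V := P.U) (W := P.phiU i) (wd := wd)
    (mul_inv_cancel (frobG k kbar ^ i)).symm (Category.id_comp _).symm y).trans ?_
  exact F.pull_one rfl rfl y

lemma phi_phiPow (i : ℤ) (x : F.sec P.U) :
    P.phi F i (phiPow F P i x) = phiPow F P (i + 1) x := by
  have w : 𝟙 P.U.left ≫ str (P.phiU i) ≫ act (weilAction kbar p) (frobG k kbar) =
      str (P.phiU (i + 1)) := by
    refine (Category.id_comp _).trans ?_
    change (str P.U ≫ act (weilAction kbar p) _) ≫ act (weilAction kbar p) _ = str P.U ≫ _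
    rw [Category.assoc, act_comp, ← zpow_one_add, add_comm]
  rw [phiPow_eq_pull, phiPow_eq_pull]
  exact F.pull_pull (U := P.phiU (i + 1)) (V := P.phiU i) (w := w)
    (by rw [add_comm, zpow_one_add]) (Category.id_comp _).symm x

/-- Read in `F(U)`, moving from index `i` to index `j` is the action of `φ^(i-j)`. The negative
exponents of the norm map come from here. -/
lemma transport_phiPow {i j : ℤ} (h : frob k kbar ^ (j - i) ∈ P.stab)
    (h' : frob k kbar ^ (i - j) ∈ P.stab) (x : F.sec P.U) :
    P.transport F h (phiPow F P i x) = phiPow F P j (P.frobAct F (i - j) h' x) := by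
  have hα : P.alpha ⟨_, h⟩ = P.alpha ⟨(frob k kbar ^ (i - j))⁻¹, inv_mem h'⟩ :=
    alpha_congr (by rw [← zpow_neg, neg_sub])
  have hφ : frobG k kbar ^ i = frobG k kbar ^ j * frobG k kbar ^ (i - j) := by
    rw [← zpow_add]
    congr 1
    omega
  exact res_twistHom_smul F hφ hα (P.alpha_inv_w _ h') x

lemma resPhi_phiPow {a : ℤ} {f : P.U.left ⟶ Q.U.left} (hf : IsSemilinear a f) (i : ℤ)
    (w : f ≫ str Q.U ≫ act (weilAction kbar p) (frobG k kbar ^ a)⁻¹ = str P.U) (x : F.sec Q.U) :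
    resPhi F hf i (phiPow F Q i x) = phiPow F P (i + a) (F.pull (frobG k kbar ^ a)⁻¹ f w x) := by
  have w1 : f ≫ str (Q.phiU i) = str (P.phiU (i + a)) := by
    change f ≫ str Q.U ≫ act (weilAction kbar p) (frobG k kbar ^ i) =
      str P.U ≫ act (weilAction kbar p) (frobG k kbar ^ (i + a))
    rw [← Category.assoc, show f ≫ str Q.U = _ from hf, Category.assoc, act_comp, ← zpow_add]
  rw [phiPow_eq_pull, phiPow_eq_pull]
  refine (F.res_pull (U := P.phiU (i + a)) (V := Q.phiU i) (f := etaleHom f w1)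
    (d := f) (wd := w1) (Category.comp_id _).symm x).trans ?_
  refine (F.pull_pull (U := P.phiU (i + a)) (V := P.U) (W := Q.U) (wd := w1) ?_
    (Category.id_comp _).symm x).symm
  rw [zpow_add, mul_inv_cancel_right]

omit [Finite k] [IsAlgClosure k kbar] in
lemma hs_thom_sub {M M' : TGhat kbar p} (a b : M ⟶ M') {U : (Xbar kbar p).Etale}
    (x : M.obj.sec U) :
    hs (a - b).hom.hom U x = hs a.hom.hom U x - hs b.hom.hom U x := by
  rw [sub_eq_add_neg, sub_eq_add_neg]
  rfl

variable [LocallyOfFiniteType p]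

/-- The section of the coinduced sheaf given by `φ^i x` on the coset of `φ^i`. -/
def base (n : P.Level) (i : ℤ) : F.sec P.U →+ ((coind kbar p).obj F.sheaf).obj.sec P.U :=
  (spreadPhi F n i).comp (phiPow F P i)

lemma shift_base (n : P.Level) (i : ℤ) (x : F.sec P.U) :
    hs (shift F).hom.hom P.U (base F n i x) = base F n (i + 1) x := by
  refine (shift_spreadPhi F n i _).trans ?_
  rw [phi_phiPow]
  rfl

/-- The indices `i + n` and `i` name the same coset, and passing from one to the other costs a
factor `φ^n`. -/
lemma base_add_level (n : P.Level) (i : ℤ) (x : F.sec P.U) :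
    base F n (i + n.val) x = base F n i (P.levelAct F n x) := by
  have h : frob k kbar ^ (i - (i + n.val)) ∈ P.stab := n.zpow_mem ⟨-1, by ring⟩
  have h' : frob k kbar ^ (i + n.val - i) ∈ P.stab := n.zpow_mem ⟨1, by ring⟩
  refine (spreadPhi_transport F n h ⟨-1, by ring⟩ _).symm.trans ?_
  rw [transport_phiPow F h h']
  exact congrArg (base F n i) (P.frobAct_congr F _ _ (by ring) x)

lemma base_eq_sum {n n' : P.Level} (h : n ≤ n') (i : ℤ) (x : F.sec P.U) :
    base F n i x = ∑ j ∈ Finset.range (n'.val / n.val), base F n' (i + n.val * j)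
      (P.frobAct F (-(n.val * j : ℤ)) (n.zpow_mem (Dvd.dvd.neg_right ⟨j, rfl⟩)) x) := by
  refine (spreadPhi_eq_sum F h i _).trans (Finset.sum_congr rfl fun j _ => ?_)
  have h' : frob k kbar ^ (i - (i + n.val * j : ℤ)) ∈ P.stab := n.zpow_mem ⟨-j, by ring⟩
  rw [transport_phiPow F _ h']
  exact congrArg (base F n' _) (P.frobAct_congr F _ _ (by ring) x)

lemma pull_base {a : ℤ} {f : P.U.left ⟶ Q.U.left} (hf : IsSemilinear a f) {n : P.Level}
    {m : Q.Level} (h : CompatibleAt f n m) (i : ℤ) (x : F.sec Q.U)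
    (w : f ≫ str Q.U ≫ act (weilAction kbar p) (frobG k kbar ^ a)⁻¹ = str P.U) :
    ((gammaUpper kbar p).obj ((coind kbar p).obj F.sheaf)).pull (frobG k kbar ^ a)⁻¹ f w
      (base F m i x) = base F n (i + a) (F.pull (frobG k kbar ^ a)⁻¹ f w x) := by
  refine (pull_spreadPhi F hf h i _ w).trans ?_
  rw [resPhi_phiPow F hf i w]
  rfl

lemma exists_eq_sum_base {n : P.Level} {s : ((coind kbar p).obj F.sheaf).obj.sec P.U}
    (hs : IsFixed ((coind kbar p).obj F.sheaf).obj n s) :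
    ∃ x : ℕ → F.sec P.U, s = ∑ i ∈ Finset.range n.val, base F n i (x i) := by
  choose x hx using fun i : ℕ => phiPow_surjective F (P := P) i (evPhi P F i s)
  refine ⟨x, ?_⟩
  rw [Finset.sum_range]
  refine (eq_sum_spreadPhi F hs).trans (Finset.sum_congr rfl fun i _ => ?_)
  exact congrArg (spreadPhi F n i) (hx i).symm

lemma evPhi_sum_base (n : P.Level) (x : ℕ → F.sec P.U) {i : ℕ} (hi : i < n.val) :
    evPhi P F i (∑ i ∈ Finset.range n.val, base F n i (x i)) = phiPow F P i (x i) := by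
  rw [Finset.sum_range]
  exact evPhi_sum F n (fun i => phiPow F P i (x i)) ⟨i, hi⟩

/-- The sum telescopes because `t` raises the index by one. For `m = n` the right-hand side becomes
`base n i (φ^n x - x)`, which links `t - 1` to `φ^n - 1`. -/
lemma sub_one_sum_base (n : P.Level) (x : F.sec P.U) (m : ℕ) (i : ℤ) :
    hs (shift F - 𝟙 _ : (coind kbar p).obj F.sheaf ⟶ _).hom.hom P.U
      (∑ j ∈ Finset.range m, base F n (i + j) x) = base F n (i + m) x - base F n i x := by
  have e (s) : hs (shift F - 𝟙 _ : (coind kbar p).obj F.sheaf ⟶ _).hom.hom P.U s =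
    hs (shift F).hom.hom P.U s - s := hs_thom_sub _ _ s
  rw [e, map_sum, ← Finset.sum_sub_distrib]
  refine (Finset.sum_congr rfl fun j _ => ?_).trans
    ((Finset.sum_range_sub (fun j => base F n (i + j) x) m).trans ?_)
  · rw [shift_base, add_assoc]
    norm_cast
  · simp

end Model

end Base

/-! ### Coinduction preserves epimorphisms. -/

section Exact

variable {k : Type u} [Field k] [Finite k] {kbar : Type u} [Field kbar] [Algebra k kbar]
variable [IsAlgClosure k kbar] {X : Scheme.{u}} {p : X ⟶ Spec (CommRingCat.of k)}

variable (kbar) in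
/-- The sieve of all morphisms that factor through an étale scheme with a model. -/
def modelSieve (U : (Xbar kbar p).Etale) : Sieve U where
  arrows V f := ∃ (P : Model kbar p) (a : V ⟶ P.U) (b : P.U ⟶ U), a ≫ b = f
  downward_closed := by
    rintro V W _ ⟨P, a, b, rfl⟩ g
    exact ⟨P, g ≫ a, b, Category.assoc _ _ _⟩

omit [Finite k] in
lemma modelSieve_mem (U : (Xbar kbar p).Etale) :
    modelSieve kbar U ∈ (Xbar kbar p).smallEtaleTopology U := by
  have := IsAlgClosure.isAlgebraic (R := k) (K := kbar)
  refine mem_smallEtaleTopology_iff.2 fun x => ?_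
  obtain ⟨P, f, y, h⟩ := exists_model_hom U x
  exact ⟨P.U, f, y, ⟨P, 𝟙 _, f, Category.id_comp _⟩, h⟩

omit [Finite k] in
lemma eq_zero_of_models {M M' : TGhat kbar p} (c : M ⟶ M')
    (h : ∀ (P : Model kbar p) (s : M.obj.sec P.U), hs c.hom.hom P.U s = 0) : c = 0 := by
  refine thom_ext fun U x => rs_ext (modelSieve_mem U) ?_
  rintro V _ ⟨P, a, b, rfl⟩
  rw [← hs_rs, ← hs_rs, ← rs_rs, hs_rs]
  refine (congrArg _ (h P _)).trans ?_
  rw [map_zero]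
  rfl

section CoindEpi

variable [LocallyOfFiniteType p]
variable {F F' : Sheaf (Xbar kbar p).smallEtaleTopology AddCommGrpCat.{u}} {a : F ⟶ F'}
variable {M : TGhat kbar p} {c : (coind kbar p).obj F' ⟶ M} {P : Model kbar p}

/-- On each member of the covering `x` lifts to some `y`. At a level compatible with the covering
morphisms, spreading commutes with restriction, so the restricted section is the image of the spread
of `y` and is killed by `c`. -/
lemma hs_spread_of_cover (hc : (coind kbar p).map a ≫ c = 0) (n : P.Level) (g : Gal(kbar/k))
    (x : Sec F' (twist (galAction kbar p) g P.U)) {ι : Type u} (Q : ι → Model kbar p)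
    (f : ∀ i, (Q i).U ⟶ P.U)
    (hf : Sieve.ofArrows _ f ∈ (Xbar kbar p).smallEtaleTopology P.U)
    (hn : ∀ i, ∀ b ∈ levelGroup k kbar n.val, ∃ (hP : b ∈ (Q i).stab) (hQ : b ∈ P.stab),
      (Q i).alpha ⟨b, hP⟩ ≫ (f i).left = (f i).left ≫ P.alpha ⟨b, hQ⟩)
    (hx : ∀ i, ∃ y : Sec F (twist (galAction kbar p) g (Q i).U), ∀ w,
      hs a _ y = rt (galAction kbar p) F' g g (f i).left w x) :
    hs c.hom.hom P.U (Model.spread n g x) = 0 := by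
  refine rs_ext hf ?_
  rintro V _ ⟨Y, u, _, ⟨i⟩, rfl⟩
  rw [← rs_rs, ← rs_rs, map_zero (rs M.obj.sheaf (f i)), ← hs_rs]
  congr 1
  obtain ⟨y, hy⟩ := hx i
  have w1 : (f i).left ≫ str P.U ≫ act (galAction kbar p) 1 = str (Q i).U := by
    rw [act_one, Category.comp_id, str_w]
  have w2 : (f i).left ≫ str P.U ≫ act (galAction kbar p) g =
      str (Q i).U ≫ act (galAction kbar p) g := by rw [← Category.assoc, str_w]
  have hn' : frob k kbar ^ n.val ∈ (Q i).stab := (hn i _ (frob_pow_mem_levelGroup _)).1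
  let m : (Q i).Level := ⟨n.val, n.pos, hn'⟩
  have e1 := ((coind kbar p).obj F').obj.res_eq_pull (f i) w1 (Model.spread n g x)
  have e2 := Model.pull_spread (n := m) (m := n) rfl (w := w1)
    (fun b hb hP hQ => (hn i b hb).2.2) (mul_one g).symm w2 x
  have e3 : hs ((coind kbar p).map a).hom.hom (Q i).U (Model.spread m g y) =
      Model.spread m g (rt (galAction kbar p) F' g g (f i).left w2 x) := by
    refine ev_ext fun h => ?_
    rw [ev_map]
    by_cases hm : g⁻¹ * h ∈ levelGroup k kbar m.val
    · rw [Model.ev_spread_of_mem _ _ hm (m.le_stab hm), Model.ev_spread_of_mem _ _ hm (m.le_stab hm),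
        ← hy w2]
      exact hs_rt a _
    · rw [Model.ev_spread_of_notMem _ _ hm, Model.ev_spread_of_notMem _ _ hm, map_zero]
  have e4 := congrArg (fun b => hs b.hom.hom (Q i).U (Model.spread m g y)) hc
  exact (congrArg (hs c.hom.hom (Q i).U) (e1.trans (e2.trans e3.symm))).trans e4

lemma hs_spread_eq_zero [Epi a] (hc : (coind kbar p).map a ≫ c = 0) (n : P.Level)
    (g : Gal(kbar/k)) (x : Sec F' (twist (galAction kbar p) g P.U)) :
    hs c.hom.hom P.U (Model.spread n g x) = 0 := by
  have := IsAlgClosure.isAlgebraic (R := k) (K := kbar)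
  obtain ⟨R, hR, hx⟩ := (epi_iff_locally_surjective a).1 inferInstance _ x
  have hid : 𝟙 P.U.left ≫ str (twist (galAction kbar p) g P.U) =
    str P.U ≫ act (galAction kbar p) g := Category.id_comp _
  obtain ⟨ι, _, Q, f, hf, hcov⟩ := exists_finite_model_cover P
    (semilinearPullback_mem (galAction kbar p) g (V := twist (galAction kbar p) g P.U)
      (𝟙 P.U.left) hid hR)
  choose N hN hNf using fun i => exists_alpha_comm (P := Q i) (Q := P) (g := 1) (f i).left
    (by rw [act_one, Category.comp_id, str_w])
  obtain ⟨N', hN', hle⟩ := exists_open_subset N hN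
  -- The level `n` need not be compatible with the covering morphisms. The claim is proved first at
  -- a finer level `n'`, and the section of level `n` is then split into sections of level `n'`.
  obtain ⟨n', hn', hnN⟩ := n.exists_le hN'
  have h0 : hs c.hom.hom P.U (Model.spread n' g x) = 0 := by
    refine hs_spread_of_cover hc n' g x Q f hcov (fun i b hb => hNf i b (hle i (hnN hb)))
      fun i => ?_
    obtain ⟨y, hy⟩ := hx _ _ (hf i)
    refine ⟨y, fun w => hy.trans ?_⟩
    have hl : (f i).left ≫ 𝟙 P.U.left = (f i).left := Category.comp_id _
    exact congrArg (fun b => rs F' b x) (etale_hom_ext hl)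
  have hm (j : ℕ) : g⁻¹ * (g * frob k kbar ^ ((n.val : ℤ) * j)) ∈ P.stab := by
    rw [inv_mul_cancel_left]
    exact n.zpow_mem ⟨j, rfl⟩
  rw [Model.spread_eq_sum hn' _ (fun j => rfl) hm x, map_sum]
  refine Finset.sum_eq_zero fun j _ => ?_
  -- The summand at `g'` is the pullback of `spread n' g x` under the stabilizer element
  -- `(g⁻¹g')⁻¹`, so equivariance of `c` reduces it to `h0`.
  set g' := g * frob k kbar ^ ((n.val : ℤ) * j) with hg'
  have w : P.alpha ⟨g⁻¹ * g', hm j⟩ ≫ str P.U ≫ act (galAction kbar p) (g⁻¹ * g')⁻¹ = str P.U :=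
    comp_act_eq (P.alpha_w _)
  have e := Model.pull_spread (F := F') (n := n') (m := n') rfl (w := w)
    (fun b _ hP hQ => ?_) (c := g) (c' := g') (by group) (Model.alpha_comp_act (hm j)) x
  · refine (congrArg (hs c.hom.hom P.U) e.symm).trans ((hom_pull c.hom _).trans ?_)
    rw [h0, map_zero]
  · rw [Model.alpha_comp rfl, Model.alpha_comp (gal_mul_comm _ _)]
    exact mul_mem hP (hm j)

instance : (coind kbar p).PreservesEpimorphisms where
  preserves a _ := Preadditive.epi_of_cancel_zero _ fun c hc => eq_zero_of_models c fun P s => by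
    obtain ⟨n, _, hs⟩ := Model.exists_isFixed (isSmooth _ s) (Classical.arbitrary P.Level)
    rw [Model.eq_sum_spread hs, map_sum]
    exact Finset.sum_eq_zero fun i _ => hs_spread_eq_zero hc n _ _

end CoindEpi

end Exact

/-- The indefinite sum, started at 0 and continued in both directions. Its existence expresses the
vanishing of the first cohomology of `ℤ` with coinduced coefficients. -/
lemma exists_int_sum {A : Type*} [AddCommGroup A] (b : ℤ → A) :
    ∃ S : ℤ → A, ∀ q, S (q + 1) - S q = b q := by
  refine ⟨fun q => ∑ i ∈ Finset.range q.toNat, b i -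
    ∑ i ∈ Finset.range (-q).toNat, b (-(i + 1 : ℕ)), fun q => ?_⟩
  obtain ⟨m, rfl | rfl⟩ := q.eq_nat_or_neg
  · have h1 : ((m : ℤ) + 1).toNat = m + 1 := by omega
    have h2 : (-((m : ℤ) + 1)).toNat = 0 := by omega
    have h3 : (-(m : ℤ)).toNat = 0 := by omega
    simp only [h1, h2, h3, Finset.sum_range_succ, Int.toNat_natCast,
      Finset.range_zero, Finset.sum_empty]
    abel
  · cases m with
    | zero => simp
    | succ m =>
      have h1 : (-((m + 1 : ℕ) : ℤ) + 1).toNat = 0 := by omega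
      have h2 : (-(-((m + 1 : ℕ) : ℤ) + 1)).toNat = m := by omega
      have h3 : (-((m + 1 : ℕ) : ℤ)).toNat = 0 := by omega
      have h4 : (- -((m + 1 : ℕ) : ℤ)).toNat = m + 1 := by omega
      simp only [h1, h2, h3, h4, Finset.sum_range_succ, Finset.range_zero, Finset.sum_empty]
      abel

/-! ### Surjectivity of `φ^n - 1` and of `t - 1` for injective objects. -/

section Injective

variable {k : Type u} [Field k] [Finite k] {kbar : Type u} [Field kbar] [Algebra k kbar]
variable [IsAlgClosure k kbar] {X : Scheme.{u}} {p : X ⟶ Spec (CommRingCat.of k)}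

variable (k kbar) in
lemma frob_zpow_injective : Function.Injective fun i : ℤ => frob k kbar ^ i := by
  intro i j h
  -- The level `|i - j| + 1` exceeds `|i - j|`, so it divides `i - j` only if `i = j`.
  have h1 : frob k kbar ^ (i - j) ∈ levelGroup k kbar ((i - j).natAbs + 1) := by
    rw [zpow_sub, show frob k kbar ^ i = frob k kbar ^ j from h, mul_inv_cancel]
    exact one_mem _
  have h2 := (frob_zpow_mem_levelGroup_iff (Nat.succ_pos _)).1 h1
  have h3 := Int.eq_zero_of_abs_lt_dvd h2 (by rw [Int.abs_eq_natAbs]; push_cast; omega)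
  omega

lemma exists_frobG_zpow (h : weilGroup k kbar) : ∃ i : ℤ, frobG k kbar ^ i = h := by
  obtain ⟨_, i, rfl⟩ := h
  exact ⟨i, rfl⟩

variable (F : Sheaf (Xbar kbar p).smallEtaleTopology AddCommGrpCat.{u}) {P : Model kbar p}

/-- Sections over the translates of `P.U` with prescribed differences along `φ^n`. -/
lemma exists_tp_sub_eq (n : P.Level)
    (x : ∀ h : weilGroup k kbar, Sec F (twist (galAction kbar p) (h : Gal(kbar/k)) P.U)) :
    ∃ s : ∀ h : weilGroup k kbar, Sec F (twist (galAction kbar p) (h : Gal(kbar/k)) P.U),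
      ∀ (h : weilGroup k kbar) (hm : ((h * frobG k kbar ^ (n.val : ℤ) : weilGroup k kbar) :
        Gal(kbar/k))⁻¹ * h ∈ P.stab),
        P.tp F ((h * frobG k kbar ^ (n.val : ℤ) : weilGroup k kbar) : Gal(kbar/k)) h hm
          (s (h * frobG k kbar ^ (n.val : ℤ))) - s h = x h := by
  have hmem {i j : ℤ} (h : (n.val : ℤ) ∣ j - i) :
      ((frobG k kbar ^ i : weilGroup k kbar) : Gal(kbar/k))⁻¹ *
        ((frobG k kbar ^ j : weilGroup k kbar) : Gal(kbar/k)) ∈ P.stab := by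
    have := n.zpow_mem h
    rwa [sub_eq_neg_add, zpow_add, zpow_neg] at this
  -- On each residue class modulo `n` all components are transported to the single group `F(φ^r U)`,
  -- where the required differences are realized by an indefinite sum along `q ↦ r + nq`. Unique
  -- exponents of elements of `G` make the resulting `s` well defined.
  choose S hS using fun r : ℤ => exists_int_sum fun q : ℤ =>
    P.tp F _ _ (hmem (i := r + n.val * q) (j := r) ⟨-q, by ring⟩)
      (x (frobG k kbar ^ (r + n.val * q)))
  choose ψ hψ using exists_frobG_zpow (k := k) (kbar := kbar)
  have hψ' (i : ℤ) : ψ (frobG k kbar ^ i) = i :=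
    frob_zpow_injective k kbar (congrArg Subtype.val (hψ (frobG k kbar ^ i)))
  have hψm (h) : ((frobG k kbar ^ (ψ h % n.val) : weilGroup k kbar) : Gal(kbar/k))⁻¹ * h ∈
      P.stab := by
    have := hmem (i := ψ h % n.val) (j := ψ h) (Int.dvd_self_sub_emod)
    rwa [hψ] at this
  let s : ∀ h : weilGroup k kbar, Sec F (twist (galAction kbar p) (h : Gal(kbar/k)) P.U) :=
    fun h => P.tp F _ _ (hψm h) (S (ψ h % n.val) (ψ h / n.val))
  have hs (h : weilGroup k kbar) (r q : ℤ) (hr : ψ h % n.val = r) (hq : ψ h / n.val = q) (hm) :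
      s h = P.tp F ((frobG k kbar ^ r : weilGroup k kbar) : Gal(kbar/k)) h hm (S r q) := by
    subst hr hq
    rfl
  have hx (i j : ℤ) (e : i = j) (c : Gal(kbar/k)) (h1) (h2) :
      P.tp F ((frobG k kbar ^ i : weilGroup k kbar) : Gal(kbar/k)) c h1 (x (frobG k kbar ^ i)) =
      P.tp F ((frobG k kbar ^ j : weilGroup k kbar) : Gal(kbar/k)) c h2
        (x (frobG k kbar ^ j)) := by
    subst e
    rfl
  refine ⟨s, fun h hm => ?_⟩
  obtain ⟨i, rfl⟩ := exists_frobG_zpow h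
  have hn0 : (n.val : ℤ) ≠ 0 := by exact_mod_cast n.pos.ne'
  have hi := hψ' (i + n.val)
  rw [zpow_add] at hi
  have hir : (n.val : ℤ) ∣ i - i % n.val := Int.dvd_self_sub_emod
  have hir' : (n.val : ℤ) ∣ (i + n.val) - i % n.val := by
    rw [add_sub_right_comm]
    exact hir.add dvd_rfl
  have hm2 := hmem hir'
  rw [zpow_add] at hm2
  rw [hs (frobG k kbar ^ i) (i % n.val) (i / n.val) (by rw [hψ']) (by rw [hψ']) (hmem hir),
    hs (frobG k kbar ^ i * frobG k kbar ^ (n.val : ℤ)) (i % n.val) (i / n.val + 1)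
      (by rw [hi, Int.add_emod_right]) (by rw [hi, Int.add_ediv_of_dvd_right dvd_rfl,
        Int.ediv_self hn0]) hm2,
    Model.tp_tp (hac := hmem hir), ← map_sub, hS,
    hx _ i (Int.emod_add_mul_ediv i n.val) _ _
      (hmem ((dvd_sub_comm).1 hir)), Model.tp_tp (hac := hmem (by simp))]
  exact Model.tp_self _

lemma alpha_level_w (n : P.Level) : P.alpha ⟨_, inv_mem (n.zpow_mem dvd_rfl)⟩ ≫ str P.U ≫
    act (weilAction kbar p) (frobG k kbar ^ (n.val : ℤ)) = str P.U :=
  P.alpha_inv_w _ (n.zpow_mem dvd_rfl)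

lemma levelAct_eq_pull (E : TG kbar p) (n : P.Level) (x : E.sec P.U) :
    P.levelAct E n x = E.pull (frobG k kbar ^ (n.val : ℤ)) (P.alpha ⟨_, inv_mem
      (n.zpow_mem dvd_rfl)⟩) (alpha_level_w n) x := rfl

lemma piEval_levelAct (n : P.Level) (s : (pi (weilAction kbar p) F).sec P.U)
    (h : weilGroup k kbar) (hm : ((h * frobG k kbar ^ (n.val : ℤ) : weilGroup k kbar) :
      Gal(kbar/k))⁻¹ * h ∈ P.stab) :
    piEval h (P.levelAct (pi (weilAction kbar p) F) n s) =
      P.tp F ((h * frobG k kbar ^ (n.val : ℤ) : weilGroup k kbar) : Gal(kbar/k)) h hm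
        (piEval (h * frobG k kbar ^ (n.val : ℤ)) s) := by
  have hn := n.zpow_mem dvd_rfl
  have hα : P.alpha ⟨(frob k kbar ^ (n.val : ℤ))⁻¹, inv_mem hn⟩ = P.alpha ⟨_, hm⟩ :=
    Model.alpha_congr (by
      change _ = ((h : Gal(kbar/k)) * frob k kbar ^ (n.val : ℤ))⁻¹ * h
      rw [mul_inv_rev, inv_mul_cancel_right])
  have w : P.alpha ⟨_, hm⟩ ≫ str P.U ≫ act (weilAction kbar p) (h * frobG k kbar ^ (n.val : ℤ)) =
    str P.U ≫ act (weilAction kbar p) h := Model.alpha_comp_act hm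
  have w' : P.alpha ⟨(frob k kbar ^ (n.val : ℤ))⁻¹, inv_mem hn⟩ ≫ str P.U ≫
      act (weilAction kbar p) (h * frobG k kbar ^ (n.val : ℤ)) =
      str P.U ≫ act (weilAction kbar p) h := by
    rw [hα, w]
  rw [levelAct_eq_pull, piEval_pull (ρ := weilAction kbar p) h (w := alpha_level_w n) (w' := w') s]
  exact rt_congr (ρ' := weilAction kbar p) (F := F) (w := w') (w' := w)
    (fun h => piEval h s) rfl hα

lemma levelActSubOne_pi_surjective (n : P.Level) :
    Function.Surjective (P.levelActSubOne (pi (weilAction kbar p) F) n) := by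
  intro x
  obtain ⟨s, hs⟩ := exists_tp_sub_eq F n fun h => piEval h x
  refine ⟨piMk s, pi_ext fun h => ?_⟩
  have hm : ((h * frobG k kbar ^ (n.val : ℤ) : weilGroup k kbar) : Gal(kbar/k))⁻¹ * h ∈
      P.stab := by
    change ((h : Gal(kbar/k)) * frob k kbar ^ (n.val : ℤ))⁻¹ * h ∈ P.stab
    rw [mul_inv_rev, inv_mul_cancel_right]
    exact inv_mem (n.zpow_mem dvd_rfl)
  refine (map_sub (piEval h) _ _).trans (Eq.trans ?_ (hs h hm))
  exact congrArg (· - _) (piEval_levelAct F n _ h hm)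

lemma hom_levelAct {E E' : TG kbar p} (a : E ⟶ E') (n : P.Level) (x : E.sec P.U) :
    hs a.hom P.U (P.levelAct E n x) = P.levelAct E' n (hs a.hom P.U x) := by
  rw [levelAct_eq_pull, levelAct_eq_pull, hom_pull]

lemma levelActSubOne_apply {E : TG kbar p} (n : P.Level) (x : E.sec P.U) :
    P.levelActSubOne E n x = P.levelAct E n x - x := rfl

lemma hom_levelActSubOne {E E' : TG kbar p} (a : E ⟶ E') (n : P.Level) (x : E.sec P.U) :
    hs a.hom P.U (P.levelActSubOne E n x) = P.levelActSubOne E' n (hs a.hom P.U x) := by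
  rw [levelActSubOne_apply, levelActSubOne_apply, map_sub, hom_levelAct]

/-- The canonical morphism from `J` to `∏_g J(gU)` is a monomorphism, so injectivity makes `J` a
retract, and `φ^n - 1` commutes with morphisms. -/
lemma levelActSubOne_surjective (J : TG kbar p) [Injective J] (n : P.Level) :
    Function.Surjective (P.levelActSubOne J n) := by
  let a : J ⟶ pi (weilAction kbar p) J.sheaf := toPi (𝟙 J.sheaf)
  have ha : a.hom ≫ piCounit (weilAction kbar p) J.sheaf = 𝟙 _ := toPi_counit _
  have : Mono a := (forgetAction (weilAction kbar p)).mono_of_mono_map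
    (SplitMono.mk _ ha).mono
  intro x
  obtain ⟨y, hy⟩ := levelActSubOne_pi_surjective J.sheaf n (hs a.hom P.U x)
  let r := Injective.factorThru (𝟙 J) a
  have hr : a ≫ r = 𝟙 J := Injective.comp_factorThru _ _
  refine ⟨hs r.hom P.U y, ?_⟩
  rw [← hom_levelActSubOne, hy]
  exact congrArg (fun b => hs (Hom.hom b) P.U x) hr

/-- On the coinduced sheaf of an injective object, `t - 1` is an epimorphism. -/
lemma epi_shift_sub_one [LocallyOfFiniteType p] (J : TG kbar p) [Injective J] :
    Epi (shift J - 𝟙 _) := by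
  refine Preadditive.epi_of_cancel_zero _ fun {M} c hc => eq_zero_of_models c fun P s => ?_
  obtain ⟨n, _, hs'⟩ := Model.exists_isFixed (isSmooth _ s) (Classical.arbitrary P.Level)
  obtain ⟨x, rfl⟩ := Model.exists_eq_sum_base J hs'
  rw [map_sum]
  refine Finset.sum_eq_zero fun i _ => ?_
  -- With `φ^n y - y = x i`, the telescoping sum of the `base n (i + j) y` over `j < n` is a
  -- preimage of `base n i (x i)` under `t - 1`.
  obtain ⟨y, hy⟩ := levelActSubOne_surjective J n (x i)
  have e1 := Model.sub_one_sum_base J n y n.val i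
  rw [Model.base_add_level, ← map_sub] at e1
  have e2 := congrArg (Model.base J n i) hy
  exact (congrArg (hs c.hom.hom P.U) (e2.symm.trans e1.symm)).trans
    (congrArg (fun b => hs b.hom.hom P.U _) hc)

end Injective

/-! ### The quasi-isomorphism of `Rγ_* F` with the two-term complex. -/

section Derived

variable {k : Type u} [Field k] [Finite k] {kbar : Type u} [Field kbar] [Algebra k kbar]
variable [IsAlgClosure k kbar] {X : Scheme.{u}} {p : X ⟶ Spec (CommRingCat.of k)}
variable [LocallyOfFiniteType p]

instance : (coind kbar p).IsRightAdjoint := (coindAdjunction kbar p).isRightAdjoint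

variable (kbar p) in
/-- The functor `F ↦ (U ↦ colim_n ⊕_{i<n} F(φ^i U))` from `𝒯_G` to `𝒯_Ĝ`. -/
def weilCoind : TG kbar p ⥤ TGhat kbar p := forgetAction (weilAction kbar p) ⋙ coind kbar p

instance : PreservesFiniteLimits (coind kbar p) where
  preservesFiniteLimits _ := inferInstance

instance : PreservesFiniteLimits (weilCoind kbar p) :=
  comp_preservesFiniteLimits _ _

instance : (weilCoind kbar p).PreservesEpimorphisms :=
  inferInstanceAs (forgetAction (weilAction kbar p) ⋙ coind kbar p).PreservesEpimorphisms

instance : (weilCoind kbar p).Additive :=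
  Functor.additive_of_preserves_binary_products _

/-- Kernels are preserved because `coind` is a right adjoint, and epimorphisms by the covering
argument. So coinduction takes a resolution to a resolution. -/
instance : (weilCoind kbar p).PreservesHomology :=
  Functor.preservesHomology_of_preservesEpis_and_kernels _

variable {F : TG kbar p} (I : InjectiveResolution F)

/-- The complex of coinduced sheaves of an injective resolution. -/
def coindComplex : CochainComplex (TGhat kbar p) ℕ :=
  ((weilCoind kbar p).mapHomologicalComplex _).obj I.cocomplex

/-- The embedding of `Rγ_*` into the complex of coinduced sheaves. -/
def gammaInclComplex : RGamma kbar p I ⟶ coindComplex I where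
  f n := gammaIncl (I.cocomplex.X n)
  comm' i j _ := (gammaLower_map_incl (I.cocomplex.d i j)).symm

/-- The endomorphism `t - 1` of the complex of coinduced sheaves. -/
def shiftSubOneComplex : coindComplex I ⟶ coindComplex I where
  f n := shift (I.cocomplex.X n) - 𝟙 _
  comm' i j _ := by
    refine (Preadditive.sub_comp _ _ _).trans (Eq.trans ?_ (Preadditive.comp_sub _ _ _).symm)
    refine congrArg₂ (· - ·) (shift_map (I.cocomplex.d i j)) ?_
    exact (Category.id_comp _).trans (Category.comp_id _).symm

lemma gammaInclComplex_comp : gammaInclComplex I ≫ shiftSubOneComplex I = 0 := by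
  ext n : 1
  exact gammaIncl_shift

/-- Termwise `γ_* I` is the kernel of `t - 1` on the coinduced complex, and `t - 1` is an
epimorphism there because the terms of `I` are injective. By exactness the coinduced complex
resolves `coind F`. -/
lemma quasiIsomorphic_shift :
    QuasiIsomorphic (RGamma kbar p I) (twoTerm (shift F - 𝟙 ((coind kbar p).obj F.sheaf))) := by
  have : Mono (I.ι.f 0) := inferInstance
  let a : (coind kbar p).obj F.sheaf ⟶ (coindComplex I).X 0 := (weilCoind kbar p).map (I.ι.f 0)
  have : Mono a := inferInstanceAs (Mono ((weilCoind kbar p).map (I.ι.f 0)))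
  have had : a ≫ (coindComplex I).d 0 1 = 0 := by
    refine ((weilCoind kbar p).map_comp _ _).symm.trans ?_
    exact (congrArg (weilCoind kbar p).map I.ι_f_zero_comp_complex_d).trans (Functor.map_zero _ _ _)
  refine quasiIsomorphic_twoTerm (W := coindComplex I) (ι := gammaInclComplex I)
    (τ := shiftSubOneComplex I) (gammaInclComplex_comp I) (fun n => ?_) (a := a) had ?_ ?_ ?_
  · have := epi_shift_sub_one (I.cocomplex.X n)
    have : Epi ((shiftSubOneComplex I).f n) := this
    have : Mono ((gammaInclComplex I).f n) := inferInstanceAs (Mono (gammaIncl (I.cocomplex.X n)))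
    exact ⟨ShortComplex.exact_of_f_is_kernel _ (isLimitGammaIncl (I.cocomplex.X n))⟩
  · have e : shift F ≫ a = a ≫ shift (I.cocomplex.X 0) := shift_map (F := F) (I.ι.f 0)
    refine (Preadditive.comp_sub _ _ _).trans (Eq.trans ?_ (Preadditive.sub_comp _ _ _).symm)
    exact congrArg₂ (· - ·) e.symm ((Category.comp_id _).trans (Category.id_comp _).symm)
  · intro n
    exact (I.cocomplex_exactAt_succ n).map (weilCoind kbar p)
  · exact (ShortComplex.exact_of_f_is_kernel (ShortComplex.mk _ _ I.ι_f_zero_comp_complex_d)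
      I.isLimitKernelFork).map (weilCoind kbar p)

end Derived

/-! ### Exactness in `𝒯_Ĝ` in terms of local sections. -/

section LocalExact

variable {k : Type u} [Field k] [Finite k] {kbar : Type u} [Field kbar] [Algebra k kbar]
variable [IsAlgClosure k kbar] {X : Scheme.{u}} {p : X ⟶ Spec (CommRingCat.of k)}
variable [LocallyOfFiniteType p] {M M' M'' : TGhat kbar p}

/-- The cokernel of `b` among all equivariant sheaves is a quotient of `M'`, hence continuous, so
the projection to it is already zero in `𝒯_Ĝ`. -/
instance (b : M ⟶ M') [Epi b] : Epi b.hom := by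
  let C : TGhat kbar p := ⟨coker b.hom, isContinuous_of_epi (cokerπ b.hom) M'.property⟩
  let π : M' ⟶ C := ObjectProperty.homMk (cokerπ b.hom)
  have h : b ≫ π = 0 := ObjectProperty.hom_ext _ (comp_cokerπ b.hom)
  have h0 : cokerπ b.hom = 0 := congrArg (fun a => a.hom) (zero_of_epi_comp b h)
  refine Preadditive.epi_of_cancel_zero _ fun c hc => ?_
  obtain ⟨d, hd⟩ := CokernelCofork.IsColimit.desc' (isColimitCoker b.hom) c hc
  exact hd.symm.trans ((congrArg (· ≫ d) h0).trans zero_comp)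

lemma locally_surjective_of_epi (b : M ⟶ M') [Epi b] {U : (Xbar kbar p).Etale}
    (y : M'.obj.sec U) : ∃ R ∈ (Xbar kbar p).smallEtaleTopology U,
      ∀ (V : (Xbar kbar p).Etale) (f : V ⟶ U), R f →
        ∃ x : M.obj.sec V, hs b.hom.hom V x = M'.obj.res f y :=
  (epi_iff_locally_surjective b.hom.hom).1 inferInstance U y

/-- The kernel of `b` is an object of `𝒯_Ĝ`. Exactness lifts its inclusion through `a` after an
epimorphism, along which sections lift locally. -/
lemma locally_of_exact (a : M ⟶ M') (b : M' ⟶ M'') (w : a ≫ b = 0)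
    (h : (ShortComplex.mk a b w).Exact) {U : (Xbar kbar p).Etale} (y : M'.obj.sec U)
    (hy : hs b.hom.hom U y = 0) : ∃ R ∈ (Xbar kbar p).smallEtaleTopology U,
      ∀ (V : (Xbar kbar p).Etale) (f : V ⟶ U), R f →
        ∃ x : M.obj.sec V, hs a.hom.hom V x = M'.obj.res f y := by
  let K : TGhat kbar p := ⟨(ker b.hom).toES,
    isContinuous_of_injective (ker b.hom).incl (ker b.hom).incl_injective M'.property⟩
  let ι : K ⟶ M' := ObjectProperty.homMk (ker b.hom).incl
  have hι : ι ≫ b = 0 := ObjectProperty.hom_ext _ (ker_comp b.hom)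
  obtain ⟨A, π, _, c, hc⟩ := h.exact_up_to_refinements ι hι
  obtain ⟨R, hR, hx⟩ := locally_surjective_of_epi π (U := U) ((ker b.hom).toSec y hy)
  refine ⟨R, hR, fun V f hf => ?_⟩
  obtain ⟨x, hx⟩ := hx V f hf
  refine ⟨hs c.hom.hom V x, ?_⟩
  have e1 := congrArg (fun d => hs d.hom.hom V x) hc
  have e2 := congrArg (hs ι.hom.hom V) hx
  exact e1.symm.trans (e2.trans (hs_rs ι.hom.hom f _))

end LocalExact

/-! ### Sections of `γ_* F` as Frobenius invariants. -/

section Invariants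

variable {k : Type u} [Field k] [Finite k] {kbar : Type u} [Field kbar] [Algebra k kbar]
variable [IsAlgClosure k kbar] {X : Scheme.{u}} {p : X ⟶ Spec (CommRingCat.of k)}
variable [LocallyOfFiniteType p] (F : TG kbar p) {P : Model kbar p}

/-- The counit on sections. -/
def counitSec (P : Model kbar p) : ((gammaLower kbar p).obj F).obj.sec P.U →+ F.sec P.U :=
  hs ((gammaAdjunction kbar p).counit.app F).hom P.U

/-- The embedding of `γ_* F` into the coinduced sheaf, on sections. -/
def inclSec (P : Model kbar p) : ((gammaLower kbar p).obj F).obj.sec P.U →+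
    ((coind kbar p).obj F.sheaf).obj.sec P.U :=
  hs (gammaIncl F).hom.hom P.U

/-- This is equivariance of the counit. The components at the powers of `φ` determine a section of
the coinduced sheaf, so the counit determines `z`. -/
lemma evPhi_inclSec (i : ℤ) (z : ((gammaLower kbar p).obj F).obj.sec P.U) :
    Model.evPhi P F i (inclSec F P z) = Model.phiPow F P i (counitSec F P z) := by
  have e := hom_smul ((gammaAdjunction kbar p).counit.app F) (frobG k kbar ^ i) P.U z
  exact e

lemma inclSec_injective : Function.Injective (inclSec F P) := by
  refine (injective_iff_map_eq_zero _).2 fun z hz => ?_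
  let b := gammaIncl F
  let K : TGhat kbar p := ⟨(ker b.hom).toES, isContinuous_of_injective (ker b.hom).incl
    (ker b.hom).incl_injective ((gammaLower kbar p).obj F).property⟩
  let ι : K ⟶ (gammaLower kbar p).obj F := ObjectProperty.homMk (ker b.hom).incl
  have hι : ι ≫ gammaIncl F = 0 := ObjectProperty.hom_ext _ (ker_comp b.hom)
  exact congrArg (fun a => hs a.hom.hom P.U ((ker b.hom).toSec z hz)) (zero_of_comp_mono _ hι)

lemma counitSec_injective : Function.Injective (counitSec F P) := by
  refine (injective_iff_map_eq_zero _).2 fun z hz => ?_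
  refine (injective_iff_map_eq_zero _).1 (inclSec_injective F) z ?_
  obtain ⟨n, _, hn⟩ := Model.exists_isFixed (isSmooth _ (inclSec F P z))
    (Classical.arbitrary P.Level)
  refine (Model.eq_sum_spreadPhi F hn).trans (Finset.sum_eq_zero fun i _ => ?_)
  rw [evPhi_inclSec, hz, map_zero, map_zero]

lemma levelAct_counitSec {n : P.Level} {z : ((gammaLower kbar p).obj F).obj.sec P.U}
    (hz : Model.IsFixed ((gammaLower kbar p).obj F).obj n z) :
    P.levelAct F n (counitSec F P z) = counitSec F P z := by
  have e := hom_levelAct ((gammaAdjunction kbar p).counit.app F) n z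
  refine e.symm.trans (congrArg (counitSec F P) ?_)
  have h := frob_pow_mem_levelGroup (k := k) (kbar := kbar) n.val
  rw [← zpow_natCast] at h
  exact hz _ h (n.le_stab h)

lemma exists_inclSec {s : ((coind kbar p).obj F.sheaf).obj.sec P.U}
    (hs' : hs (shift F - 𝟙 _ : (coind kbar p).obj F.sheaf ⟶ _).hom.hom P.U s = 0) :
    ∃ z, inclSec F P z = s := by
  let b : (coind kbar p).obj F.sheaf ⟶ (coind kbar p).obj F.sheaf := shift F - 𝟙 _
  let K : TGhat kbar p := ⟨(ker b.hom).toES,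
    isContinuous_of_injective (ker b.hom).incl (ker b.hom).incl_injective
      ((coind kbar p).obj F.sheaf).property⟩
  let ι : K ⟶ (coind kbar p).obj F.sheaf := ObjectProperty.homMk (ker b.hom).incl
  have hι : ι ≫ b = 0 := ObjectProperty.hom_ext _ (ker_comp b.hom)
  obtain ⟨l, hl⟩ := KernelFork.IsLimit.lift' (isLimitGammaIncl F) ι hι
  refine ⟨hs l.hom.hom P.U ((ker b.hom).toSec s hs'), ?_⟩
  exact congrArg (fun a => hs a.hom.hom P.U ((ker b.hom).toSec s hs')) hl

/-- If `φ^n x = x`, then `∑_{i<n} base n i x` is killed by `t - 1`, since the telescoped difference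
is `base n 0 (φ^n x - x)`. It therefore comes from `γ_* F`, and its component at index 0 is `x`. -/
lemma exists_counitSec {n : P.Level} {x : F.sec P.U} (hx : P.levelAct F n x = x) :
    ∃ z, counitSec F P z = x := by
  have e := Model.sub_one_sum_base F n x n.val 0
  rw [Model.base_add_level, hx, sub_self] at e
  simp only [zero_add] at e
  obtain ⟨z, hz⟩ := exists_inclSec F e
  refine ⟨z, Model.phiPow_injective F ((0 : ℕ) : ℤ) ?_⟩
  rw [← evPhi_inclSec, hz]
  exact Model.evPhi_sum_base F n (fun _ => x) n.pos

lemma isColimInv : IsColimInv F := by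
  intro P
  refine ⟨counitSec_injective F, Set.Subset.antisymm ?_ ?_⟩
  · rintro _ ⟨z, rfl⟩
    obtain ⟨n, _, hn⟩ := Model.exists_isFixed (isSmooth ((gammaLower kbar p).obj F) (P := P) z)
      (Classical.arbitrary P.Level)
    exact ⟨n, levelAct_counitSec F hn⟩
  · rintro x ⟨n, hx⟩
    exact exists_counitSec F hx

end Invariants

/-! ### `R¹γ_* F` and the norm system of coinvariants. -/

section Coinvariants

variable {k : Type u} [Field k] [Finite k] {kbar : Type u} [Field kbar] [Algebra k kbar]
variable [IsAlgClosure k kbar] {X : Scheme.{u}} {p : X ⟶ Spec (CommRingCat.of k)}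

namespace Model

variable (F : TG kbar p) {P Q : Model kbar p}

lemma coinvMk_norm {n n' : P.Level} (h : n ≤ n') (x : F.sec P.U) :
    P.coinvMk F n' (P.norm F n n' x) = P.coinvMk F n x :=
  AddCommGroup.DirectLimit.of_f (G := P.Coinv F) (f := P.coinvMap F) (i := n) (j := n') (hij := h)
    (x := QuotientAddGroup.mk' (P.levelActSubOne F n).range x)

lemma exists_coinvMk [LocallyOfFiniteType p] (z : P.colimCoinv F) :
    ∃ n x, P.coinvMk F n x = z := by
  induction z using AddCommGroup.DirectLimit.induction_on with
  | ih n y =>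
    obtain ⟨x, rfl⟩ := QuotientAddGroup.mk'_surjective _ y
    exact ⟨n, x, rfl⟩

lemma mk_levelAct (n : P.Level) (x : F.sec P.U) :
    (QuotientAddGroup.mk' (P.levelActSubOne F n).range) (P.levelAct F n x) =
      QuotientAddGroup.mk' (P.levelActSubOne F n).range x := by
  refine ((QuotientAddGroup.eq (s := (P.levelActSubOne F n).range)).2 ⟨x, ?_⟩).symm
  rw [levelActSubOne_apply, sub_eq_neg_add]

/-- The isomorphism `φ^i : F(U) ≃ F(φ^i U)`. -/
def phiPowEquiv (i : ℤ) : F.sec P.U ≃+ F.sec (P.phiU i) :=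
  AddEquiv.ofBijective (phiPow F P i) ⟨phiPow_injective F i, phiPow_surjective F i⟩

variable [LocallyOfFiniteType p]

/-- The sum of the components of a section of the coinduced sheaf, in the coinvariants. -/
def traceCoinv (n : P.Level) : ((coind kbar p).obj F.sheaf).obj.sec P.U →+ P.Coinv F n :=
  ∑ i ∈ Finset.range n.val, (QuotientAddGroup.mk' (P.levelActSubOne F n).range).comp
    ((phiPowEquiv F (i : ℤ)).symm.toAddMonoidHom.comp (evPhi P F i))

lemma traceCoinv_sum_base (n : P.Level) (x : ℕ → F.sec P.U) :
    traceCoinv F n (∑ i ∈ Finset.range n.val, base F n i (x i)) =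
      ∑ i ∈ Finset.range n.val, QuotientAddGroup.mk' (P.levelActSubOne F n).range (x i) := by
  rw [traceCoinv, AddMonoidHom.finsetSum_apply]
  refine Finset.sum_congr rfl fun i hi => ?_
  refine congrArg (QuotientAddGroup.mk' (P.levelActSubOne F n).range) ?_
  refine (congrArg (phiPowEquiv F (i : ℤ)).symm
    (evPhi_sum_base F n x (Finset.mem_range.1 hi))).trans ?_
  exact (phiPowEquiv F (i : ℤ)).symm_apply_apply (x i)

lemma traceCoinv_base_of_lt (n : P.Level) {i : ℕ} (hi : i < n.val) (x : F.sec P.U) :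
    traceCoinv F n (base F n i x) = QuotientAddGroup.mk' (P.levelActSubOne F n).range x := by
  have e := traceCoinv_sum_base F n (Pi.single i x)
  rw [Finset.sum_eq_single i (fun j _ hj => by rw [Pi.single_eq_of_ne hj, map_zero])
      (fun h => absurd (Finset.mem_range.2 hi) h),
    Finset.sum_eq_single i (fun j _ hj => by rw [Pi.single_eq_of_ne hj, map_zero])
      (fun h => absurd (Finset.mem_range.2 hi) h), Pi.single_eq_same] at e
  exact e

/-- The boundary case `i = n` is included because `t` moves the last index `n - 1` to `n`. That
index wraps around to 0 with a factor `φ^n`, which is invisible in the coinvariants. -/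
lemma traceCoinv_base (n : P.Level) {i : ℕ} (hi : i ≤ n.val) (x : F.sec P.U) :
    traceCoinv F n (base F n i x) = QuotientAddGroup.mk' (P.levelActSubOne F n).range x := by
  obtain hi | rfl := hi.lt_or_eq
  · exact traceCoinv_base_of_lt F n hi x
  · have e := base_add_level F n 0 x
    rw [zero_add] at e
    rw [e]
    exact (traceCoinv_base_of_lt F n n.pos _).trans (mk_levelAct F n x)

/-- `t` only changes the index, which the trace does not see. So the trace separates coinvariants
modulo `(t - 1)s` for `s` fixed at level `n`. -/
lemma traceCoinv_shift_sub_one {n : P.Level} {s : ((coind kbar p).obj F.sheaf).obj.sec P.U}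
    (hs' : IsFixed ((coind kbar p).obj F.sheaf).obj n s) :
    traceCoinv F n (hs (shift F - 𝟙 _ : (coind kbar p).obj F.sheaf ⟶ _).hom.hom P.U s) = 0 := by
  obtain ⟨x, rfl⟩ := exists_eq_sum_base F hs'
  rw [map_sum, map_sum]
  refine Finset.sum_eq_zero fun i hi => ?_
  have e : hs (shift F - 𝟙 _ : (coind kbar p).obj F.sheaf ⟶ _).hom.hom P.U (base F n i (x i)) =
      hs (shift F).hom.hom P.U (base F n i (x i)) - base F n i (x i) := hs_thom_sub _ _ _
  rw [e, shift_base, map_sub, sub_eq_zero]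
  have hi' := Finset.mem_range.1 hi
  exact (traceCoinv_base F n (i := i + 1) hi' (x i)).trans
    (traceCoinv_base F n hi'.le (x i)).symm

variable {B : TGhat kbar p} (π : (coind kbar p).obj F.sheaf ⟶ B)

variable {F π} in
lemma hs_base_add (w : (shift F - 𝟙 _) ≫ π = 0) (n : P.Level) (i : ℤ) (m : ℕ) (x : F.sec P.U) :
    hs π.hom.hom P.U (base F n (i + m) x) = hs π.hom.hom P.U (base F n i x) := by
  rw [← sub_eq_zero, ← map_sub, ← sub_one_sum_base]
  exact congrArg (fun a => hs a.hom.hom P.U _) w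

variable {F π} in
-- Modulo the image of `t - 1` the index of a component is irrelevant, so only its value in `F(U)`
-- matters.
lemma hs_base (w : (shift F - 𝟙 _) ≫ π = 0) (n : P.Level) (i : ℤ) (x : F.sec P.U) :
    hs π.hom.hom P.U (base F n i x) = hs π.hom.hom P.U (base F n 0 x) := by
  obtain ⟨m, rfl | rfl⟩ := i.eq_nat_or_neg
  · have := hs_base_add w n 0 m x
    rwa [zero_add] at this
  · have := hs_base_add w n (-m) m x
    rw [neg_add_cancel] at this
    exact this.symm

variable {F π} in
/-- The homomorphism from the colimit of the coinvariants given by a morphism that coequalizes `t`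
and the identity. -/
def coinvToSec (w : (shift F - 𝟙 _) ≫ π = 0) (P : Model kbar p) :
    P.colimCoinv F →+ ((gammaUpper kbar p).obj B).sec P.U :=
  AddCommGroup.DirectLimit.lift _ _ _
    (fun n => QuotientAddGroup.lift _ ((hs π.hom.hom P.U).comp (base F n 0)) (by
      rintro _ ⟨x, rfl⟩
      have e : hs π.hom.hom P.U (base F n 0 (P.levelActSubOne F n x)) = 0 := by
        -- Applying `φ^n` amounts to raising the index by `n`, which has no effect after `π`.
        rw [levelActSubOne_apply, map_sub, map_sub, sub_eq_zero, ← base_add_level]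
        exact hs_base w n _ x
      exact e))
    (fun n n' h y => by
      obtain ⟨x, rfl⟩ := QuotientAddGroup.mk'_surjective _ y
      change hs π.hom.hom P.U (base F n' 0 (P.norm F n n' x)) = hs π.hom.hom P.U (base F n 0 x)
      -- Splitting the coset at level `n'` and then forgetting the indices leaves the norm of `x`.
      rw [base_eq_sum F h, norm, AddMonoidHom.finsetSum_apply, map_sum, map_sum, map_sum]
      exact Finset.sum_congr rfl fun j _ => (hs_base w n' _ _).symm)

variable {F π}

lemma coinvToSec_coinvMk (w : (shift F - 𝟙 _) ≫ π = 0) (n : P.Level) (x : F.sec P.U) :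
    coinvToSec w P (P.coinvMk F n x) = hs π.hom.hom P.U (base F n 0 x) :=
  AddCommGroup.DirectLimit.lift_of _ _ _ _ _

omit [LocallyOfFiniteType p] in
lemma resSemilinear_eq (E : TG kbar p) {a : ℤ} {f : P.U.left ⟶ Q.U.left} (hf : IsSemilinear a f)
    (w : f ≫ str Q.U ≫ act (weilAction kbar p) (frobG k kbar ^ a)⁻¹ = str P.U) (x : E.sec Q.U) :
    resSemilinear E hf x = phiPow E P a (E.pull (frobG k kbar ^ a)⁻¹ f w x) :=
  res_ofSemilinear_eq_smul E (mul_inv_cancel _) x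

lemma coinvToSec_natural (w : (shift F - 𝟙 _) ≫ π = 0) {a : ℤ} {f : P.U.left ⟶ Q.U.left}
    (hf : IsSemilinear a f) {z : Q.colimCoinv F} {z' : P.colimCoinv F}
    (h : CoinvRestr F hf z z') :
    resSemilinear ((gammaUpper kbar p).obj B) hf (coinvToSec w Q z) =
      phiPow ((gammaUpper kbar p).obj B) P a (coinvToSec w P z') := by
  obtain ⟨n, m, x, x', hc, hx, rfl, rfl⟩ := h
  have wf : f ≫ str Q.U ≫ act (weilAction kbar p) (frobG k kbar ^ a)⁻¹ = str P.U :=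
    comp_act_eq hf
  rw [resSemilinear_eq _ hf wf] at hx ⊢
  obtain rfl := phiPow_injective F a hx
  refine congrArg (phiPow ((gammaUpper kbar p).obj B) P a) ?_
  rw [coinvToSec_coinvMk, coinvToSec_coinvMk]
  refine (hom_pull ((gammaUpper kbar p).map π) (w := wf) (base F m 0 x)).symm.trans ?_
  refine (congrArg (hs π.hom.hom P.U) (pull_base F hf hc 0 x wf)).trans ?_
  exact hs_base w n _ _

lemma exists_compatible_fixed {M : TGhat kbar p} (f : P.U ⟶ Q.U) (s : M.obj.sec P.U)
    (m : Q.Level) : ∃ (n : P.Level) (m' : Q.Level), m ≤ m' ∧ CompatibleAt f.left n m' ∧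
      IsFixed M.obj n s := by
  obtain ⟨N, hN, hNf⟩ := exists_alpha_comm (P := P) (Q := Q) (g := 1) f.left
    (by rw [act_one, Category.comp_id, str_w])
  obtain ⟨m₀, hm₀, hle⟩ := m.exists_le hN
  obtain ⟨h₀, -, -⟩ := hNf _ (hle (frob_pow_mem_levelGroup _))
  obtain ⟨n, hn, hs⟩ := exists_isFixed (isSmooth M s) ⟨m₀.val, m₀.pos, h₀⟩
  obtain ⟨_, h₂, e⟩ := hNf _ (hle (levelGroup_anti hn (frob_pow_mem_levelGroup n.val)))
  exact ⟨n, ⟨n.val, n.pos, h₂⟩, hm₀.trans hn, ⟨rfl, e.symm⟩, hs⟩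

/-- At a level `n` where `y` is fixed and `f` is compatible, the trace kills `(t - 1)y`. The trace
of the restriction of `base n₀ 0 x` is the class of the restricted norm of `x`, so this class
vanishes. -/
lemma coinvRestr_zero {n₀ : Q.Level} {x : F.sec Q.U} {f : P.U ⟶ Q.U}
    {y : ((coind kbar p).obj F.sheaf).obj.sec P.U}
    (hy : hs (shift F - 𝟙 _ : (coind kbar p).obj F.sheaf ⟶ _).hom.hom P.U y =
      ((coind kbar p).obj F.sheaf).obj.res f (base F n₀ 0 x)) :
    CoinvRestr F (isSemilinear_zero f) (Q.coinvMk F n₀ x) 0 := by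
  obtain ⟨n, m, hm, hc, hfix⟩ := exists_compatible_fixed f y n₀
  have hf := isSemilinear_zero f
  have wf : f.left ≫ str Q.U ≫ act (weilAction kbar p) (frobG k kbar ^ (0 : ℤ))⁻¹ = str P.U :=
    comp_act_eq hf
  refine ⟨n, m, Q.norm F n₀ m x, F.pull (frobG k kbar ^ (0 : ℤ))⁻¹ f.left wf (Q.norm F n₀ m x), hc,
    (resSemilinear_eq F hf wf _).symm, (coinvMk_norm F hm x).symm, ?_⟩
  refine (map_zero (AddCommGroup.DirectLimit.of (P.Coinv F) (P.coinvMap F) n)).symm.trans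
    (congrArg (AddCommGroup.DirectLimit.of (P.Coinv F) (P.coinvMap F) n) ?_)
  rw [← traceCoinv_shift_sub_one F hfix, hy]
  have w1 : f.left ≫ str Q.U ≫ act (weilAction kbar p) 1 = str P.U := by
    rw [act_one, Category.comp_id, str_w]
  let E := (gammaUpper kbar p).obj ((coind kbar p).obj F.sheaf)
  have e (s : E.sec Q.U) : E.res f s = E.pull (frobG k kbar ^ (0 : ℤ))⁻¹ f.left wf s :=
    (E.res_eq_pull f w1 s).trans (E.pull_congr (by simp) rfl s)
  refine (congrArg (traceCoinv F n) (e _)).trans ?_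
  have hnm : n.val = m.val := hc.1
  have hdiv : n₀.val * (m.val / n₀.val) = m.val := Nat.mul_div_cancel' hm
  rw [norm, AddMonoidHom.finsetSum_apply, base_eq_sum F hm, map_sum, map_sum]
  let T : E.sec Q.U →+ P.Coinv F n :=
    (traceCoinv F n).comp (E.pull (frobG k kbar ^ (0 : ℤ))⁻¹ f.left wf)
  refine (map_sum T _ _).trans ?_
  refine Finset.sum_congr rfl fun j hj => ?_
  have hlt : n₀.val * j ≤ n.val := by
    rw [hnm, ← hdiv]
    exact Nat.mul_le_mul_left _ (Finset.mem_range.1 hj).le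
  refine Eq.trans (congrArg (traceCoinv F n) ?_) (traceCoinv_base F n hlt _)
  refine (pull_base F hf hc _ _ wf).trans ?_
  refine congrArg (fun i => base F n i _) ?_
  push_cast
  ring

/-- A section of the cokernel lifts locally to a sum of terms `base n i (x i)`, whose indices may be
dropped; this gives local surjectivity. A section that maps to zero is locally in the image of `t -
1`, and the trace then shows that its class vanishes locally. -/
lemma isColimCoinvSheaf (w : (shift F - 𝟙 _) ≫ π = 0)
    (hπ : IsColimit (CokernelCofork.ofπ π w)) : IsColimCoinvSheaf F B (coinvToSec w) where
  natural P Q a f hf z z' h := coinvToSec_natural w hf h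
  locally_injective Q z hz := by
    have := IsAlgClosure.isAlgebraic (R := k) (K := kbar)
    obtain ⟨n₀, x, rfl⟩ := exists_coinvMk F z
    rw [coinvToSec_coinvMk] at hz
    obtain ⟨R, hR, h⟩ := locally_of_exact _ π w (ShortComplex.exact_of_g_is_cokernel _ hπ) _ hz
    obtain ⟨ι, _, P, f, hf, hcov⟩ := exists_finite_model_cover Q hR
    refine ⟨ι, P, f, hcov, fun j => ?_⟩
    obtain ⟨y, hy⟩ := h _ _ (hf j)
    exact coinvRestr_zero hy
  locally_surjective Q s := by
    have := IsAlgClosure.isAlgebraic (R := k) (K := kbar)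
    have : Epi π := Cofork.IsColimit.epi hπ
    obtain ⟨R, hR, h⟩ := locally_surjective_of_epi π s
    obtain ⟨ι, _, P, f, hf, hcov⟩ := exists_finite_model_cover Q hR
    refine ⟨ι, P, f, hcov, fun j => ?_⟩
    obtain ⟨y, hy⟩ := h _ _ (hf j)
    obtain ⟨n, _, hn⟩ := exists_isFixed (isSmooth _ y) (Classical.arbitrary (P j).Level)
    obtain ⟨x, rfl⟩ := exists_eq_sum_base F hn
    refine ⟨∑ i ∈ Finset.range n.val, (P j).coinvMk F n (x i), Eq.trans ?_ hy⟩
    rw [map_sum, map_sum]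
    exact Finset.sum_congr rfl fun i _ =>
      (coinvToSec_coinvMk w n (x i)).trans (hs_base w n i (x i)).symm

end Model

lemma exists_cokernel_homology_RGamma [LocallyOfFiniteType p] {F : TG kbar p}
    (I : InjectiveResolution F) :
    ∃ (π : (coind kbar p).obj F.sheaf ⟶ (RGamma kbar p I).homology 1)
      (w : (shift F - 𝟙 _) ≫ π = 0), Nonempty (IsColimit (CokernelCofork.ofπ π w)) := by
  obtain ⟨e⟩ := (quasiIsomorphic_shift I).homologyIso 1
  obtain ⟨π, w, ⟨hπ⟩⟩ := exists_cokernel_homology_twoTerm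
    (shift F - 𝟙 ((coind kbar p).obj F.sheaf))
  have w' : (shift F - 𝟙 ((coind kbar p).obj F.sheaf)) ≫ π ≫ e.inv = 0 := by
    rw [← Category.assoc, w, zero_comp]
  exact ⟨π ≫ e.inv, w', ⟨IsColimit.ofIsoColimit hπ (Cofork.ext e.symm rfl)⟩⟩

end Coinvariants

end WeilEtale

end

theorem theorem3p1 {k : Type u} [Field k] [Finite k] {kbar : Type u} [Field kbar] [Algebra k kbar]
    [IsAlgClosure k kbar] {X : AlgebraicGeometry.Scheme.{u}}
    (p : X ⟶ AlgebraicGeometry.Spec (CommRingCat.of k))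
    [AlgebraicGeometry.LocallyOfFiniteType p] [AlgebraicGeometry.QuasiCompact p] :
    ∃ (_ : CategoryWithHomology (WeilEtale.TGhat kbar p))
      (_ : (WeilEtale.gammaUpper kbar p).IsLeftAdjoint),
      HasInjectiveResolutions (WeilEtale.TG kbar p) ∧
      ∀ (F : WeilEtale.TG kbar p) (I : InjectiveResolution F),
        (∃ (A : WeilEtale.TGhat kbar p) (t : A ⟶ A)
          (e : ∀ P : WeilEtale.Model kbar p,
            P.colimSum F ≃+ ((WeilEtale.gammaUpper kbar p).obj A).sec P.U),
          WeilEtale.IsColimSumSheaf F t e ∧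
          WeilEtale.QuasiIsomorphic (WeilEtale.RGamma kbar p I) (WeilEtale.twoTerm (t - 𝟙 A))) ∧
        WeilEtale.IsColimInv F ∧
        (∃ S : ∀ P : WeilEtale.Model kbar p, P.colimCoinv F →+
            ((WeilEtale.gammaUpper kbar p).obj ((WeilEtale.RGamma kbar p I).homology 1)).sec P.U,
          WeilEtale.IsColimCoinvSheaf F ((WeilEtale.RGamma kbar p I).homology 1) S) ∧
        ∀ i : ℕ, 1 < i → IsZero ((WeilEtale.RGamma kbar p I).homology i) := by
  refine ⟨inferInstance, inferInstance, inferInstance, fun F I => ⟨?_, ?_, ?_, fun i hi => ?_⟩⟩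
  · exact ⟨_, WeilEtale.shift F, WeilEtale.Model.colimSumEquiv F,
      WeilEtale.Model.isColimSumSheaf_coind F, WeilEtale.quasiIsomorphic_shift I⟩
  · exact WeilEtale.isColimInv F
  · obtain ⟨π, w, ⟨hπ⟩⟩ := WeilEtale.exists_cokernel_homology_RGamma I
    exact ⟨WeilEtale.Model.coinvToSec w, WeilEtale.Model.isColimCoinvSheaf w hπ⟩
  · obtain ⟨e⟩ := (WeilEtale.quasiIsomorphic_shift I).homologyIso i
    exact (WeilEtale.isZero_homology_twoTerm _ i hi).of_iso e
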